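/- **Setting.** Let $\mu>0$, $2\mu+\lambda>0$, $\omega>0$, $k_p=\omega/\sqrt{\lambda+2\mu}$, $k_s=\omega/\sqrt{\mu}$. A rigid body is a bounded open set $\Omega\subset\mathbb R^2$ with Lipschitz boundary whose exterior $\mathbb R^2\setminus\overline\Omega$ is connected. For $v=(v_1,v_2)\in\mathbb R^2$ put $v^\perp=(-v_2,v_1)$, and let $\nabla^\perp=(-\partial_2,\partial_1)$, $\operatorname{div}^\perp u=-\partial_2u_1+\partial_1u_2$. For $d\in\mathbb S=\{x\in\mathbb R^2:|x|=1\}$ let $u^{in}_p(x)=d\,e^{ik_p x\cdot d}$ and $u^{in}_s(x)=d^\perp e^{ik_s x\cdot d}$. For $m\in\{p,s\}$, the scattered field $u^{sc}_{\Omega,m}(\cdot,d)$ is the solution, smooth in $\mathbb R^2\setminus\overline\Omega$ and of class $H^1$ on $B_R\setminus\overline\Omega$ for every ball $B_R=\{|x|<R\}$, of $$\mu\Delta u+(\lambda+\mu)\nabla\operatorname{div}u+\omega^2u=0\ \text{ in }\mathbb R^2\setminus\overline\Omega,\qquad u+u^{in}_m=0\ \text{ on }\partial\Omega\ \text{(in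 the trace sense)},$$ whose parts $u_p=-k_p^{-2}\nabla\operatorname{div}u$ and $u_s=-k_s^{-2}\nabla^\perp\operatorname{div}^\perp u$ satisfy $\partial_r u_n-ik_nu_n=o(r^{-1/2})$ as $r=|x|\to\infty$, uniformly in $\hat x=x/|x|$, for $n=p,s$. Its far field patterns $u^\infty_{\Omega,mn}(\cdot,d):\mathbb S\to\mathbb C$, $n=p,s$, are given by $$u_n(x)=\frac{k_n}{\omega}\,\frac{e^{i\pi/4}}{\sqrt{8\pi\omega}}\,\frac{e^{ik_n|x|}}{\sqrt{|x|}}\,u^\infty_{\Omega,mn}(\hat x,d)\,e_n(\hat x)+O(|x|^{-3/2}),\qquad |x|\to\infty,$$ uniformly in $\hat x$, where $e_p(\hat x)=\hat x$ and $e_s(\hat x)=\hat x^\perp$. **Theorem.** Let $\Omega$ be a rigid body, $h\in\mathbb R^2$, and $\Omega_h=\{z+h: z\in\Omega\}$. For every $\omega>0$, all $\hat x,d\in\mathbb S$ and all $m,n\in\{p,s\}$, $$|u^\infty_{\Omega_h,mn}(\hat x,d)|=|u^\infty_{\Omega,mn}(\hat x,d)|,$$ and explicitly $$u^\infty_{\Omega_h,mn}(\hat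 x,d)=e^{ik_m h\cdot d}\,e^{-ik_n h\cdot\hat x}\,u^\infty_{\Omega,mn}(\hat x,d).$$ (That is: if a pair of functions is the pair of far field patterns for $\Omega$, then its product with these factors is one for $\Omega_h$; and any far field patterns for $\Omega$ and $\Omega_h$ are related by the two identities.) -/

import Mathlib

open MeasureTheory

noncomputable section

/-- The plane `ℝ²` with its Euclidean norm. -/
abbrev Plane : Type := EuclideanSpace ℝ (Fin 2)

/-- `ℂ²`, the space of values of displacement fields. -/
abbrev CVec : Type := EuclideanSpace ℂ (Fin 2)

/-- The unit circle `𝕊`. -/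
abbrev Circle2 : Type := Metric.sphere (0 : Plane) 1

/-- The two wave types: compressional (`p`) and shear (`s`). -/
inductive Mode : Type
  | p
  | s

/-- Rotation of a vector anticlockwise by `π / 2`. -/
def perp (v : Plane) : Plane := !₂[-(v 1), v 0]

/-- A real vector, seen as a complex vector. -/
def toCVec (v : Plane) : CVec := !₂[((v 0 : ℝ) : ℂ), ((v 1 : ℝ) : ℂ)]

/-- The unit vector in which the `p`- and `s`-waves travelling in direction `d` are polarized:
`d` for a compressional wave and `d^⊥` for a shear wave. -/
def polarization : Mode → Plane → Plane
  | Mode.p, d => d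
  | Mode.s, d => perp d

/-- The wave numbers `k_p = ω / √(λ + 2μ)` and `k_s = ω / √μ`. -/
def waveNumber (lam mu ω : ℝ) : Mode → ℝ
  | Mode.p => ω / Real.sqrt (lam + 2 * mu)
  | Mode.s => ω / Real.sqrt mu

/-! ### Differential operators -/

/-- The partial derivative `∂ᵢ`. -/
def pderiv {F : Type*} [NormedAddCommGroup F] [NormedSpace ℝ F]
    (i : Fin 2) (g : Plane → F) (x : Plane) : F :=
  fderiv ℝ g x (EuclideanSpace.single i 1)

/-- `∇ g = (∂₁ g, ∂₂ g)`. -/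
def grad (g : Plane → ℂ) (x : Plane) : CVec := !₂[pderiv 0 g x, pderiv 1 g x]

/-- `∇^⊥ g = (-∂₂ g, ∂₁ g)`. -/
def gradPerp (g : Plane → ℂ) (x : Plane) : CVec := !₂[-pderiv 1 g x, pderiv 0 g x]

/-- `div u = ∂₁ u₁ + ∂₂ u₂`. -/
def dvg (u : Plane → CVec) (x : Plane) : ℂ :=
  pderiv 0 (fun y => u y 0) x + pderiv 1 (fun y => u y 1) x

/-- `div^⊥ u = -∂₂ u₁ + ∂₁ u₂`. -/
def dvgPerp (u : Plane → CVec) (x : Plane) : ℂ :=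
  -pderiv 1 (fun y => u y 0) x + pderiv 0 (fun y => u y 1) x

/-- The componentwise Laplacian `Δ u = ∂₁ ∂₁ u + ∂₂ ∂₂ u`. -/
def lapl (u : Plane → CVec) (x : Plane) : CVec :=
  pderiv 0 (pderiv 0 u) x + pderiv 1 (pderiv 1 u) x

/-- The Lamé operator `Δ* u = μ Δ u + (λ + μ) ∇ div u`. -/
def lameOp (lam mu : ℝ) (u : Plane → CVec) (x : Plane) : CVec :=
  (mu : ℂ) • lapl u x + ((lam + mu : ℝ) : ℂ) • grad (dvg u) x

/-- The compressional part `u_p = -k_p⁻² ∇ div u` and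
the shear part `u_s = -k_s⁻² ∇^⊥ div^⊥ u` of a displacement field. -/
def wavePart (lam mu ω : ℝ) : Mode → (Plane → CVec) → Plane → CVec
  | Mode.p, u => fun x => (-(1 / (waveNumber lam mu ω Mode.p : ℂ) ^ 2)) • grad (dvg u) x
  | Mode.s, u => fun x => (-(1 / (waveNumber lam mu ω Mode.s : ℂ) ^ 2)) • gradPerp (dvgPerp u) x

/-- The plane waves `u_p^in(x) = d e^{i k_p x·d}` and `u_s^in(x) = d^⊥ e^{i k_s x·d}`. -/
def planeWave (lam mu ω : ℝ) (m : Mode) (d : Plane) (x : Plane) : CVec :=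
  Complex.exp (Complex.I * ((waveNumber lam mu ω m * inner ℝ x d : ℝ) : ℂ)) •
    toCVec (polarization m d)

/-! ### Rigid bodies -/

/-- The exterior `ℝ² \ closure Ω`. -/
def exterior (Ω : Set Plane) : Set Plane := (closure Ω)ᶜ

/-- Near each of its boundary points, `Ω` is, in suitable Cartesian coordinates, the set of the
points that lie strictly below the graph of a Lipschitz function. -/
def HasLipschitzBoundary (Ω : Set Plane) : Prop :=
  ∀ x ∈ frontier Ω, ∃ (e : Plane ≃ᵃⁱ[ℝ] Plane) (g : ℝ → ℝ) (K : NNReal) (r : ℝ),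
    LipschitzWith K g ∧ 0 < r ∧
      ∀ y ∈ Metric.ball x r, (y ∈ Ω ↔ (e y) 1 < g ((e y) 0))

/-- Bounded open sets with Lipschitz boundary and connected exterior. -/
structure IsRigidBody (Ω : Set Plane) : Prop where
  isOpen : IsOpen Ω
  isBounded : Bornology.IsBounded Ω
  lipschitz : HasLipschitzBoundary Ω
  connected_exterior : IsConnected (exterior Ω)

/-! ### The scattering problem -/

/-- `u ∈ [H¹(B_R \ closure Ω)]²` for every `R`, for a field `u` that is smooth in the exterior of
`Ω` (so that its weak derivatives are the classical ones): the field and its first partial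
derivatives are square integrable over every bounded part of the exterior. -/
def IsH1Loc (Ω : Set Plane) (u : Plane → CVec) : Prop :=
  ∀ R : ℝ,
    MemLp u 2 (volume.restrict (Metric.ball 0 R ∩ exterior Ω)) ∧
    ∀ i, MemLp (pderiv i u) 2 (volume.restrict (Metric.ball 0 R ∩ exterior Ω))

/-- `u = 0` on `∂Ω` in the sense of `H¹` traces from the exterior: for every smooth cut-off
function `χ`, the field `χ u` lies in `[H¹₀(ℝ² \ closure Ω)]²`, the closure in the `H¹` norm of
the smooth fields with compact support in the exterior. -/
def VanishesOnBoundary (Ω : Set Plane) (u : Plane → CVec) : Prop :=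
  ∀ χ : Plane → ℝ, ContDiff ℝ (⊤ : ℕ∞) χ → HasCompactSupport χ → ∀ ε : ENNReal, 0 < ε →
    ∃ φ : Plane → CVec, ContDiff ℝ (⊤ : ℕ∞) φ ∧ HasCompactSupport φ ∧ tsupport φ ⊆ exterior Ω ∧
      eLpNorm (fun x => χ x • u x - φ x) 2 (volume.restrict (exterior Ω)) ≤ ε ∧
      ∀ i, eLpNorm (fun x => pderiv i (fun y => χ y • u y) x - pderiv i φ x) 2
        (volume.restrict (exterior Ω)) ≤ ε

/-- Kupradze's radiation condition: for `n = p, s`, uniformly in all directions,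
`∂u_n/∂r - i k_n u_n = o(r^{-1/2})` as `r → ∞`. -/
def IsRadiating (lam mu ω : ℝ) (u : Plane → CVec) : Prop :=
  ∀ n : Mode, ∀ ε : ℝ, 0 < ε → ∃ R : ℝ, 0 < R ∧ ∀ r : ℝ, R ≤ r → ∀ θ : Circle2,
    ‖fderiv ℝ (wavePart lam mu ω n u) (r • (θ : Plane)) (θ : Plane)
        - (Complex.I * (waveNumber lam mu ω n : ℂ)) • wavePart lam mu ω n u (r • (θ : Plane))‖
      ≤ ε / Real.sqrt r

/-- `u` is the scattered field of the rigid body `Ω` for the incident plane wave of type `m` with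
direction `d` (only the values of `u` in the exterior of `Ω` matter). -/
structure IsScatteredField (lam mu ω : ℝ) (Ω : Set Plane) (m : Mode) (d : Plane)
    (u : Plane → CVec) : Prop where
  smooth : ContDiffOn ℝ (⊤ : ℕ∞) u (exterior Ω)
  h1Loc : IsH1Loc Ω u
  navier : ∀ x ∈ exterior Ω, lameOp lam mu u x + ((ω : ℂ) ^ 2) • u x = 0
  dirichlet : VanishesOnBoundary Ω (fun x => u x + planeWave lam mu ω m d x)
  radiating : IsRadiating lam mu ω u

/-! ### Far field patterns -/

/-- The functions `f p` and `f s` on the unit circle are the compressional and shear far field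
patterns of `u`: for `n = p, s`,
`u_n(x) = (k_n / ω) (e^{iπ/4} / √(8πω)) (e^{i k_n |x|} / √|x|) f n (x̂) e_n + O(|x|^{-3/2})`
as `|x| → ∞`, uniformly in `x̂ = x / |x|`, where `e_p = x̂` and `e_s = x̂^⊥`. -/
def HasFarFieldPatterns (lam mu ω : ℝ) (u : Plane → CVec) (f : Mode → Circle2 → ℂ) : Prop :=
  ∀ n : Mode, ∃ C R : ℝ, 0 < R ∧ ∀ r : ℝ, R ≤ r → ∀ θ : Circle2,
    ‖wavePart lam mu ω n u (r • (θ : Plane))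
        - (((waveNumber lam mu ω n / ω : ℝ) : ℂ)
            * (Complex.exp (Complex.I * (Real.pi / 4 : ℝ)) / (Real.sqrt (8 * Real.pi * ω) : ℂ))
            * (Complex.exp (Complex.I * ((waveNumber lam mu ω n * r : ℝ) : ℂ))
                / (Real.sqrt r : ℂ))
            * f n θ) • toCVec (polarization n (θ : Plane))‖
      ≤ C * r ^ (-(3 / 2) : ℝ)

/-- `f n x̂ = u^∞_{Ω,mn}(x̂, d)` for `n = p, s`: the pair `f` consists of the compressional and the
shear far field pattern of the field scattered by the rigid body `Ω` when the incident field is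
the plane wave of type `m` with direction `d`. -/
def AreFarFieldPatterns (lam mu ω : ℝ) (Ω : Set Plane) (m : Mode) (d : Plane)
    (f : Mode → Circle2 → ℂ) : Prop :=
  ∃ u : Plane → CVec, IsScatteredField lam mu ω Ω m d u ∧ HasFarFieldPatterns lam mu ω u f

/-- The shifted body `Ω_h = {z + h : z ∈ Ω}`. -/
def shifted (Ω : Set Plane) (h : Plane) : Set Plane := {y | ∃ z ∈ Ω, y = z + h}

/-- The unimodular factor `e^{i k_m h·d} e^{-i k_n h·x̂}`. -/
def phaseFactor (lam mu ω : ℝ) (m n : Mode) (h d : Plane) (θ : Plane) : ℂ :=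
  Complex.exp (Complex.I * ((waveNumber lam mu ω m * inner ℝ h d : ℝ) : ℂ)) *
    Complex.exp (-(Complex.I * ((waveNumber lam mu ω n * inner ℝ h θ : ℝ) : ℂ)))

end

/-!
The scattered field of the moved body is, by translation invariance of the Lamé operator and of the
boundary condition, `c u(x - h)` with `c = e^{i k_m h·d}`, because the incident wave satisfies
`u^in(x) = c u^in(x - h)`. So the formula comes down to two facts: the far field and the radiation
condition may be referred to the moved origin `h` instead of `0`, and far field patterns are
uniquely determined by the body.

*The moved origin.* The radiation condition and the far field expansion bear on `∇P` for the
potentials `P = div u` and `P = div^⊥ u`, which solve Helmholtz equations (`IsOutgoing`). Replacing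
`x` by `x - h` changes the direction `x̂` by `O(1 / |x|)`, and the phase `k|x|` by
`-k h·x̂ + O(1 / |x|)`. To keep the error `O(|x|^{-3/2})` the pattern `F` must be Lipschitz, although
the expansion assumes no regularity of it. This is `IsOutgoing.exists_pattern_bound`: since `∇P` is
radial to leading order, `P` hardly varies across the ray; and the difference of `P` at two points
of a ray that are half a wave length apart determines `F(x̂)`. In the radiation condition the turn
of the direction meets the second derivatives of `P`; these are `o(r^{1/2})` since the radiation
condition controls those in the radial direction and the Helmholtz equation the others
(`IsOutgoing.hessian_isLittleO`). The results are `IsOutgoing.radiating_comp_sub` and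
`IsOutgoing.farField_comp_sub`, and with them `AreFarFieldPatterns.shifted`.

*Uniqueness.* Only the patterns, not the fields, need be unique, so that conservation of energy
suffices and Rellich's lemma is not needed. The difference `w` of two scattered fields vanishes on
the boundary. Testing its equation with `χ w` for a cut-off function `χ`, and taking imaginary
parts, shows that `w` has no net energy flux (`integral_fluxDensity_im`). In terms of the potentials
this flux is the sum of the fluxes of `div w` and of `div^⊥ w` with positive weights
(`flux_potential_add_eq_zero`). For `χ(x / R)` with `R` large, the flux of each potential approaches
its nonnegative radiated energy (`IsOutgoing.abs_flux_sub_outflow_le`), which stays away from zero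
unless the pattern vanishes (`IsOutgoing.exists_le_outflow`). Hence both patterns of `w` are zero
(`farFieldPattern_eq_zero`).
-/

noncomputable section

/-! ### Calculus of partial derivatives -/

section PartialDerivatives

variable {F : Type*} [NormedAddCommGroup F] [NormedSpace ℝ F]

lemma fderiv_apply_eq_pderiv (f : Plane → F) (x v : Plane) :
    fderiv ℝ f x v = v 0 • pderiv 0 f x + v 1 • pderiv 1 f x := by
  have hv : v = v 0 • EuclideanSpace.single 0 (1 : ℝ) + v 1 • EuclideanSpace.single 1 (1 : ℝ) := by
    ext i
    fin_cases i <;> simp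
  conv_lhs => rw [hv]
  simp only [map_add, map_smul, pderiv]

lemma ContDiffAt.pderiv {f : Plane → F} {x : Plane} (hf : ContDiffAt ℝ (⊤ : ℕ∞) f x) (i : Fin 2) :
    ContDiffAt ℝ (⊤ : ℕ∞) (pderiv i f) x :=
  (hf.fderiv_right (m := (⊤ : ℕ∞)) (by simp)).clm_apply contDiffAt_const

lemma ContDiffAt.differentiableAt_of_infty {f : Plane → F} {x : Plane}
    (hf : ContDiffAt ℝ (⊤ : ℕ∞) f x) : DifferentiableAt ℝ f x :=
  hf.differentiableAt (by simp)

lemma Filter.EventuallyEq.pderiv_eq {f g : Plane → F} {x : Plane} (h : f =ᶠ[nhds x] g)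
    (i : Fin 2) : pderiv i f x = pderiv i g x := by
  simp only [pderiv, h.fderiv_eq]

lemma pderiv_congr_of_isOpen {f g : Plane → F} {U : Set Plane} (hU : IsOpen U)
    (h : ∀ y ∈ U, f y = g y) {x : Plane} (hx : x ∈ U) (i : Fin 2) :
    pderiv i f x = pderiv i g x :=
  Filter.EventuallyEq.pderiv_eq (Filter.eventuallyEq_of_mem (hU.mem_nhds hx) h) i

lemma pderiv_comm {f : Plane → F} {x : Plane} (hf : ContDiffAt ℝ (⊤ : ℕ∞) f x) (i j : Fin 2) :
    pderiv i (pderiv j f) x = pderiv j (pderiv i f) x := by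
  have hd : DifferentiableAt ℝ (fderiv ℝ f) x :=
    (hf.fderiv_right (m := (⊤ : ℕ∞)) (by simp)).differentiableAt (by simp)
  have h2 : ∀ a b : Fin 2, pderiv a (pderiv b f) x =
      fderiv ℝ (fderiv ℝ f) x (EuclideanSpace.single a 1) (EuclideanSpace.single b 1) := by
    intro a b
    change fderiv ℝ (fun y => fderiv ℝ f y (EuclideanSpace.single b 1)) x _ = _
    rw [fderiv_clm_apply hd (differentiableAt_const _)]
    simp
  rw [h2, h2]
  have h3 : ((2 : ℕ∞) : WithTop ℕ∞) ≤ (⊤ : ℕ∞) := WithTop.coe_le_coe.2 le_top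
  exact (hf.isSymmSndFDerivAt (by simpa using h3)) _ _

lemma pderiv_add {f g : Plane → F} {x : Plane} (hf : DifferentiableAt ℝ f x)
    (hg : DifferentiableAt ℝ g x) (i : Fin 2) :
    pderiv i (fun y => f y + g y) x = pderiv i f x + pderiv i g x := by
  simp only [pderiv, fderiv_fun_add hf hg, _root_.add_apply]

lemma pderiv_sub {f g : Plane → F} {x : Plane} (hf : DifferentiableAt ℝ f x)
    (hg : DifferentiableAt ℝ g x) (i : Fin 2) :
    pderiv i (fun y => f y - g y) x = pderiv i f x - pderiv i g x := by
  simp only [pderiv, fderiv_fun_sub hf hg, _root_.sub_apply]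

lemma pderiv_neg (f : Plane → F) (x : Plane) (i : Fin 2) :
    pderiv i (fun y => -f y) x = -pderiv i f x := by
  simp only [pderiv, fderiv_fun_neg, _root_.neg_apply]

lemma pderiv_smul {χ : Plane → ℝ} {f : Plane → F} {x : Plane} (hχ : DifferentiableAt ℝ χ x)
    (hf : DifferentiableAt ℝ f x) (i : Fin 2) :
    pderiv i (fun y => χ y • f y) x = χ x • pderiv i f x + pderiv i χ x • f x := by
  simp only [pderiv, fderiv_fun_smul hχ hf, _root_.add_apply,
    _root_.smul_apply, ContinuousLinearMap.smulRight_apply]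

lemma pderiv_mul {f g : Plane → ℂ} {x : Plane} (hf : DifferentiableAt ℝ f x)
    (hg : DifferentiableAt ℝ g x) (i : Fin 2) :
    pderiv i (fun y => f y * g y) x = f x * pderiv i g x + pderiv i f x * g x := by
  simp only [pderiv, fderiv_fun_mul hf hg, _root_.add_apply,
    _root_.smul_apply, smul_eq_mul]
  ring

lemma pderiv_const_mul {f : Plane → ℂ} {x : Plane} (c : ℂ) (hf : DifferentiableAt ℝ f x)
    (i : Fin 2) : pderiv i (fun y => c * f y) x = c * pderiv i f x := by
  rw [pderiv_mul (differentiableAt_const c) hf]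
  simp [pderiv]

lemma pderiv_star {f : Plane → ℂ} {x : Plane} (i : Fin 2) :
    pderiv i (fun y => star (f y)) x = star (pderiv i f x) := by
  simp only [pderiv, fderiv_star]
  rfl

lemma pderiv_ofReal {f : Plane → ℝ} {x : Plane} (hf : DifferentiableAt ℝ f x) (i : Fin 2) :
    pderiv i (fun y => ((f y : ℝ) : ℂ)) x = ((pderiv i f x : ℝ) : ℂ) := by
  have := (Complex.ofRealCLM.hasFDerivAt.comp x hf.hasFDerivAt).fderiv
  simp only [pderiv]
  change fderiv ℝ (Complex.ofRealCLM ∘ f) x _ = _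
  rw [this]
  simp

lemma pderiv_apply {u : Plane → CVec} {x : Plane} (hu : DifferentiableAt ℝ u x) (i j : Fin 2) :
    pderiv i (fun y => u y j) x = (pderiv i u x) j := by
  have := ((PiLp.hasFDerivAt_apply (𝕜 := ℝ) 2 (u x) j).comp x hu.hasFDerivAt).fderiv
  simp only [pderiv]
  change fderiv ℝ ((fun f : CVec => f j) ∘ u) x _ = _
  rw [this]
  rfl

end PartialDerivatives

lemma ContDiffAt.coord {u : Plane → CVec} {x : Plane} (hu : ContDiffAt ℝ (⊤ : ℕ∞) u x) (j : Fin 2) :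
    ContDiffAt ℝ (⊤ : ℕ∞) (fun y => u y j) x :=
  (contDiffAt_piLp 2).1 hu j

@[simp] lemma grad_apply_zero (g : Plane → ℂ) (x : Plane) : grad g x 0 = pderiv 0 g x := rfl
@[simp] lemma grad_apply_one (g : Plane → ℂ) (x : Plane) : grad g x 1 = pderiv 1 g x := rfl
@[simp] lemma gradPerp_apply_zero (g : Plane → ℂ) (x : Plane) :
    gradPerp g x 0 = -pderiv 1 g x := rfl
@[simp] lemma gradPerp_apply_one (g : Plane → ℂ) (x : Plane) :
    gradPerp g x 1 = pderiv 0 g x := rfl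
@[simp] lemma toCVec_apply_zero (v : Plane) : toCVec v 0 = ((v 0 : ℝ) : ℂ) := rfl
@[simp] lemma toCVec_apply_one (v : Plane) : toCVec v 1 = ((v 1 : ℝ) : ℂ) := rfl

lemma CVec.norm_sq (z : CVec) : ‖z‖ ^ 2 = ‖z 0‖ ^ 2 + ‖z 1‖ ^ 2 := by
  rw [EuclideanSpace.norm_sq_eq, Fin.sum_univ_two]

lemma CVec.norm_coord_le (z : CVec) (i : Fin 2) : ‖z i‖ ≤ ‖z‖ := PiLp.norm_apply_le z i

lemma CVec.norm_le_add (z : CVec) : ‖z‖ ≤ ‖z 0‖ + ‖z 1‖ := by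
  have := CVec.norm_sq z
  nlinarith [norm_nonneg (z 0), norm_nonneg (z 1), norm_nonneg z]

lemma Plane.norm_sq (z : Plane) : ‖z‖ ^ 2 = z 0 ^ 2 + z 1 ^ 2 := by
  rw [EuclideanSpace.norm_sq_eq, Fin.sum_univ_two]
  simp

lemma norm_toCVec (v : Plane) : ‖toCVec v‖ = ‖v‖ := by
  have h : ‖toCVec v‖ ^ 2 = ‖v‖ ^ 2 := by
    rw [CVec.norm_sq, Plane.norm_sq]
    simp
  exact (sq_eq_sq₀ (norm_nonneg _) (norm_nonneg _)).1 h

lemma toCVec_sub (v w : Plane) : toCVec (v - w) = toCVec v - toCVec w := by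
  ext i
  fin_cases i <;> simp [toCVec]

lemma contDiffAt_grad {g : Plane → ℂ} {x : Plane} (hg : ContDiffAt ℝ (⊤ : ℕ∞) g x) :
    ContDiffAt ℝ (⊤ : ℕ∞) (grad g) x := by
  refine contDiffAt_piLp' 2 ?_
  intro i
  fin_cases i
  · exact hg.pderiv 0
  · exact hg.pderiv 1

lemma fderiv_grad_coord {g : Plane → ℂ} {x : Plane} (hg : ContDiffAt ℝ (⊤ : ℕ∞) g x) (v : Plane)
    (j : Fin 2) : (fderiv ℝ (grad g) x v) j = fderiv ℝ (pderiv j g) x v := by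
  have hd := (contDiffAt_grad hg).differentiableAt_of_infty
  have e : (fun y => grad g y j) = pderiv j g := by
    fin_cases j <;> rfl
  rw [fderiv_apply_eq_pderiv, fderiv_apply_eq_pderiv, ← e]
  simp only [pderiv_apply hd]
  simp

/-- For a symmetric Hessian `H` in the plane, `H Jv = (tr H) Jv - J H v` with `J` the rotation by a
right angle. So the second derivatives in one direction and the Laplacian control all second
derivatives. -/
lemma norm_fderiv_grad_le {g : Plane → ℂ} {x : Plane} (hg : ContDiffAt ℝ (⊤ : ℕ∞) g x) {θ : Plane}
    (hθ : ‖θ‖ = 1) (v : Plane) :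
    ‖fderiv ℝ (grad g) x v‖ ≤ ‖v‖ *
      (2 * ‖fderiv ℝ (grad g) x θ‖ + ‖pderiv 0 (pderiv 0 g) x + pderiv 1 (pderiv 1 g) x‖) := by
  have hθ2 : θ 0 ^ 2 + θ 1 ^ 2 = 1 := by rw [← Plane.norm_sq, hθ, one_pow]
  have hperp : ‖perp θ‖ = 1 := by
    have : ‖perp θ‖ ^ 2 = 1 := by
      rw [Plane.norm_sq]
      simp only [perp, PiLp.toLp_apply, Matrix.cons_val_zero, Matrix.cons_val_one]
      linarith
    nlinarith [norm_nonneg (perp θ)]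
  set α := v 0 * θ 0 + v 1 * θ 1 with hα
  set β := v 1 * θ 0 - v 0 * θ 1 with hβ
  have hv : v = α • θ + β • perp θ := by
    ext i
    fin_cases i
    · simp [perp, hα, hβ]; linear_combination (-(v 0)) * hθ2
    · simp [perp, hα, hβ]; linear_combination (-(v 1)) * hθ2
  have hab : α ^ 2 + β ^ 2 = ‖v‖ ^ 2 := by
    rw [Plane.norm_sq, hα, hβ]; linear_combination (v 0 ^ 2 + v 1 ^ 2) * hθ2
  have hα' : |α| ≤ ‖v‖ := abs_le_of_sq_le_sq (by nlinarith) (norm_nonneg _)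
  have hβ' : |β| ≤ ‖v‖ := abs_le_of_sq_le_sq (by nlinarith) (norm_nonneg _)
  set a := fderiv ℝ (grad g) x θ with ha
  set T := pderiv 0 (pderiv 0 g) x + pderiv 1 (pderiv 1 g) x with hT
  have hb : fderiv ℝ (grad g) x (perp θ) = T • toCVec (perp θ) - !₂[-(a 1), a 0] := by
    have hs := pderiv_comm hg 0 1
    ext i
    fin_cases i
    · simp [fderiv_grad_coord hg, ha, hT]
      simp only [fderiv_apply_eq_pderiv, perp]
      simp [hs]; ring
    · simp [fderiv_grad_coord hg, ha, hT]
      simp only [fderiv_apply_eq_pderiv, perp]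
      simp [hs]; ring
  have hJ : ‖(!₂[-(a 1), a 0] : CVec)‖ = ‖a‖ := by
    have : ‖(!₂[-(a 1), a 0] : CVec)‖ ^ 2 = ‖a‖ ^ 2 := by
      rw [CVec.norm_sq, CVec.norm_sq a]; simp; ring
    exact (sq_eq_sq₀ (norm_nonneg _) (norm_nonneg _)).1 this
  have hbn : ‖fderiv ℝ (grad g) x (perp θ)‖ ≤ ‖T‖ + ‖a‖ := by
    rw [hb]
    refine (norm_sub_le _ _).trans ?_
    rw [norm_smul, norm_toCVec, hperp, hJ, mul_one]
  calc ‖fderiv ℝ (grad g) x v‖ = ‖α • a + β • fderiv ℝ (grad g) x (perp θ)‖ := by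
        conv_lhs => rw [hv]
        simp only [map_add, map_smul, ha]
    _ ≤ |α| * ‖a‖ + |β| * ‖fderiv ℝ (grad g) x (perp θ)‖ := by
        refine (norm_add_le _ _).trans ?_
        rw [norm_smul, norm_smul, Real.norm_eq_abs, Real.norm_eq_abs]
    _ ≤ ‖v‖ * ‖a‖ + ‖v‖ * (‖T‖ + ‖a‖) := by gcongr
    _ = _ := by ring

lemma fderiv_eq_inner_grad (g : Plane → ℂ) (x v : Plane) :
    fderiv ℝ g x v = inner ℂ (toCVec v) (grad g x) := by
  rw [fderiv_apply_eq_pderiv, PiLp.inner_apply, Fin.sum_univ_two]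
  simp [mul_comm]

/-! ### Outgoing solutions of the scalar Helmholtz equation -/

/-- A solution `P` of `Δ P + k² P = 0` in `|x| > ρ` whose *gradient* satisfies Sommerfeld's radiation
condition and has the far field `e^{ikr} r^{-1/2} F(x̂) x̂ + O(r^{-3/2})`, uniformly in `x̂`. No decay
of `P` itself is assumed: the conditions of the scattering problem concern `∇ div u` and
`∇^⊥ div^⊥ u` only. -/
structure IsOutgoing (k ρ : ℝ) (P : Plane → ℂ) (F : Circle2 → ℂ) : Prop where
  nonneg : 0 ≤ ρ
  smooth : ∀ x, ρ < ‖x‖ → ContDiffAt ℝ (⊤ : ℕ∞) P x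
  helmholtz : ∀ x, ρ < ‖x‖ →
    pderiv 0 (pderiv 0 P) x + pderiv 1 (pderiv 1 P) x = -(k : ℂ) ^ 2 * P x
  radiating : ∀ ε : ℝ, 0 < ε → ∃ R : ℝ, 0 < R ∧ ∀ r : ℝ, R ≤ r → ∀ θ : Circle2,
    ‖fderiv ℝ (grad P) (r • (θ : Plane)) (θ : Plane)
      - (Complex.I * (k : ℂ)) • grad P (r • (θ : Plane))‖ ≤ ε / Real.sqrt r
  farField : ∃ C R : ℝ, 0 < R ∧ ∀ r : ℝ, R ≤ r → ∀ θ : Circle2,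
    ‖grad P (r • (θ : Plane)) - (Complex.exp (Complex.I * ((k * r : ℝ) : ℂ)) / (Real.sqrt r : ℂ)
      * F θ) • toCVec (θ : Plane)‖ ≤ C * r ^ (-(3 / 2) : ℝ)

lemma Real.rpow_neg_three_halves {r : ℝ} (hr : 0 < r) :
    r ^ (-(3 / 2) : ℝ) = 1 / (r * Real.sqrt r) := by
  rw [Real.rpow_neg hr.le, show (3 / 2 : ℝ) = 1 + 1 / 2 by norm_num, Real.rpow_add hr,
    Real.rpow_one, ← Real.sqrt_eq_rpow, one_div]

lemma Circle2.norm_eq (θ : Circle2) : ‖(θ : Plane)‖ = 1 := by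
  simp

lemma Circle2.norm_smul_of_nonneg (θ : Circle2) {r : ℝ} (hr : 0 ≤ r) : ‖r • (θ : Plane)‖ = r := by
  rw [norm_smul, θ.norm_eq, Real.norm_of_nonneg hr, mul_one]

/-- Every nonzero point is `|x| x̂` with `x̂` on the unit circle. -/
lemma exists_circle_smul {x : Plane} (hx : x ≠ 0) : ∃ θ : Circle2, x = ‖x‖ • (θ : Plane) := by
  refine ⟨⟨‖x‖⁻¹ • x, ?_⟩, ?_⟩
  · rw [mem_sphere_zero_iff_norm, norm_smul, norm_inv, norm_norm,
      inv_mul_cancel₀ (norm_ne_zero_iff.2 hx)]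
  · rw [smul_smul, mul_inv_cancel₀ (norm_ne_zero_iff.2 hx), one_smul]

lemma Complex.norm_exp_I_mul_ofReal' (t : ℝ) : ‖Complex.exp (Complex.I * (t : ℂ))‖ = 1 := by
  rw [mul_comm]; exact Complex.norm_exp_ofReal_mul_I t

lemma Complex.norm_exp_I_mul_sub_le (s t : ℝ) :
    ‖Complex.exp (Complex.I * (s : ℂ)) - Complex.exp (Complex.I * (t : ℂ))‖ ≤ |s - t| := by
  have h : Complex.exp (Complex.I * (s : ℂ)) - Complex.exp (Complex.I * (t : ℂ))
      = Complex.exp (Complex.I * (t : ℂ)) * (Complex.exp (Complex.I * ((s - t : ℝ) : ℂ)) - 1) := by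
    rw [mul_sub, ← Complex.exp_add, mul_one]
    congr 2
    push_cast
    ring
  rw [h, norm_mul, Complex.norm_exp_I_mul_ofReal', one_mul]
  exact Real.norm_exp_I_mul_ofReal_sub_one_le

lemma hasDerivAt_ray {F : Type*} [NormedAddCommGroup F] [NormedSpace ℝ F] {f : Plane → F}
    {θ : Plane} {t : ℝ} (hf : DifferentiableAt ℝ f (t • θ)) :
    HasDerivAt (fun s : ℝ => f (s • θ)) (fderiv ℝ f (t • θ) θ) t := by
  have h1 : HasDerivAt (fun s : ℝ => s • θ) θ t := by
    simpa using (hasDerivAt_id t).smul_const θ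
  exact hf.hasFDerivAt.comp_hasDerivAt t h1

namespace IsOutgoing

variable {k ρ : ℝ} {P : Plane → ℂ} {F : Circle2 → ℂ}

lemma exists_bound (hP : IsOutgoing k ρ P F) :
    ∃ M R : ℝ, 0 < M ∧ 1 ≤ R ∧ ρ < R ∧ (∀ θ, ‖F θ‖ ≤ M) ∧
      ∀ r : ℝ, R ≤ r → ∀ θ : Circle2, ‖grad P (r • (θ : Plane))‖ ≤ M / Real.sqrt r := by
  obtain ⟨C, R₀, hR₀, hfar⟩ := hP.farField
  set R := max (max R₀ 1) (ρ + 1) with hR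
  have hR0 : R₀ ≤ R := (le_max_left _ _).trans (le_max_left _ _)
  have hR1 : 1 ≤ R := (le_max_right _ _).trans (le_max_left _ _)
  have hRρ : ρ < R := lt_of_lt_of_le (by linarith) (le_max_right _ _)
  have hcont : ContinuousOn (grad P) (Metric.sphere 0 R) := fun x hx =>
    (contDiffAt_grad (hP.smooth x (by rw [mem_sphere_zero_iff_norm.1 hx]; exact hRρ)))
      |>.continuousAt.continuousWithinAt
  obtain ⟨B, hB⟩ := (isCompact_sphere (0 : Plane) R).exists_bound_of_continuousOn hcont
  have hC : 0 ≤ |C| := abs_nonneg C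
  have hfar' : ∀ r : ℝ, R ≤ r → ∀ θ : Circle2, ‖grad P (r • (θ : Plane))
      - (Complex.exp (Complex.I * ((k * r : ℝ) : ℂ)) / (Real.sqrt r : ℂ) * F θ)
        • toCVec (θ : Plane)‖ ≤ |C| / Real.sqrt r := by
    intro r hr θ
    have hr1 : 1 ≤ r := hR1.trans hr
    have hr0 : 0 < r := by linarith
    refine (hfar r (hR0.trans hr) θ).trans ?_
    rw [Real.rpow_neg_three_halves hr0, mul_one_div]
    have : 0 < Real.sqrt r := Real.sqrt_pos.2 hr0
    calc C / (r * Real.sqrt r) ≤ |C| / (r * Real.sqrt r) := by gcongr; exact le_abs_self C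
      _ ≤ |C| / Real.sqrt r := by
        gcongr; nlinarith
  have hmain : ∀ r : ℝ, R ≤ r → ∀ θ : Circle2,
      ‖(Complex.exp (Complex.I * ((k * r : ℝ) : ℂ)) / (Real.sqrt r : ℂ) * F θ)
        • toCVec (θ : Plane)‖ = ‖F θ‖ / Real.sqrt r := by
    intro r hr θ
    rw [norm_smul, norm_toCVec, θ.norm_eq, mul_one, norm_mul, norm_div,
      Complex.norm_exp_I_mul_ofReal', Complex.norm_real, Real.norm_of_nonneg (Real.sqrt_nonneg r)]
    ring
  have hsR : 0 < Real.sqrt R := Real.sqrt_pos.2 (by linarith)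
  have hF : ∀ θ, ‖F θ‖ ≤ |B| * Real.sqrt R + |C| := by
    intro θ
    have h1 := hfar' R le_rfl θ
    have h2 : ‖grad P (R • (θ : Plane))‖ ≤ |B| := (hB _ (by
      rw [mem_sphere_zero_iff_norm, θ.norm_smul_of_nonneg (by linarith)])).trans (le_abs_self B)
    have h3 := hmain R le_rfl θ
    have h4 : ‖F θ‖ / Real.sqrt R ≤ |B| + |C| / Real.sqrt R := by
      rw [← h3]
      calc _ = ‖grad P (R • (θ : Plane)) - (grad P (R • (θ : Plane)) - (Complex.exp
            (Complex.I * ((k * R : ℝ) : ℂ)) / (Real.sqrt R : ℂ) * F θ) • toCVec (θ : Plane))‖ := by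
            rw [sub_sub_cancel]
        _ ≤ _ := (norm_sub_le _ _).trans (add_le_add h2 h1)
    calc ‖F θ‖ = ‖F θ‖ / Real.sqrt R * Real.sqrt R := by field_simp
      _ ≤ (|B| + |C| / Real.sqrt R) * Real.sqrt R := by gcongr
      _ = _ := by field_simp
  refine ⟨|B| * Real.sqrt R + |C| + |C| + 1, R, by positivity, hR1, hRρ,
    fun θ => (hF θ).trans (by linarith), fun r hr θ => ?_⟩
  have hr0 : 0 < Real.sqrt r := Real.sqrt_pos.2 (by linarith)
  calc ‖grad P (r • (θ : Plane))‖
      = ‖(grad P (r • (θ : Plane)) - (Complex.exp (Complex.I * ((k * r : ℝ) : ℂ))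
          / (Real.sqrt r : ℂ) * F θ) • toCVec (θ : Plane)) + (Complex.exp (Complex.I *
          ((k * r : ℝ) : ℂ)) / (Real.sqrt r : ℂ) * F θ) • toCVec (θ : Plane)‖ := by
        rw [sub_add_cancel]
    _ ≤ |C| / Real.sqrt r + ‖F θ‖ / Real.sqrt r := by
        refine (norm_add_le _ _).trans (add_le_add (hfar' r hr θ) (hmain r hr θ).le)
    _ = (|C| + ‖F θ‖) / Real.sqrt r := by ring
    _ ≤ _ := div_le_div_of_nonneg_right (by linarith [hF θ]) hr0.le

/-- The potential itself is `o(r^{1/2})`: by the radiation condition the radial derivative of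
`∂_r P - i k P` is `o(r^{-1/2})`. -/
lemma potential_isLittleO (hP : IsOutgoing k ρ P F) (hk : 0 < k) {ε : ℝ} (hε : 0 < ε) :
    ∃ R : ℝ, 0 < R ∧ ∀ r : ℝ, R ≤ r → ∀ θ : Circle2, ‖P (r • (θ : Plane))‖ ≤ ε * Real.sqrt r := by
  obtain ⟨M, R₁, hM, hR₁, hR₁ρ, -, hgrad⟩ := hP.exists_bound
  set δ := ε * k / 4 with hδ
  have hδ0 : 0 < δ := by positivity
  obtain ⟨R₂, hR₂, hrad⟩ := hP.radiating δ hδ0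
  set a := max R₁ R₂ with ha
  have ha1 : 1 ≤ a := hR₁.trans (le_max_left _ _)
  have haρ : ρ < a := hR₁ρ.trans_le (le_max_left _ _)
  have hcont : ContinuousOn P (Metric.sphere 0 a) := fun x hx =>
    (hP.smooth x (by rw [mem_sphere_zero_iff_norm.1 hx]; exact haρ))
      |>.continuousAt.continuousWithinAt
  obtain ⟨B, hB⟩ := (isCompact_sphere (0 : Plane) a).exists_bound_of_continuousOn hcont
  have hsm : ∀ (θ : Circle2) (t : ℝ), a ≤ t → ContDiffAt ℝ (⊤ : ℕ∞) P (t • (θ : Plane)) := by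
    intro θ t ht
    exact hP.smooth _ (by rw [θ.norm_smul_of_nonneg (by linarith)]; linarith)
  -- the growth of `∂_r P - i k P` along the ray in direction `θ`
  have hG : ∀ (θ : Circle2) (r : ℝ), a ≤ r →
      ‖inner ℂ (toCVec (θ : Plane)) (grad P (r • (θ : Plane)))
        - Complex.I * k * P (r • (θ : Plane))‖
        ≤ M + k * |B| + 2 * δ * Real.sqrt r := by
    intro θ r har
    have hder : ∀ t, a ≤ t → HasDerivAt (fun s : ℝ => inner ℂ (toCVec (θ : Plane))
        (grad P (s • (θ : Plane))) - Complex.I * k * P (s • (θ : Plane)))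
        (inner ℂ (toCVec (θ : Plane)) (fderiv ℝ (grad P) (t • (θ : Plane)) (θ : Plane)
          - (Complex.I * (k : ℂ)) • grad P (t • (θ : Plane)))) t := by
      intro t ht
      have h1 := hasDerivAt_ray (θ := (θ : Plane)) (t := t)
        (contDiffAt_grad (hsm θ t ht)).differentiableAt_of_infty
      have h2 := hasDerivAt_ray (θ := (θ : Plane)) (t := t) (hsm θ t ht).differentiableAt_of_infty
      have h3 := ((innerSL ℂ (toCVec (θ : Plane))).restrictScalars ℝ).hasFDerivAt.comp_hasDerivAt
        t h1
      have h4 := h3.sub (h2.const_mul (Complex.I * k))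
      refine h4.congr_deriv ?_
      rw [fderiv_eq_inner_grad, inner_sub_right, inner_smul_right]
      rfl
    have hBd : ∀ t, a ≤ t → HasDerivAt (fun s : ℝ => M + k * |B| + 2 * δ * Real.sqrt s)
        (δ / Real.sqrt t) t := by
      intro t ht
      have := ((Real.hasDerivAt_sqrt (by linarith : t ≠ 0)).const_mul (2 * δ)).const_add
        (M + k * |B|)
      refine this.congr_deriv ?_
      have : 0 < Real.sqrt t := Real.sqrt_pos.2 (by linarith)
      field_simp
    refine image_norm_le_of_norm_deriv_right_le_deriv_boundary'
      (f := fun s : ℝ => inner ℂ (toCVec (θ : Plane)) (grad P (s • (θ : Plane)))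
        - Complex.I * k * P (s • (θ : Plane)))
      (B := fun s => M + k * |B| + 2 * δ * Real.sqrt s)
      (fun t ht => (hder t ht.1).continuousAt.continuousWithinAt)
      (fun t ht => (hder t ht.1).hasDerivWithinAt) ?_
      (fun t ht => (hBd t ht.1).continuousAt.continuousWithinAt)
      (fun t ht => (hBd t ht.1).hasDerivWithinAt) ?_ ⟨har, le_rfl⟩
    · have h1 : ‖P (a • (θ : Plane))‖ ≤ |B| := (hB _ (by
        rw [mem_sphere_zero_iff_norm, θ.norm_smul_of_nonneg (by linarith)])).trans (le_abs_self B)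
      have h2 : ‖inner ℂ (toCVec (θ : Plane)) (grad P (a • (θ : Plane)))‖ ≤ M := by
        refine (norm_inner_le_norm _ _).trans ?_
        rw [norm_toCVec, θ.norm_eq, one_mul]
        refine (hgrad a (le_max_left _ _) θ).trans (div_le_self hM.le ?_)
        exact Real.one_le_sqrt.2 ha1
      refine (norm_sub_le _ _).trans ?_
      rw [norm_mul, norm_mul, Complex.norm_I, one_mul, Complex.norm_real, Real.norm_of_nonneg hk.le]
      have := mul_le_mul_of_nonneg_left h1 hk.le
      have h3 : 0 ≤ 2 * δ * Real.sqrt a := by positivity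
      linarith
    · intro t ht
      refine (norm_inner_le_norm _ _).trans ?_
      rw [norm_toCVec, θ.norm_eq, one_mul]
      exact hrad t ((le_max_right _ _).trans ht.1) θ
  set c := (M + k * |B| + M) / δ with hc
  have hc0 : 0 ≤ c := by positivity
  refine ⟨max a (c ^ 2), lt_of_lt_of_le (by linarith) (le_max_left _ _), fun r hr θ => ?_⟩
  have har : a ≤ r := (le_max_left _ _).trans hr
  have hcr : c ≤ Real.sqrt r := Real.le_sqrt_of_sq_le ((le_max_right _ _).trans hr)
  have h1 := hG θ r har
  have h2 : ‖inner ℂ (toCVec (θ : Plane)) (grad P (r • (θ : Plane)))‖ ≤ M := by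
    refine (norm_inner_le_norm _ _).trans ?_
    rw [norm_toCVec, θ.norm_eq, one_mul]
    refine (hgrad r ((le_max_left _ _).trans har) θ).trans (div_le_self hM.le ?_)
    exact Real.one_le_sqrt.2 (ha1.trans har)
  have h3 : k * ‖P (r • (θ : Plane))‖ ≤ M + (M + k * |B| + 2 * δ * Real.sqrt r) := by
    have : k * ‖P (r • (θ : Plane))‖ = ‖Complex.I * k * P (r • (θ : Plane))‖ := by
      rw [norm_mul, norm_mul, Complex.norm_I, one_mul, Complex.norm_real, Real.norm_of_nonneg hk.le]
    rw [this]
    calc _ = ‖inner ℂ (toCVec (θ : Plane)) (grad P (r • (θ : Plane)))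
          - (inner ℂ (toCVec (θ : Plane)) (grad P (r • (θ : Plane)))
            - Complex.I * k * P (r • (θ : Plane)))‖ := by rw [sub_sub_cancel]
      _ ≤ _ := (norm_sub_le _ _).trans (add_le_add h2 h1)
  have h4 : M + k * |B| + M ≤ δ * Real.sqrt r := by
    have : M + k * |B| + M = δ * c := by rw [hc]; field_simp
    rw [this]; gcongr
  have h5 : k * ‖P (r • (θ : Plane))‖ ≤ k * (ε * Real.sqrt r) := by
    have : k * (ε * Real.sqrt r) = 4 * (δ * Real.sqrt r) := by rw [hδ]; ring
    rw [this]
    have : 0 ≤ δ * Real.sqrt r := by positivity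
    linarith
  exact le_of_mul_le_mul_left h5 hk

/-- All second derivatives are `o(r^{1/2})`. -/
lemma hessian_isLittleO (hP : IsOutgoing k ρ P F) (hk : 0 < k) {ε : ℝ} (hε : 0 < ε) :
    ∃ R : ℝ, 0 < R ∧ ∀ r : ℝ, R ≤ r → ∀ (θ : Circle2) (v : Plane),
      ‖fderiv ℝ (grad P) (r • (θ : Plane)) v‖ ≤ ‖v‖ * (ε * Real.sqrt r) := by
  obtain ⟨M, R₁, hM, hR₁, hR₁ρ, -, hgrad⟩ := hP.exists_bound
  obtain ⟨R₂, hR₂, hpot⟩ := hP.potential_isLittleO hk (ε := ε / (2 * k ^ 2)) (by positivity)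
  obtain ⟨R₃, hR₃, hrad⟩ := hP.radiating 1 one_pos
  set c := 4 * (1 + k * M) / ε with hc
  have hc0 : 0 ≤ c := by positivity
  refine ⟨max (max R₁ R₂) (max R₃ (c ^ 2)), lt_of_lt_of_le hR₂ ((le_max_right _ _).trans
    (le_max_left _ _)), fun r hr θ v => ?_⟩
  obtain ⟨hr12, hr34⟩ := max_le_iff.1 hr
  obtain ⟨hr1, hr2⟩ := max_le_iff.1 hr12
  obtain ⟨hr3, hr4⟩ := max_le_iff.1 hr34
  have hcr : c ≤ Real.sqrt r := Real.le_sqrt_of_sq_le hr4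
  have hs1 : 1 ≤ Real.sqrt r := Real.one_le_sqrt.2 (hR₁.trans hr1)
  have hx : ρ < ‖r • (θ : Plane)‖ := by rw [θ.norm_smul_of_nonneg (by linarith)]; linarith
  refine (norm_fderiv_grad_le (hP.smooth _ hx) θ.norm_eq v).trans ?_
  refine mul_le_mul_of_nonneg_left ?_ (norm_nonneg v)
  have h1 : ‖grad P (r • (θ : Plane))‖ ≤ M := (hgrad r hr1 θ).trans (div_le_self hM.le hs1)
  have h2 : ‖fderiv ℝ (grad P) (r • (θ : Plane)) (θ : Plane)‖ ≤ 1 + k * M := by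
    calc _ = ‖(fderiv ℝ (grad P) (r • (θ : Plane)) (θ : Plane)
          - (Complex.I * (k : ℂ)) • grad P (r • (θ : Plane)))
          + (Complex.I * (k : ℂ)) • grad P (r • (θ : Plane))‖ := by rw [sub_add_cancel]
      _ ≤ 1 + k * M := by
        refine (norm_add_le _ _).trans (add_le_add ?_ ?_)
        · exact (hrad r hr3 θ).trans (div_le_self zero_le_one hs1)
        · rw [norm_smul, norm_mul, Complex.norm_I, one_mul, Complex.norm_real,
            Real.norm_of_nonneg hk.le]
          gcongr
  have h3 : ‖pderiv 0 (pderiv 0 P) (r • (θ : Plane)) + pderiv 1 (pderiv 1 P) (r • (θ : Plane))‖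
      ≤ ε / 2 * Real.sqrt r := by
    rw [hP.helmholtz _ hx, norm_mul, norm_neg, norm_pow, Complex.norm_real,
      Real.norm_of_nonneg hk.le]
    calc k ^ 2 * ‖P (r • (θ : Plane))‖ ≤ k ^ 2 * (ε / (2 * k ^ 2) * Real.sqrt r) := by
          gcongr; exact hpot r hr2 θ
      _ = _ := by field_simp
  have h4 : 2 * (1 + k * M) ≤ ε / 2 * Real.sqrt r := by
    have : 2 * (1 + k * M) = ε / 2 * c := by rw [hc]; field_simp; ring
    rw [this]; gcongr
  linarith

end IsOutgoing

/-! ### Translating an outgoing solution -/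

lemma inner_toCVec (v w : Plane) : inner ℂ (toCVec v) (toCVec w) = ((inner ℝ v w : ℝ) : ℂ) := by
  rw [PiLp.inner_apply, PiLp.inner_apply, Fin.sum_univ_two, Fin.sum_univ_two]
  simp

lemma one_div_mul_sqrt_le {r s : ℝ} (hr : 0 < r) (hs : r / 2 ≤ s) :
    1 / (s * Real.sqrt s) ≤ 4 / (r * Real.sqrt r) := by
  have hs0 : 0 < s := by linarith
  have h1 : Real.sqrt r / 2 ≤ Real.sqrt s := by
    refine Real.le_sqrt_of_sq_le ?_
    rw [div_pow, Real.sq_sqrt hr.le]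
    linarith
  have h2 : 0 < Real.sqrt r := Real.sqrt_pos.2 hr
  calc 1 / (s * Real.sqrt s) ≤ 1 / ((r / 2) * (Real.sqrt r / 2)) := by gcongr
    _ = _ := by field_simp; norm_num

/-- Polar coordinates of the point `r θ - h`, up to `O(1 / r)`. -/
lemma exists_polar_sub {r : ℝ} (θ : Circle2) (h : Plane) (hr : 0 < r) (hrh : 2 * ‖h‖ ≤ r) :
    ∃ (s : ℝ) (η : Circle2), r • (θ : Plane) - h = s • (η : Plane) ∧ r / 2 ≤ s ∧ s ≤ 2 * r ∧
      |s - r| ≤ ‖h‖ ∧ ‖(η : Plane) - θ‖ ≤ 2 * ‖h‖ / r ∧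
      |s - (r - inner ℝ h (θ : Plane))| ≤ ‖h‖ ^ 2 / r := by
  set x := r • (θ : Plane) - h with hx
  have hnr : ‖r • (θ : Plane)‖ = r := θ.norm_smul_of_nonneg hr.le
  have hd : |‖x‖ - r| ≤ ‖h‖ := by
    have := abs_norm_sub_norm_le x (r • (θ : Plane))
    rwa [hnr, hx, sub_sub_cancel_left, norm_neg] at this
  obtain ⟨hd1, hd2⟩ := abs_le.1 hd
  have hs : r / 2 ≤ ‖x‖ := by linarith
  have hx0 : x ≠ 0 := norm_pos_iff.1 (by linarith)
  obtain ⟨η, hη⟩ := exists_circle_smul hx0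
  refine ⟨‖x‖, η, hη, hs, by linarith [norm_nonneg h], hd, ?_, ?_⟩
  · have h1 : r • ((η : Plane) - θ) = (r - ‖x‖) • (η : Plane) - h := by
      rw [smul_sub, sub_smul, ← hη, hx]
      abel
    have h2 : r * ‖(η : Plane) - θ‖ ≤ 2 * ‖h‖ := by
      calc r * ‖(η : Plane) - θ‖ = ‖r • ((η : Plane) - θ)‖ := by
            rw [norm_smul, Real.norm_of_nonneg hr.le]
        _ ≤ |r - ‖x‖| + ‖h‖ := by
            rw [h1]
            refine (norm_sub_le _ _).trans ?_
            rw [norm_smul, η.norm_eq, mul_one, Real.norm_eq_abs]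
        _ ≤ _ := by rw [abs_sub_comm]; linarith
    rw [le_div_iff₀ hr]
    linarith
  · set q := inner ℝ h (θ : Plane) with hq
    have hqh : |q| ≤ ‖h‖ := by
      have := abs_real_inner_le_norm h (θ : Plane)
      rwa [θ.norm_eq, mul_one] at this
    have hsq : ‖x‖ ^ 2 = r ^ 2 - 2 * r * q + ‖h‖ ^ 2 := by
      rw [hx, norm_sub_sq_real, hnr, inner_smul_left, real_inner_comm]
      simp only [conj_trivial, ← hq]
      ring
    obtain ⟨hq1, hq2⟩ := abs_le.1 hqh
    have hden : r ≤ ‖x‖ + (r - q) := by linarith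
    have hprod : (‖x‖ - (r - q)) * (‖x‖ + (r - q)) = ‖h‖ ^ 2 - q ^ 2 := by
      linear_combination hsq
    have hq2' : q ^ 2 ≤ ‖h‖ ^ 2 := by nlinarith
    have hnn : 0 ≤ ‖x‖ - (r - q) := by
      by_contra hneg
      push Not at hneg
      nlinarith
    rw [abs_of_nonneg hnn, le_div_iff₀ hr]
    nlinarith [sq_nonneg q]

namespace IsOutgoing

variable {k ρ : ℝ} {P : Plane → ℂ} {F : Circle2 → ℂ}

/-- The far field expansion with an explicit nonnegative constant and a larger starting radius. -/
lemma exists_farField_bound (hP : IsOutgoing k ρ P F) (R₀ : ℝ) : ∃ C R : ℝ, 0 ≤ C ∧ 1 ≤ R ∧ R₀ ≤ R ∧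
    ρ < R ∧ ∀ r : ℝ, R ≤ r → ∀ θ : Circle2,
      ‖grad P (r • (θ : Plane)) - (Complex.exp (Complex.I * ((k * r : ℝ) : ℂ)) / (Real.sqrt r : ℂ)
        * F θ) • toCVec (θ : Plane)‖ ≤ C / (r * Real.sqrt r) := by
  obtain ⟨C, R, hR, hfar⟩ := hP.farField
  refine ⟨|C|, max (max R 1) (max R₀ (ρ + 1)), abs_nonneg C,
    (le_max_right _ _).trans (le_max_left _ _), (le_max_left _ _).trans (le_max_right _ _),
    lt_of_lt_of_le (lt_add_one ρ) ((le_max_right _ _).trans (le_max_right _ _)), fun r hr θ => ?_⟩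
  have hrR : R ≤ r := ((le_max_left _ _).trans (le_max_left _ _)).trans hr
  have hr0 : 0 < r := hR.trans_le hrR
  refine (hfar r hrR θ).trans ?_
  rw [Real.rpow_neg_three_halves hr0, mul_one_div]
  gcongr
  exact le_abs_self C

/-- The gradient is radial up to `O(r^{-3/2})`, so that `P` varies only by that much along chords
of length `O(1)` of the circle of radius `r`. -/
lemma exists_transversal_bound (hP : IsOutgoing k ρ P F) {K : ℝ} (hK : 0 ≤ K) : ∃ C R : ℝ, 0 ≤ C ∧
    0 < R ∧ ∀ r : ℝ, R ≤ r → ∀ θ η : Circle2, ‖(θ : Plane) - η‖ ≤ K / r →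
      ‖P (r • (θ : Plane)) - P (r • (η : Plane))‖ ≤ C / (r * Real.sqrt r) := by
  obtain ⟨M, R₁, hM, hR₁, hR₁ρ, hF, -⟩ := hP.exists_bound
  obtain ⟨C, R₂, hC, hR₂, hRR, hR₂ρ, hfar⟩ := hP.exists_farField_bound R₁
  refine ⟨4 * (M * K ^ 2 / 2 + K * C), 2 * R₂ + 2 * K, by positivity, by linarith,
    fun r hr θ η hθη => ?_⟩
  have hr0 : 0 < r := by linarith
  set v : Plane := r • ((θ : Plane) - η) with hv
  have hvK : ‖v‖ ≤ K := by
    rw [hv, norm_smul, Real.norm_of_nonneg hr0.le, mul_comm]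
    exact (le_div_iff₀ hr0).1 hθη
  have hη : ‖r • (η : Plane)‖ = r := η.norm_smul_of_nonneg hr0.le
  have hθ : r • (η : Plane) + (1 : ℝ) • v = r • (θ : Plane) := by
    rw [hv, one_smul, smul_sub]; abel
  have hnorm : ∀ t ∈ Set.Icc (0 : ℝ) 1, r / 2 ≤ ‖r • (η : Plane) + t • v‖ := by
    intro t ht
    have h1 : ‖r • (η : Plane)‖ - ‖t • v‖ ≤ ‖r • (η : Plane) + t • v‖ := by
      have := norm_sub_norm_le (r • (η : Plane)) (-(t • v))
      rwa [norm_neg, sub_neg_eq_add] at this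
    have h2 : ‖t • v‖ ≤ K := by
      rw [norm_smul, Real.norm_of_nonneg ht.1]
      nlinarith [ht.1, ht.2, norm_nonneg v]
    rw [hη] at h1
    linarith
  have hder : ∀ t ∈ Set.Icc (0 : ℝ) 1, HasDerivAt (fun t : ℝ => P (r • (η : Plane) + t • v))
      (fderiv ℝ P (r • (η : Plane) + t • v) v) t := by
    intro t ht
    have hline : HasDerivAt (fun t : ℝ => r • (η : Plane) + t • v) v t := by
      simpa using ((hasDerivAt_id t).smul_const v).const_add (r • (η : Plane))
    have := hnorm t ht
    exact ((hP.smooth _ (by linarith)).differentiableAt_of_infty.hasFDerivAt).comp_hasDerivAt t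
      hline
  have hbound : ∀ t ∈ Set.Icc (0 : ℝ) 1, ‖fderiv ℝ P (r • (η : Plane) + t • v) v‖
      ≤ 4 * (M * K ^ 2 / 2 + K * C) / (r * Real.sqrt r) := by
    intro t ht
    set y := r • (η : Plane) + t • v with hy
    have hyr := hnorm t ht
    rw [← hy] at hyr
    have hy0 : 0 < ‖y‖ := by linarith
    obtain ⟨ζ, hζ⟩ := exists_circle_smul (norm_pos_iff.1 hy0)
    set s := ‖y‖ with hs
    have hss : 0 < Real.sqrt s := Real.sqrt_pos.2 hy0
    -- the chord is orthogonal to the radius up to `O(1 / r)`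
    have hvy : |inner ℝ v y| ≤ K ^ 2 / 2 := by
      have h1 : 2 * r * inner ℝ v (η : Plane) = - ‖v‖ ^ 2 := by
        have h3 : ‖r • (η : Plane) + (1 : ℝ) • v‖ ^ 2 = r ^ 2 := by
          rw [hθ, θ.norm_smul_of_nonneg hr0.le]
        rw [one_smul, norm_add_sq_real, hη, inner_smul_left, real_inner_comm] at h3
        simp only [conj_trivial] at h3
        linarith
      have h2 : inner ℝ v y = ‖v‖ ^ 2 * (t - 1 / 2) := by
        rw [hy, inner_add_right, inner_smul_right, inner_smul_right, real_inner_self_eq_norm_sq]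
        linarith
      rw [h2, abs_mul, abs_of_nonneg (sq_nonneg _)]
      have h4 : |t - 1 / 2| ≤ 1 / 2 := abs_le.2 ⟨by linarith [ht.1], by linarith [ht.2]⟩
      have h5 : ‖v‖ ^ 2 ≤ K ^ 2 := pow_le_pow_left₀ (norm_nonneg v) hvK 2
      nlinarith [abs_nonneg (t - 1 / 2), sq_nonneg ‖v‖]
    have hvζ : |inner ℝ v (ζ : Plane)| ≤ K ^ 2 / 2 / s := by
      rw [le_div_iff₀ hy0]
      have : inner ℝ v y = inner ℝ v (ζ : Plane) * s := by
        conv_lhs => rw [hζ]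
        rw [inner_smul_right, mul_comm]
      rw [this, abs_mul, abs_of_pos hy0] at hvy
      exact hvy
    have hE := hfar s (by linarith) ζ
    rw [← hζ] at hE
    set m := Complex.exp (Complex.I * ((k * s : ℝ) : ℂ)) / (Real.sqrt s : ℂ) * F ζ with hm
    have hmn : ‖m‖ ≤ M / Real.sqrt s := by
      rw [hm, norm_mul, norm_div, Complex.norm_exp_I_mul_ofReal', Complex.norm_real,
        Real.norm_of_nonneg hss.le, one_div, inv_mul_eq_div]
      gcongr
      exact hF ζ
    have hsplit : fderiv ℝ P y v = m * ((inner ℝ v (ζ : Plane) : ℝ) : ℂ)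
        + inner ℂ (toCVec v) (grad P y - m • toCVec (ζ : Plane)) := by
      rw [fderiv_eq_inner_grad, inner_sub_right, inner_smul_right, inner_toCVec]
      ring
    calc ‖fderiv ℝ P y v‖ ≤ ‖m‖ * |inner ℝ v (ζ : Plane)|
          + ‖v‖ * ‖grad P y - m • toCVec (ζ : Plane)‖ := by
          rw [hsplit]
          refine (norm_add_le _ _).trans (add_le_add ?_ ?_)
          · rw [norm_mul, Complex.norm_real, Real.norm_eq_abs]
          · rw [← norm_toCVec v]; exact norm_inner_le_norm _ _
      _ ≤ M / Real.sqrt s * (K ^ 2 / 2 / s) + K * (C / (s * Real.sqrt s)) := by gcongr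
      _ = (M * K ^ 2 / 2 + K * C) * (1 / (s * Real.sqrt s)) := by field_simp
      _ ≤ (M * K ^ 2 / 2 + K * C) * (4 / (r * Real.sqrt r)) :=
          mul_le_mul_of_nonneg_left (one_div_mul_sqrt_le hr0 hyr) (by positivity)
      _ = _ := by ring
  have := norm_image_sub_le_of_norm_deriv_le_segment_01'
    (f := fun t : ℝ => P (r • (η : Plane) + t • v))
    (fun t ht => (hder t ht).hasDerivWithinAt)
    (fun t ht => hbound t ⟨ht.1, ht.2.le⟩)
  rw [hθ, zero_smul, add_zero] at this
  exact this

/-- Integrating the far field expansion along a ray. -/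
lemma exists_radial_bound (hP : IsOutgoing k ρ P F) (hk : 0 < k) {τ : ℝ} (hτ : 0 ≤ τ) :
    ∃ C R : ℝ, 0 ≤ C ∧ 0 < R ∧ ∀ r : ℝ, R ≤ r → ∀ θ : Circle2,
      ‖(P ((r + τ) • (θ : Plane)) - F θ / (Complex.I * k) *
          (Complex.exp (Complex.I * ((k * (r + τ) : ℝ) : ℂ)) / (Real.sqrt (r + τ) : ℂ)))
        - (P (r • (θ : Plane)) - F θ / (Complex.I * k) *
          (Complex.exp (Complex.I * ((k * r : ℝ) : ℂ)) / (Real.sqrt r : ℂ)))‖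
        ≤ C / (r * Real.sqrt r) := by
  obtain ⟨M, R₁, hM, hR₁, hR₁ρ, hF, -⟩ := hP.exists_bound
  obtain ⟨C, R₂, hC, hR₂, hRR, hR₂ρ, hfar⟩ := hP.exists_farField_bound R₁
  have hkC : (k : ℂ) ≠ 0 := by exact_mod_cast hk.ne'
  refine ⟨(C + M / (2 * k)) * τ, R₂, by positivity, by linarith, fun r hr θ => ?_⟩
  have hr0 : 0 < r := by linarith
  have hder : ∀ t, r ≤ t → HasDerivAt (fun t : ℝ => P (t • (θ : Plane)) - F θ / (Complex.I * k) *
      (Complex.exp (Complex.I * ((k * t : ℝ) : ℂ)) / (Real.sqrt t : ℂ)))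
      (inner ℂ (toCVec (θ : Plane)) (grad P (t • (θ : Plane)) -
        (Complex.exp (Complex.I * ((k * t : ℝ) : ℂ)) / (Real.sqrt t : ℂ) * F θ)
          • toCVec (θ : Plane))
        + F θ / (2 * (Complex.I * k)) * (Complex.exp (Complex.I * ((k * t : ℝ) : ℂ))
          / ((t * Real.sqrt t : ℝ) : ℂ))) t := by
    intro t ht
    have ht0 : 0 < t := by linarith
    have hst : 0 < Real.sqrt t := Real.sqrt_pos.2 ht0
    have hstC : (Real.sqrt t : ℂ) ≠ 0 := by exact_mod_cast hst.ne'
    have h1 := hasDerivAt_ray (θ := (θ : Plane)) (t := t) (hP.smooth _ (by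
      rw [θ.norm_smul_of_nonneg ht0.le]; linarith)).differentiableAt_of_infty
    have h2 : HasDerivAt (fun t : ℝ => ((k * t : ℝ) : ℂ)) (k : ℂ) t := by
      simpa using ((hasDerivAt_id t).const_mul k).ofReal_comp
    have h3 : HasDerivAt (fun t : ℝ => (Real.sqrt t : ℂ)) ((1 / (2 * Real.sqrt t) : ℝ) : ℂ) t :=
      (Real.hasDerivAt_sqrt ht0.ne').ofReal_comp
    have h4 := h1.sub (((((h2.const_mul Complex.I).cexp).div h3 hstC)).const_mul
      (F θ / (Complex.I * k)))
    refine h4.congr_deriv ?_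
    have hsq : (t : ℂ) = (Real.sqrt t : ℂ) * Real.sqrt t := by
      exact_mod_cast (Real.mul_self_sqrt ht0.le).symm
    rw [fderiv_eq_inner_grad, inner_sub_right, inner_smul_right, inner_toCVec,
      real_inner_self_eq_norm_sq, θ.norm_eq]
    push_cast
    rw [hsq]
    generalize (Real.sqrt t : ℂ) = q at hstC ⊢
    have hI := Complex.I_ne_zero
    generalize Complex.exp _ = e
    field_simp
    ring
  have hbound : ∀ t, r ≤ t → ‖inner ℂ (toCVec (θ : Plane)) (grad P (t • (θ : Plane)) -
        (Complex.exp (Complex.I * ((k * t : ℝ) : ℂ)) / (Real.sqrt t : ℂ) * F θ)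
          • toCVec (θ : Plane))
        + F θ / (2 * (Complex.I * k)) * (Complex.exp (Complex.I * ((k * t : ℝ) : ℂ))
          / ((t * Real.sqrt t : ℝ) : ℂ))‖ ≤ (C + M / (2 * k)) / (r * Real.sqrt r) := by
    intro t ht
    have ht0 : 0 < t := by linarith
    have hst : 0 < Real.sqrt t := Real.sqrt_pos.2 ht0
    have hsr : 0 < Real.sqrt r := Real.sqrt_pos.2 hr0
    calc _ ≤ C / (t * Real.sqrt t) + M / (2 * k) * (1 / (t * Real.sqrt t)) := by
          refine (norm_add_le _ _).trans (add_le_add ?_ ?_)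
          · refine (norm_inner_le_norm _ _).trans ?_
            rw [norm_toCVec, θ.norm_eq, one_mul]
            exact hfar t (hr.trans ht) θ
          · rw [norm_mul, norm_div, norm_div, norm_mul, norm_mul, Complex.norm_I, one_mul,
              Complex.norm_exp_I_mul_ofReal', Complex.norm_real, Complex.norm_real,
              Real.norm_of_nonneg hk.le, Real.norm_of_nonneg (by positivity), Complex.norm_two]
            gcongr
            exact hF θ
      _ = (C + M / (2 * k)) / (t * Real.sqrt t) := by ring
      _ ≤ _ := by gcongr
  have := norm_image_sub_le_of_norm_deriv_le_segment'
    (f := fun t : ℝ => P (t • (θ : Plane)) - F θ / (Complex.I * k) *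
      (Complex.exp (Complex.I * ((k * t : ℝ) : ℂ)) / (Real.sqrt t : ℂ)))
    (fun t (ht : t ∈ Set.Icc r (r + τ)) => (hder t ht.1).hasDerivWithinAt)
    (fun t ht => hbound t ht.1) (r + τ) ⟨by linarith, le_rfl⟩
  refine this.trans (le_of_eq ?_)
  ring

/-- The far field pattern is Lipschitz at small distances. Its values are recovered from the
differences `P ((r + π / k) θ) - P (r θ)` over half a wave length, and these hardly depend on the
direction `θ`. -/
lemma exists_pattern_bound (hP : IsOutgoing k ρ P F) (hk : 0 < k) {K : ℝ} (hK : 0 ≤ K) :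
    ∃ C R : ℝ, 0 ≤ C ∧ 0 < R ∧ ∀ r : ℝ, R ≤ r → ∀ θ η : Circle2, ‖(θ : Plane) - η‖ ≤ K / r →
      ‖F θ - F η‖ ≤ C / r := by
  have hπk : 0 < Real.pi / k := div_pos Real.pi_pos hk
  set τ := Real.pi / k with hτ
  obtain ⟨C₁, R₁, hC₁, hR₁, h₁⟩ := hP.exists_transversal_bound (K := 2 * K) (by positivity)
  obtain ⟨C₂, R₂, hC₂, hR₂, h₂⟩ := hP.exists_radial_bound hk hπk.le
  have hkC : (k : ℂ) ≠ 0 := by exact_mod_cast hk.ne'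
  refine ⟨k * (2 * C₁ + 2 * C₂), max (max R₁ R₂) τ, by positivity,
    lt_of_lt_of_le hπk (le_max_right _ _), fun r hr θ η hθη => ?_⟩
  obtain ⟨hr12, hrτ⟩ := max_le_iff.1 hr
  obtain ⟨hr1, hr2⟩ := max_le_iff.1 hr12
  have hr0 : 0 < r := by linarith
  have hsr : 0 < Real.sqrt r := Real.sqrt_pos.2 hr0
  have hsr' : 0 < Real.sqrt (r + τ) := Real.sqrt_pos.2 (by linarith)
  have a1 := h₁ r hr1 θ η (hθη.trans (by gcongr; linarith))
  have a2 := h₁ (r + τ) (by linarith) θ η (hθη.trans (by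
    rw [div_le_div_iff₀ hr0 (by linarith)]; nlinarith))
  have a2' : ‖P ((r + τ) • (θ : Plane)) - P ((r + τ) • (η : Plane))‖
      ≤ C₁ / (r * Real.sqrt r) := a2.trans (by
    have : r ≤ r + τ := by linarith
    gcongr)
  have b1 := h₂ r hr2 θ
  have b2 := h₂ r hr2 η
  set e := Complex.exp (Complex.I * ((k * r : ℝ) : ℂ)) with he
  -- a shift by half a wave length reverses the sign of the wave
  have hexp : Complex.exp (Complex.I * ((k * (r + τ) : ℝ) : ℂ)) = -e := by
    have : Complex.I * ((k * (r + τ) : ℝ) : ℂ)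
        = Complex.I * ((k * r : ℝ) : ℂ) + Real.pi * Complex.I := by
      rw [hτ]
      push_cast
      field_simp
    rw [this, Complex.exp_add, Complex.exp_pi_mul_I, he]
    ring
  rw [hexp] at b1 b2
  have hkey : (F θ - F η) * (e / (Complex.I * k))
      * ((1 / Real.sqrt (r + τ) + 1 / Real.sqrt r : ℝ) : ℂ)
      = ((P ((r + τ) • (θ : Plane)) - F θ / (Complex.I * k) * (-e / (Real.sqrt (r + τ) : ℂ)))
        - (P (r • (θ : Plane)) - F θ / (Complex.I * k) * (e / (Real.sqrt r : ℂ))))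
      - ((P ((r + τ) • (η : Plane)) - F η / (Complex.I * k) * (-e / (Real.sqrt (r + τ) : ℂ)))
        - (P (r • (η : Plane)) - F η / (Complex.I * k) * (e / (Real.sqrt r : ℂ))))
      - (P ((r + τ) • (θ : Plane)) - P ((r + τ) • (η : Plane)))
      + (P (r • (θ : Plane)) - P (r • (η : Plane))) := by
    push_cast
    ring
  have hnorm : ‖F θ - F η‖ * (1 / k) * (1 / Real.sqrt r)
      ≤ (2 * C₁ + 2 * C₂) / (r * Real.sqrt r) := by
    calc _ ≤ ‖F θ - F η‖ * (1 / k) * (1 / Real.sqrt (r + τ) + 1 / Real.sqrt r) := by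
          gcongr
          have : 0 < 1 / Real.sqrt (r + τ) := by positivity
          linarith
      _ = ‖(F θ - F η) * (e / (Complex.I * k))
            * ((1 / Real.sqrt (r + τ) + 1 / Real.sqrt r : ℝ) : ℂ)‖ := by
          rw [norm_mul, norm_mul, norm_div, norm_mul, Complex.norm_I, one_mul, he,
            Complex.norm_exp_I_mul_ofReal', Complex.norm_real, Complex.norm_real,
            Real.norm_of_nonneg hk.le, Real.norm_of_nonneg (by positivity)]
      _ ≤ C₂ / (r * Real.sqrt r) + C₂ / (r * Real.sqrt r) + C₁ / (r * Real.sqrt r)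
          + C₁ / (r * Real.sqrt r) := by
          rw [hkey]
          refine (norm_add_le _ _).trans (add_le_add ?_ a1)
          refine (norm_sub_le _ _).trans (add_le_add ?_ a2')
          exact (norm_sub_le _ _).trans (add_le_add b1 b2)
      _ = _ := by ring
  rw [le_div_iff₀ hr0]
  have := mul_le_mul_of_nonneg_right hnorm (by positivity : 0 ≤ k * Real.sqrt r * r)
  have e1 : ‖F θ - F η‖ * (1 / k) * (1 / Real.sqrt r) * (k * Real.sqrt r * r)
      = ‖F θ - F η‖ * r := by
    field_simp
  have e2 : (2 * C₁ + 2 * C₂) / (r * Real.sqrt r) * (k * Real.sqrt r * r)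
      = k * (2 * C₁ + 2 * C₂) := by field_simp
  rwa [e1, e2] at this

/-- In the radiation condition the origin may be moved: the radial direction turns by `O(1 / r)`
only, and the second derivatives are `o(r^{1/2})`. -/
lemma radiating_comp_sub (hP : IsOutgoing k ρ P F) (hk : 0 < k) (h : Plane) {ε : ℝ} (hε : 0 < ε) :
    ∃ R : ℝ, 0 < R ∧ ∀ r : ℝ, R ≤ r → ∀ θ : Circle2,
      ‖fderiv ℝ (grad P) (r • (θ : Plane) - h) (θ : Plane)
        - (Complex.I * (k : ℂ)) • grad P (r • (θ : Plane) - h)‖ ≤ ε / Real.sqrt r := by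
  obtain ⟨R₁, hR₁, h₁⟩ := hP.radiating (ε / 4) (by positivity)
  obtain ⟨R₂, hR₂, h₂⟩ := hP.hessian_isLittleO hk (ε := ε / (8 * (‖h‖ + 1))) (by positivity)
  refine ⟨2 * R₁ + 2 * R₂ + 2 * ‖h‖, by positivity, fun r hr θ => ?_⟩
  have hh := norm_nonneg h
  have hr0 : 0 < r := by linarith
  obtain ⟨s, η, hx, hs1, hs2, -, hηθ, -⟩ := exists_polar_sub θ h hr0 (by linarith)
  have hs0 : 0 < s := by linarith
  have hsr : 0 < Real.sqrt r := Real.sqrt_pos.2 hr0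
  have hs_lo : Real.sqrt r / 2 ≤ Real.sqrt s := Real.le_sqrt_of_sq_le (by
    rw [div_pow, Real.sq_sqrt hr0.le]; linarith)
  have hs_hi : Real.sqrt s ≤ 2 * Real.sqrt r := Real.sqrt_le_iff.2 ⟨by positivity, by
    rw [mul_pow, Real.sq_sqrt hr0.le]; linarith⟩
  rw [hx]
  have a1 := h₁ s (by linarith) η
  have a2 := h₂ s (by linarith) η ((θ : Plane) - η)
  rw [norm_sub_rev] at hηθ
  calc _ = ‖(fderiv ℝ (grad P) (s • (η : Plane)) (η : Plane)
          - (Complex.I * (k : ℂ)) • grad P (s • (η : Plane)))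
          + fderiv ℝ (grad P) (s • (η : Plane)) ((θ : Plane) - η)‖ := by
        rw [map_sub]; congr 1; abel
    _ ≤ ε / 4 / Real.sqrt s + ‖(θ : Plane) - η‖ * (ε / (8 * (‖h‖ + 1)) * Real.sqrt s) :=
        (norm_add_le _ _).trans (add_le_add a1 a2)
    _ ≤ ε / 4 / (Real.sqrt r / 2) + 2 * ‖h‖ / r * (ε / (8 * (‖h‖ + 1)) * (2 * Real.sqrt r)) := by
        gcongr
    _ = ε / 2 / Real.sqrt r + ε / 2 * (‖h‖ / (‖h‖ + 1)) * (Real.sqrt r / r) := by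
        field_simp; ring
    _ ≤ ε / 2 / Real.sqrt r + ε / 2 * 1 * (1 / Real.sqrt r) := by
        have e1 : ‖h‖ / (‖h‖ + 1) ≤ 1 := (div_le_one (by linarith)).2 (by linarith)
        have e2 : Real.sqrt r / r = 1 / Real.sqrt r := by rw [Real.sqrt_div_self']
        rw [e2]
        gcongr
    _ = _ := by ring

/-- The far field about a moved origin: `|x - h| = |x| - h·x̂ + O(1 / |x|)` turns into the phase
`e^{-ikh·x̂}`, and the pattern moves by `O(1 / |x|)` because it is Lipschitz. -/
lemma farField_comp_sub (hP : IsOutgoing k ρ P F) (hk : 0 < k) (h : Plane) :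
    ∃ C R : ℝ, 0 < R ∧ ∀ r : ℝ, R ≤ r → ∀ θ : Circle2,
      ‖grad P (r • (θ : Plane) - h) - (Complex.exp (Complex.I * ((k * r : ℝ) : ℂ))
        / (Real.sqrt r : ℂ) * (Complex.exp (-(Complex.I * ((k * inner ℝ h (θ : Plane) : ℝ) : ℂ)))
          * F θ)) • toCVec (θ : Plane)‖ ≤ C * r ^ (-(3 / 2) : ℝ) := by
  obtain ⟨M, R₁, hM, hR₁, hR₁ρ, hF, -⟩ := hP.exists_bound
  obtain ⟨C, R₂, hC, hR₂, hRR, hR₂ρ, hfar⟩ := hP.exists_farField_bound R₁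
  obtain ⟨C₃, R₃, hC₃, hR₃, h₃⟩ := hP.exists_pattern_bound hk (K := 2 * ‖h‖) (by positivity)
  have hh := norm_nonneg h
  refine ⟨4 * C + (2 * ‖h‖ * M + k * ‖h‖ ^ 2 * M + C₃ + 2 * ‖h‖ * M), 2 * R₂ + R₃ + 2 * ‖h‖,
    by positivity, fun r hr θ => ?_⟩
  have hr0 : 0 < r := by linarith
  obtain ⟨s, η, hx, hs1, hs2, hsr, hηθ, hphase⟩ := exists_polar_sub θ h hr0 (by linarith)
  have hs0 : 0 < s := by linarith
  have hqr : 0 < Real.sqrt r := Real.sqrt_pos.2 hr0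
  have hqs : 0 < Real.sqrt s := Real.sqrt_pos.2 hs0
  have hqrC : (Real.sqrt r : ℂ) ≠ 0 := by exact_mod_cast hqr.ne'
  have hqsC : (Real.sqrt s : ℂ) ≠ 0 := by exact_mod_cast hqs.ne'
  rw [Real.rpow_neg_three_halves hr0, hx]
  have a1 := hfar s (by linarith) η
  have a2 := h₃ r (by linarith) η θ hηθ
  set E := Complex.exp (Complex.I * ((k * s : ℝ) : ℂ)) with hE
  set E' := Complex.exp (Complex.I * ((k * (r - inner ℝ h (θ : Plane)) : ℝ) : ℂ)) with hE'
  have hEE' : Complex.exp (Complex.I * ((k * r : ℝ) : ℂ)) *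
      Complex.exp (-(Complex.I * ((k * inner ℝ h (θ : Plane) : ℝ) : ℂ))) = E' := by
    rw [hE', ← Complex.exp_add]
    congr 1
    push_cast
    ring
  have hE1 : ‖E‖ = 1 := Complex.norm_exp_I_mul_ofReal' _
  have hE1' : ‖E'‖ = 1 := Complex.norm_exp_I_mul_ofReal' _
  have hdE : ‖E - E'‖ ≤ k * (‖h‖ ^ 2 / r) := by
    refine (Complex.norm_exp_I_mul_sub_le _ _).trans ?_
    rw [← mul_sub, abs_mul, abs_of_pos hk]
    gcongr
  -- replacing `s`, `η` by `r`, `θ` in the amplitude costs `O(r^{-3/2})`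
  have hdq : ‖(1 / (Real.sqrt s : ℂ) - 1 / (Real.sqrt r : ℂ))‖ ≤ 2 * ‖h‖ / (r * Real.sqrt r) := by
    have e1 : (1 / (Real.sqrt s : ℂ) - 1 / (Real.sqrt r : ℂ))
        = (((r - s) / (Real.sqrt s * Real.sqrt r * (Real.sqrt r + Real.sqrt s)) : ℝ) : ℂ) := by
      rw [← Complex.ofReal_one, ← Complex.ofReal_div, ← Complex.ofReal_div, ← Complex.ofReal_sub]
      congr 1
      have : r - s = (Real.sqrt r - Real.sqrt s) * (Real.sqrt r + Real.sqrt s) := by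
        ring_nf; rw [Real.sq_sqrt hr0.le, Real.sq_sqrt hs0.le]
      rw [this]
      field_simp
    have hs_lo : Real.sqrt r / 2 ≤ Real.sqrt s := Real.le_sqrt_of_sq_le (by
      rw [div_pow, Real.sq_sqrt hr0.le]; linarith)
    rw [e1, Complex.norm_real, Real.norm_eq_abs, abs_div, abs_sub_comm,
      abs_of_pos (by positivity : 0 < Real.sqrt s * Real.sqrt r * (Real.sqrt r + Real.sqrt s))]
    calc |s - r| / (Real.sqrt s * Real.sqrt r * (Real.sqrt r + Real.sqrt s))
        ≤ ‖h‖ / (Real.sqrt r / 2 * Real.sqrt r * (Real.sqrt r + 0)) := by gcongr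
      _ = 2 * ‖h‖ / (r * Real.sqrt r) := by
        rw [add_zero, div_mul_eq_mul_div, Real.mul_self_sqrt hr0.le]
        field_simp
  have hmain : ‖(E / (Real.sqrt s : ℂ) * F η) • toCVec (η : Plane)
      - (E' / (Real.sqrt r : ℂ) * F θ) • toCVec (θ : Plane)‖
      ≤ (2 * ‖h‖ * M + k * ‖h‖ ^ 2 * M + C₃ + 2 * ‖h‖ * M) / (r * Real.sqrt r) := by
    have e1 : (E / (Real.sqrt s : ℂ) * F η) • toCVec (η : Plane)
        - (E' / (Real.sqrt r : ℂ) * F θ) • toCVec (θ : Plane)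
        = (E * (1 / (Real.sqrt s : ℂ) - 1 / (Real.sqrt r : ℂ)) * F η) • toCVec (η : Plane)
          + ((E - E') * (1 / (Real.sqrt r : ℂ)) * F η) • toCVec (η : Plane)
          + (E' * (1 / (Real.sqrt r : ℂ)) * (F η - F θ)) • toCVec (η : Plane)
          + (E' * (1 / (Real.sqrt r : ℂ)) * F θ) • toCVec ((η : Plane) - θ) := by
      rw [toCVec_sub]
      module
    have e2 : ‖1 / (Real.sqrt r : ℂ)‖ = 1 / Real.sqrt r := by
      rw [norm_div, norm_one, Complex.norm_real, Real.norm_of_nonneg hqr.le]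
    rw [e1]
    calc _ ≤ 1 * (2 * ‖h‖ / (r * Real.sqrt r)) * M * 1
          + k * (‖h‖ ^ 2 / r) * (1 / Real.sqrt r) * M * 1
          + 1 * (1 / Real.sqrt r) * (C₃ / r) * 1
          + 1 * (1 / Real.sqrt r) * M * (2 * ‖h‖ / r) := by
          refine (norm_add_le _ _).trans (add_le_add ((norm_add_le _ _).trans (add_le_add
            ((norm_add_le _ _).trans (add_le_add ?_ ?_)) ?_)) ?_)
          · rw [norm_smul, norm_mul, norm_mul, norm_toCVec, η.norm_eq, hE1]
            gcongr
            exact hF η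
          · rw [norm_smul, norm_mul, norm_mul, norm_toCVec, η.norm_eq, e2]
            gcongr
            exact hF η
          · rw [norm_smul, norm_mul, norm_mul, norm_toCVec, η.norm_eq, hE1', e2]
            gcongr
          · rw [norm_smul, norm_mul, norm_mul, norm_toCVec, hE1', e2]
            gcongr
            exact hF θ
      _ = _ := by field_simp
  calc _ = ‖(grad P (s • (η : Plane)) - (E / (Real.sqrt s : ℂ) * F η) • toCVec (η : Plane))
          + ((E / (Real.sqrt s : ℂ) * F η) • toCVec (η : Plane)
            - (E' / (Real.sqrt r : ℂ) * F θ) • toCVec (θ : Plane))‖ := by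
        rw [← hEE', sub_add_sub_cancel]
        congr 3
        ring
    _ ≤ C * (1 / (s * Real.sqrt s))
        + (2 * ‖h‖ * M + k * ‖h‖ ^ 2 * M + C₃ + 2 * ‖h‖ * M) / (r * Real.sqrt r) := by
        refine (norm_add_le _ _).trans (add_le_add (a1.trans_eq (by ring)) hmain)
    _ ≤ C * (4 / (r * Real.sqrt r))
        + (2 * ‖h‖ * M + k * ‖h‖ ^ 2 * M + C₃ + 2 * ‖h‖ * M) / (r * Real.sqrt r) :=
        add_le_add (mul_le_mul_of_nonneg_left (one_div_mul_sqrt_le hr0 hs1) hC) le_rfl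
    _ = _ := by ring

end IsOutgoing

/-! ### The scalar potentials of a displacement field -/

/-- The scalar potential of the part of `u` of the given type, up to a constant factor: `div u` for
the compressional and `div^⊥ u` for the shear part. -/
def potential : Mode → (Plane → CVec) → Plane → ℂ
  | Mode.p, u => dvg u
  | Mode.s, u => dvgPerp u

/-- Rotation by a right angle in `ℂ²`. -/
def quarterTurn : CVec →L[ℂ] CVec :=
  LinearMap.toContinuousLinearMap
    { toFun := fun z => !₂[-(z 1), z 0]
      map_add' := fun z w => by ext i; fin_cases i <;> simp [add_comm]
      map_smul' := fun c z => by ext i; fin_cases i <;> simp }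

@[simp] lemma quarterTurn_apply (z : CVec) : quarterTurn z = !₂[-(z 1), z 0] := rfl

/-- The rotation that takes the direction of propagation to the direction of polarization. -/
def modeTurn : Mode → CVec →L[ℂ] CVec
  | Mode.p => ContinuousLinearMap.id ℂ CVec
  | Mode.s => quarterTurn

lemma norm_modeTurn (n : Mode) (z : CVec) : ‖modeTurn n z‖ = ‖z‖ := by
  cases n
  · rfl
  · have : ‖modeTurn Mode.s z‖ ^ 2 = ‖z‖ ^ 2 := by
      rw [CVec.norm_sq, CVec.norm_sq z]
      simp [modeTurn]
      ring
    exact (sq_eq_sq₀ (norm_nonneg _) (norm_nonneg _)).1 this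

lemma toCVec_polarization (n : Mode) (d : Plane) :
    toCVec (polarization n d) = modeTurn n (toCVec d) := by
  cases n
  · rfl
  · ext i
    fin_cases i <;> simp [modeTurn, polarization, perp]

lemma wavePart_eq (lam mu ω : ℝ) (n : Mode) (u : Plane → CVec) :
    wavePart lam mu ω n u = fun x => (-(1 / (waveNumber lam mu ω n : ℂ) ^ 2)) •
      modeTurn n (grad (potential n u) x) := by
  cases n
  · rfl
  · funext x
    ext i
    fin_cases i <;> simp [modeTurn, potential, wavePart]

section Smooth

variable {u : Plane → CVec}

lemma contDiffAt_potential {x : Plane} (hu : ContDiffAt ℝ (⊤ : ℕ∞) u x) (n : Mode) :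
    ContDiffAt ℝ (⊤ : ℕ∞) (potential n u) x := by
  cases n
  · exact ((hu.coord 0).pderiv 0).add ((hu.coord 1).pderiv 1)
  · exact ((hu.coord 0).pderiv 1).neg.add ((hu.coord 1).pderiv 0)

lemma fderiv_wavePart (lam mu ω : ℝ) {x : Plane} (hu : ContDiffAt ℝ (⊤ : ℕ∞) u x) (n : Mode)
    (v : Plane) : fderiv ℝ (wavePart lam mu ω n u) x v =
      (-(1 / (waveNumber lam mu ω n : ℂ) ^ 2)) •
        modeTurn n (fderiv ℝ (grad (potential n u)) x v) := by
  have h1 := (contDiffAt_grad (contDiffAt_potential hu n)).differentiableAt_of_infty.hasFDerivAt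
  have h2 := ((((-(1 / (waveNumber lam mu ω n : ℂ) ^ 2)) • modeTurn n).restrictScalars ℝ)
    |>.hasFDerivAt.comp x h1).fderiv
  rw [wavePart_eq]
  exact congrArg (fun L => L v) h2

variable {U : Set Plane}

lemma pderiv_pderiv_apply (hU : IsOpen U) (hu : ∀ x ∈ U, ContDiffAt ℝ (⊤ : ℕ∞) u x) {x : Plane}
    (hx : x ∈ U) (i j l : Fin 2) :
    (pderiv i (pderiv j u) x) l = pderiv i (pderiv j (fun y => u y l)) x := by
  rw [← pderiv_apply ((hu x hx).pderiv j).differentiableAt_of_infty]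
  exact pderiv_congr_of_isOpen hU
    (fun y hy => (pderiv_apply (hu y hy).differentiableAt_of_infty j l).symm) hx i

/-- Navier's equation in terms of the potentials: `Δ = ∇ div + ∇^⊥ div^⊥`. -/
lemma lameOp_eq (lam mu : ℝ) (hU : IsOpen U) (hu : ∀ x ∈ U, ContDiffAt ℝ (⊤ : ℕ∞) u x) {x : Plane}
    (hx : x ∈ U) : lameOp lam mu u x =
      ((lam + 2 * mu : ℝ) : ℂ) • grad (potential Mode.p u) x
        + (mu : ℂ) • gradPerp (potential Mode.s u) x := by
  have d : ∀ i j : Fin 2, DifferentiableAt ℝ (pderiv i (fun y => u y j)) x := fun i j =>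
    (((hu x hx).coord j).pderiv i).differentiableAt_of_infty
  have hp : ∀ i, pderiv i (potential Mode.p u) x = pderiv i (pderiv 0 (fun y => u y 0)) x
      + pderiv i (pderiv 1 (fun y => u y 1)) x := fun i => pderiv_add (d 0 0) (d 1 1) i
  have hs : ∀ i, pderiv i (potential Mode.s u) x = -pderiv i (pderiv 1 (fun y => u y 0)) x
      + pderiv i (pderiv 0 (fun y => u y 1)) x := fun i => by
    rw [← pderiv_neg]
    exact pderiv_add (d 1 0).fun_neg (d 0 1) i
  have c0 := pderiv_comm ((hu x hx).coord 0) 0 1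
  have c1 := pderiv_comm ((hu x hx).coord 1) 0 1
  change (mu : ℂ) • lapl u x + ((lam + mu : ℝ) : ℂ) • grad (potential Mode.p u) x = _
  ext i
  fin_cases i
  · simp [lapl, pderiv_pderiv_apply hU hu hx, hp, hs, c1]
    ring
  · simp [lapl, pderiv_pderiv_apply hU hu hx, hp, hs, c0]
    ring

lemma waveNumber_pos {lam mu ω : ℝ} (hmu : 0 < mu) (hlam : 0 < 2 * mu + lam) (hω : 0 < ω)
    (n : Mode) : 0 < waveNumber lam mu ω n := by
  cases n
  · exact div_pos hω (Real.sqrt_pos.2 (by linarith))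
  · exact div_pos hω (Real.sqrt_pos.2 hmu)

lemma mul_waveNumber_p_sq {lam mu ω : ℝ} (hlam : 0 < 2 * mu + lam) :
    (lam + 2 * mu) * waveNumber lam mu ω Mode.p ^ 2 = ω ^ 2 := by
  have h : 0 < lam + 2 * mu := by linarith
  simp only [waveNumber]
  rw [div_pow, Real.sq_sqrt h.le]
  field_simp

lemma mul_waveNumber_s_sq {lam mu ω : ℝ} (hmu : 0 < mu) :
    mu * waveNumber lam mu ω Mode.s ^ 2 = ω ^ 2 := by
  simp only [waveNumber]
  rw [div_pow, Real.sq_sqrt hmu.le]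
  field_simp

/-- Both potentials of a solution of Navier's equation solve a Helmholtz equation. -/
lemma helmholtz_potential {lam mu ω : ℝ} (hmu : 0 < mu) (hlam : 0 < 2 * mu + lam) (hU : IsOpen U)
    (hu : ∀ x ∈ U, ContDiffAt ℝ (⊤ : ℕ∞) u x)
    (hnav : ∀ x ∈ U, lameOp lam mu u x + ((ω : ℂ) ^ 2) • u x = 0) (n : Mode) {x : Plane}
    (hx : x ∈ U) :
    pderiv 0 (pderiv 0 (potential n u)) x + pderiv 1 (pderiv 1 (potential n u)) x
      = -(waveNumber lam mu ω n : ℂ) ^ 2 * potential n u x := by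
  set P := potential Mode.p u with hP
  set Q := potential Mode.s u with hQ
  have e0 : ∀ y ∈ U, ((lam + 2 * mu : ℝ) : ℂ) * pderiv 0 P y - (mu : ℂ) * pderiv 1 Q y
      + (ω : ℂ) ^ 2 * u y 0 = 0 := by
    intro y hy
    have := congrArg (fun z : CVec => z 0) (hnav y hy)
    rw [lameOp_eq lam mu hU hu hy] at this
    simpa [sub_eq_add_neg] using this
  have e1 : ∀ y ∈ U, ((lam + 2 * mu : ℝ) : ℂ) * pderiv 1 P y + (mu : ℂ) * pderiv 0 Q y
      + (ω : ℂ) ^ 2 * u y 1 = 0 := by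
    intro y hy
    have := congrArg (fun z : CVec => z 1) (hnav y hy)
    rw [lameOp_eq lam mu hU hu hy] at this
    simpa using this
  have cP := contDiffAt_potential (hu x hx) Mode.p
  have cQ := contDiffAt_potential (hu x hx) Mode.s
  have dP : ∀ i, DifferentiableAt ℝ (pderiv i P) x := fun i =>
    (cP.pderiv i).differentiableAt_of_infty
  have dQ : ∀ i, DifferentiableAt ℝ (pderiv i Q) x := fun i =>
    (cQ.pderiv i).differentiableAt_of_infty
  have du : ∀ j, DifferentiableAt ℝ (fun y => u y j) x := fun j =>
    ((hu x hx).coord j).differentiableAt_of_infty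
  have z : ∀ i, pderiv i (fun _ : Plane => (0 : ℂ)) x = 0 := fun i => by simp [pderiv]
  have f0 : ∀ i, ((lam + 2 * mu : ℝ) : ℂ) * pderiv i (pderiv 0 P) x
      - (mu : ℂ) * pderiv i (pderiv 1 Q) x + (ω : ℂ) ^ 2 * pderiv i (fun y => u y 0) x = 0 := by
    intro i
    have := pderiv_congr_of_isOpen hU e0 hx i
    rwa [z, pderiv_add (((dP 0).const_mul _).fun_sub ((dQ 1).const_mul _)) ((du 0).const_mul _),
      pderiv_sub ((dP 0).const_mul _) ((dQ 1).const_mul _), pderiv_const_mul _ (dP 0),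
      pderiv_const_mul _ (dQ 1), pderiv_const_mul _ (du 0)] at this
  have f1 : ∀ i, ((lam + 2 * mu : ℝ) : ℂ) * pderiv i (pderiv 1 P) x
      + (mu : ℂ) * pderiv i (pderiv 0 Q) x + (ω : ℂ) ^ 2 * pderiv i (fun y => u y 1) x = 0 := by
    intro i
    have := pderiv_congr_of_isOpen hU e1 hx i
    rwa [z, pderiv_add (((dP 1).const_mul _).fun_add ((dQ 0).const_mul _)) ((du 1).const_mul _),
      pderiv_add ((dP 1).const_mul _) ((dQ 0).const_mul _), pderiv_const_mul _ (dP 1),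
      pderiv_const_mul _ (dQ 0), pderiv_const_mul _ (du 1)] at this
  have sP := pderiv_comm cP 0 1
  have sQ := pderiv_comm cQ 0 1
  cases n
  · have hne : ((lam + 2 * mu : ℝ) : ℂ) ≠ 0 := by
      exact_mod_cast (by linarith : 0 < lam + 2 * mu).ne'
    have hk : ((lam + 2 * mu : ℝ) : ℂ) * (waveNumber lam mu ω Mode.p : ℂ) ^ 2 = (ω : ℂ) ^ 2 := by
      exact_mod_cast mul_waveNumber_p_sq hlam
    have hdef : potential Mode.p u x = pderiv 0 (fun y => u y 0) x + pderiv 1 (fun y => u y 1) x :=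
      rfl
    apply mul_left_cancel₀ hne
    rw [hdef]
    linear_combination f0 0 + f1 1 + (mu : ℂ) * sQ
      + (pderiv 0 (fun y => u y 0) x + pderiv 1 (fun y => u y 1) x) * hk
  · have hne : (mu : ℂ) ≠ 0 := by exact_mod_cast hmu.ne'
    have hk : (mu : ℂ) * (waveNumber lam mu ω Mode.s : ℂ) ^ 2 = (ω : ℂ) ^ 2 := by
      exact_mod_cast mul_waveNumber_s_sq hmu
    have hdef : potential Mode.s u x = -pderiv 1 (fun y => u y 0) x + pderiv 0 (fun y => u y 1) x :=
      rfl
    apply mul_left_cancel₀ hne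
    rw [hdef]
    linear_combination f1 0 - f0 1 - ((lam + 2 * mu : ℝ) : ℂ) * sP
      + (-pderiv 1 (fun y => u y 0) x + pderiv 0 (fun y => u y 1) x) * hk

end Smooth

/-- The factor by which the far field of `∇ potential` differs from the far field pattern. -/
def farFieldFactor (lam mu ω : ℝ) (n : Mode) : ℂ :=
  -(waveNumber lam mu ω n : ℂ) ^ 2 * (((waveNumber lam mu ω n / ω : ℝ) : ℂ)
    * (Complex.exp (Complex.I * (Real.pi / 4 : ℝ)) / (Real.sqrt (8 * Real.pi * ω) : ℂ)))

lemma farFieldFactor_ne_zero {lam mu ω : ℝ} (hmu : 0 < mu) (hlam : 0 < 2 * mu + lam) (hω : 0 < ω)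
    (n : Mode) : farFieldFactor lam mu ω n ≠ 0 := by
  have hk := waveNumber_pos hmu hlam hω n
  have h1 : (waveNumber lam mu ω n : ℂ) ≠ 0 := by exact_mod_cast hk.ne'
  have h2 : ((waveNumber lam mu ω n / ω : ℝ) : ℂ) ≠ 0 := by exact_mod_cast (div_pos hk hω).ne'
  have h3 : (Real.sqrt (8 * Real.pi * ω) : ℂ) ≠ 0 := by
    exact_mod_cast (Real.sqrt_pos.2 (mul_pos (mul_pos (by norm_num) Real.pi_pos) hω)).ne'
  exact mul_ne_zero (neg_ne_zero.2 (pow_ne_zero 2 h1))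
    (mul_ne_zero h2 (div_ne_zero (Complex.exp_ne_zero _) h3))

/-- The defect in the far field expansion of `u_n` is that of the gradient of the potential, up to
an isometry and a constant. -/
lemma wavePart_sub_farField {lam mu ω : ℝ} (hmu : 0 < mu) (hlam : 0 < 2 * mu + lam) (hω : 0 < ω)
    (n : Mode) (u : Plane → CVec) (x : Plane) (θ : Plane) (r : ℝ) (a : ℂ) :
    wavePart lam mu ω n u x - (((waveNumber lam mu ω n / ω : ℝ) : ℂ)
        * (Complex.exp (Complex.I * (Real.pi / 4 : ℝ)) / (Real.sqrt (8 * Real.pi * ω) : ℂ))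
        * (Complex.exp (Complex.I * ((waveNumber lam mu ω n * r : ℝ) : ℂ)) / (Real.sqrt r : ℂ))
        * a) • toCVec (polarization n θ)
      = (-(1 / (waveNumber lam mu ω n : ℂ) ^ 2)) • modeTurn n (grad (potential n u) x
        - (Complex.exp (Complex.I * ((waveNumber lam mu ω n * r : ℝ) : ℂ)) / (Real.sqrt r : ℂ)
          * (farFieldFactor lam mu ω n * a)) • toCVec θ) := by
  have hk : (waveNumber lam mu ω n : ℂ) ≠ 0 := by
    exact_mod_cast (waveNumber_pos hmu hlam hω n).ne'
  rw [wavePart_eq, toCVec_polarization, map_sub, map_smul, smul_sub, smul_smul]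
  congr 2
  rw [farFieldFactor]
  field_simp

lemma norm_neg_one_div_sq_smul (k : ℝ) (n : Mode) (z : CVec) :
    ‖(-(1 / (k : ℂ) ^ 2)) • modeTurn n z‖ = 1 / k ^ 2 * ‖z‖ := by
  rw [norm_smul, norm_modeTurn, norm_neg, norm_div, norm_one, norm_pow, Complex.norm_real,
    Real.norm_eq_abs, sq_abs]

/-- In the exterior of a large disc, the potentials of a radiating solution of Navier's equation
with far field patterns are outgoing. -/
lemma isOutgoing_potential {lam mu ω : ℝ} (hmu : 0 < mu) (hlam : 0 < 2 * mu + lam) (hω : 0 < ω)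
    {u : Plane → CVec} {U : Set Plane} (hU : IsOpen U) (hu : ∀ x ∈ U, ContDiffAt ℝ (⊤ : ℕ∞) u x)
    (hnav : ∀ x ∈ U, lameOp lam mu u x + ((ω : ℂ) ^ 2) • u x = 0)
    (hrad : IsRadiating lam mu ω u) {f : Mode → Circle2 → ℂ}
    (hfar : HasFarFieldPatterns lam mu ω u f) {ρ : ℝ} (hρ : 0 ≤ ρ)
    (hρU : ∀ x : Plane, ρ < ‖x‖ → x ∈ U) (n : Mode) :
    IsOutgoing (waveNumber lam mu ω n) ρ (potential n u)
      (fun θ => farFieldFactor lam mu ω n * f n θ) where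
  nonneg := hρ
  smooth x hx := contDiffAt_potential (hu x (hρU x hx)) n
  helmholtz x hx := helmholtz_potential hmu hlam hU hu hnav n (hρU x hx)
  radiating := by
    intro ε hε
    have hk := waveNumber_pos hmu hlam hω n
    obtain ⟨R, hR, h⟩ := hrad n (ε / waveNumber lam mu ω n ^ 2) (by positivity)
    refine ⟨max R (ρ + 1), lt_of_lt_of_le hR (le_max_left _ _), fun r hr θ => ?_⟩
    have hr1 : ρ + 1 ≤ r := (le_max_right _ _).trans hr
    have hx : ρ < ‖r • (θ : Plane)‖ := by rw [θ.norm_smul_of_nonneg (by linarith)]; linarith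
    have h1 := h r ((le_max_left _ _).trans hr) θ
    rw [fderiv_wavePart lam mu ω (hu _ (hρU _ hx)), wavePart_eq, smul_comm (Complex.I * _),
      ← smul_sub, ← map_smul, ← map_sub, norm_neg_one_div_sq_smul] at h1
    have h2 := mul_le_mul_of_nonneg_left h1 (by positivity : 0 ≤ waveNumber lam mu ω n ^ 2)
    rw [← mul_assoc, mul_one_div_cancel (by positivity), one_mul] at h2
    refine h2.trans (le_of_eq ?_)
    field_simp
  farField := by
    have hk := waveNumber_pos hmu hlam hω n
    obtain ⟨C, R, hR, h⟩ := hfar n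
    refine ⟨waveNumber lam mu ω n ^ 2 * C, R, hR, fun r hr θ => ?_⟩
    have h1 := h r hr θ
    rw [wavePart_sub_farField hmu hlam hω, norm_neg_one_div_sq_smul] at h1
    have h2 := mul_le_mul_of_nonneg_left h1 (by positivity : 0 ≤ waveNumber lam mu ω n ^ 2)
    rw [← mul_assoc, mul_one_div_cancel (by positivity), one_mul] at h2
    exact h2.trans_eq (mul_assoc _ _ _).symm

lemma isOpen_exterior (Ω : Set Plane) : IsOpen (exterior Ω) := isClosed_closure.isOpen_compl

lemma exists_radius_exterior {Ω : Set Plane} (hΩ : Bornology.IsBounded Ω) :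
    ∃ ρ : ℝ, 0 ≤ ρ ∧ ∀ x : Plane, ρ < ‖x‖ → x ∈ exterior Ω := by
  obtain ⟨ρ, hρ⟩ := hΩ.closure.exists_norm_le
  refine ⟨max ρ 0, le_max_right _ _, fun x hx hmem => ?_⟩
  exact absurd (hρ x hmem) (not_le.2 ((le_max_left _ _).trans_lt hx))

namespace IsScatteredField

variable {lam mu ω : ℝ} {Ω : Set Plane} {m : Mode} {d : Plane} {u : Plane → CVec}

lemma contDiffAt (hu : IsScatteredField lam mu ω Ω m d u) {x : Plane} (hx : x ∈ exterior Ω) :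
    ContDiffAt ℝ (⊤ : ℕ∞) u x :=
  (hu.smooth x hx).contDiffAt ((isOpen_exterior Ω).mem_nhds hx)

end IsScatteredField

/-! ### Translating the scattered field -/

section ShiftField

variable {F : Type*} [NormedAddCommGroup F] [NormedSpace ℂ F]

/-- The field `u`, moved by `h` and multiplied by the constant `c`. -/
def shiftField (c : ℂ) (h : Plane) (u : Plane → F) : Plane → F := fun x => c • u (x - h)

lemma fderiv_shiftField (c : ℂ) (h : Plane) (u : Plane → F) (x v : Plane) :
    fderiv ℝ (shiftField c h u) x v = c • fderiv ℝ u (x - h) v := by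
  have h1 : fderiv ℝ (c • fun y => u (y - h)) x = c • fderiv ℝ (fun y => u (y - h)) x := by
    rw [fderiv_const_smul_field]; rfl
  change fderiv ℝ (c • fun y => u (y - h)) x v = _
  rw [h1, fderiv_comp_sub]
  rfl

lemma pderiv_shiftField (c : ℂ) (h : Plane) (u : Plane → F) (i : Fin 2) :
    pderiv i (shiftField c h u) = shiftField c h (pderiv i u) :=
  funext fun x => fderiv_shiftField c h u x _

variable (c : ℂ) (h : Plane)

lemma shiftField_coord (u : Plane → CVec) (j : Fin 2) :
    (fun y => shiftField c h u y j) = shiftField c h (fun y => u y j) := rfl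

lemma dvg_shiftField (u : Plane → CVec) : dvg (shiftField c h u) = shiftField c h (dvg u) := by
  funext x
  simp only [dvg, shiftField_coord, pderiv_shiftField]
  simp [shiftField, dvg, mul_add]

lemma dvgPerp_shiftField (u : Plane → CVec) :
    dvgPerp (shiftField c h u) = shiftField c h (dvgPerp u) := by
  funext x
  simp only [dvgPerp, shiftField_coord, pderiv_shiftField]
  simp [shiftField, dvgPerp, mul_add]

lemma grad_shiftField (g : Plane → ℂ) : grad (shiftField c h g) = shiftField c h (grad g) := by
  funext x
  ext i
  fin_cases i <;> simp [pderiv_shiftField] <;> simp [shiftField]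

lemma potential_shiftField (n : Mode) (u : Plane → CVec) :
    potential n (shiftField c h u) = shiftField c h (potential n u) := by
  cases n
  · exact dvg_shiftField c h u
  · exact dvgPerp_shiftField c h u

lemma lameOp_shiftField (lam mu : ℝ) (u : Plane → CVec) :
    lameOp lam mu (shiftField c h u) = shiftField c h (lameOp lam mu u) := by
  funext x
  simp only [lameOp, lapl, pderiv_shiftField, dvg_shiftField, grad_shiftField]
  simp only [shiftField, lameOp, lapl]
  module

lemma wavePart_shiftField (lam mu ω : ℝ) (n : Mode) (u : Plane → CVec) :
    wavePart lam mu ω n (shiftField c h u) = shiftField c h (wavePart lam mu ω n u) := by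
  simp only [wavePart_eq, potential_shiftField, grad_shiftField]
  funext x
  simp only [shiftField, map_smul]
  exact smul_comm _ _ _

end ShiftField

lemma exterior_shifted (Ω : Set Plane) (h : Plane) :
    exterior (shifted Ω h) = (fun x => x - h) ⁻¹' exterior Ω := by
  have h1 : shifted Ω h = Homeomorph.subRight h ⁻¹' Ω := by
    ext y
    constructor
    · rintro ⟨z, hz, rfl⟩
      simpa using hz
    · intro hy
      exact ⟨y - h, hy, by simp⟩
  rw [exterior, h1, ← Homeomorph.preimage_closure]
  rfl

lemma eLpNorm_comp_sub_restrict {F : Type*} [NormedAddCommGroup F] (g : Plane → F) (h : Plane)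
    (S : Set Plane) : eLpNorm (fun x => g (x - h)) 2 (volume.restrict ((fun x => x - h) ⁻¹' S))
      = eLpNorm g 2 (volume.restrict S) := by
  have he : MeasurableEmbedding (fun x : Plane => x - h) :=
    (Homeomorph.subRight h).measurableEmbedding
  have hm := (measurePreserving_sub_right (volume : Measure Plane) h).restrict_preimage_emb he S
  rw [← hm.map_eq, he.eLpNorm_map_measure]
  rfl

lemma MeasureTheory.MemLp.shift {F : Type*} [NormedAddCommGroup F] [NormedSpace ℂ F]
    {g : Plane → F} {S : Set Plane} (hg : MemLp g 2 (volume.restrict S)) (c : ℂ) (h : Plane) :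
    MemLp (shiftField c h g) 2 (volume.restrict ((fun x => x - h) ⁻¹' S)) := by
  have he : MeasurableEmbedding (fun x : Plane => x - h) :=
    (Homeomorph.subRight h).measurableEmbedding
  have hm := (measurePreserving_sub_right (volume : Measure Plane) h).restrict_preimage_emb he S
  exact (hg.comp_measurePreserving hm).const_smul c

lemma IsH1Loc.shift {Ω : Set Plane} {u : Plane → CVec} (hu : IsH1Loc Ω u) (c : ℂ) (h : Plane) :
    IsH1Loc (shifted Ω h) (shiftField c h u) := by
  intro R
  have hsub : Metric.ball 0 R ∩ exterior (shifted Ω h)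
      ⊆ (fun x => x - h) ⁻¹' (Metric.ball 0 (R + ‖h‖) ∩ exterior Ω) := by
    rintro x ⟨hx1, hx2⟩
    rw [exterior_shifted] at hx2
    refine ⟨?_, hx2⟩
    rw [mem_ball_zero_iff] at hx1 ⊢
    linarith [norm_sub_le x h]
  obtain ⟨h1, h2⟩ := hu (R + ‖h‖)
  refine ⟨(h1.shift c h).mono_measure (Measure.restrict_mono hsub le_rfl), fun i => ?_⟩
  rw [pderiv_shiftField]
  exact ((h2 i).shift c h).mono_measure (Measure.restrict_mono hsub le_rfl)

lemma VanishesOnBoundary.shift {Ω : Set Plane} {u : Plane → CVec}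
    (hu : VanishesOnBoundary Ω u) {c : ℂ} (hc : ‖c‖ = 1) (h : Plane) :
    VanishesOnBoundary (shifted Ω h) (shiftField c h u) := by
  intro χ hχ hχc ε hε
  set χ' : Plane → ℝ := fun y => χ (y + h) with hχ'
  obtain ⟨φ, hφ, hφc, hφΩ, h0, h1⟩ := hu χ'
    (hχ.comp (g := χ) (f := fun x : Plane => x + h) (by fun_prop))
    (hχc.comp_homeomorph (Homeomorph.addRight h)) ε hε
  have hsupp : tsupport (shiftField c h φ) ⊆ (fun x => x - h) ⁻¹' tsupport φ := by
    refine (tsupport_smul_subset_right (fun _ => c) _).trans ?_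
    exact (tsupport_comp_eq_preimage φ (Homeomorph.subRight h)).le
  have hprod : (fun y => χ y • shiftField c h u y)
      = shiftField c h (fun y => χ' y • u y) := by
    funext y
    simp only [shiftField, hχ', sub_add_cancel]
    exact smul_comm _ _ _
  have hnorm : ∀ g g' : Plane → CVec, eLpNorm (fun x => shiftField c h g x
      - shiftField c h g' x) 2 (volume.restrict (exterior (shifted Ω h)))
      = eLpNorm (fun x => g x - g' x) 2 (volume.restrict (exterior Ω)) := by
    intro g g'
    rw [exterior_shifted, ← eLpNorm_comp_sub_restrict (fun x => g x - g' x) h]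
    refine eLpNorm_congr_norm_ae (Filter.Eventually.of_forall fun x => ?_)
    simp only [shiftField]
    rw [← smul_sub, norm_smul, hc, one_mul]
  have hφ' : ContDiff ℝ (⊤ : ℕ∞) (shiftField c h φ) :=
    (hφ.comp (g := φ) (f := fun x : Plane => x - h) (by fun_prop)).const_smul c
  have hφc' : HasCompactSupport (shiftField c h φ) :=
    (hφc.comp_homeomorph (Homeomorph.subRight h)).smul_left (f := fun _ => c)
  refine ⟨shiftField c h φ, hφ', hφc', ?_, ?_, fun i => ?_⟩
  · rw [exterior_shifted]
    exact hsupp.trans (Set.preimage_mono hφΩ)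
  · have := hnorm (fun y => χ' y • u y) φ
    rw [← hprod] at this
    exact this.trans_le h0
  · rw [hprod, pderiv_shiftField, pderiv_shiftField]
    exact (hnorm _ _).trans_le (h1 i)

lemma planeWave_eq_shiftField (lam mu ω : ℝ) (m : Mode) (d h : Plane) :
    planeWave lam mu ω m d = shiftField
      (Complex.exp (Complex.I * ((waveNumber lam mu ω m * inner ℝ h d : ℝ) : ℂ))) h
      (planeWave lam mu ω m d) := by
  funext x
  simp only [shiftField, planeWave, smul_smul, ← Complex.exp_add]
  congr 2
  rw [inner_sub_left]
  push_cast
  ring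

/-- Moving the body by `h` moves the scattered field by `h` and multiplies it by `e^{ik_m h·d}`, the
phase that the incident wave gains from the origin to `h`. -/
lemma AreFarFieldPatterns.shifted {lam mu ω : ℝ} (hmu : 0 < mu) (hlam : 0 < 2 * mu + lam)
    (hω : 0 < ω) {Ω : Set Plane} (hΩ : Bornology.IsBounded Ω) (h : Plane) {m : Mode} {d : Plane}
    {f : Mode → Circle2 → ℂ} (hf : AreFarFieldPatterns lam mu ω Ω m d f) :
    AreFarFieldPatterns lam mu ω (shifted Ω h) m d
      (fun n θ => phaseFactor lam mu ω m n h d θ * f n θ) := by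
  obtain ⟨u, hu, hfar⟩ := hf
  set c := Complex.exp (Complex.I * ((waveNumber lam mu ω m * inner ℝ h d : ℝ) : ℂ)) with hc
  have hc1 : ‖c‖ = 1 := Complex.norm_exp_I_mul_ofReal' _
  obtain ⟨ρ, hρ, hρΩ⟩ := exists_radius_exterior hΩ
  have hsm : ∀ x ∈ exterior Ω, ContDiffAt ℝ (⊤ : ℕ∞) u x := fun x hx => hu.contDiffAt hx
  have hout := isOutgoing_potential hmu hlam hω (isOpen_exterior Ω) hsm hu.navier hu.radiating
    hfar hρ hρΩ
  refine ⟨shiftField c h u, ⟨?_, hu.h1Loc.shift c h, ?_, ?_, ?_⟩, ?_⟩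
  · intro x hx
    rw [exterior_shifted] at hx
    have h1 : ContDiffAt ℝ (⊤ : ℕ∞) (fun y : Plane => y - h) x := by fun_prop
    exact (((hsm (x - h) hx).comp x h1).const_smul c).contDiffWithinAt
  · intro x hx
    rw [exterior_shifted] at hx
    have := congrArg (fun z => c • z) (hu.navier (x - h) hx)
    rw [lameOp_shiftField]
    simp only [shiftField, smul_add, smul_zero] at this ⊢
    rw [smul_comm] at this
    rwa [smul_comm ((ω : ℂ) ^ 2)] at this ⊢
  · have := hu.dirichlet.shift hc1 h
    convert this using 1
    funext x
    conv_lhs => rw [planeWave_eq_shiftField lam mu ω m d h]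
    simp only [shiftField, smul_add, hc]
  · intro n ε hε
    have hk := waveNumber_pos hmu hlam hω n
    obtain ⟨R, hR, hb⟩ := (hout n).radiating_comp_sub hk h
      (ε := ε * waveNumber lam mu ω n ^ 2) (by positivity)
    refine ⟨max R (ρ + ‖h‖ + 1), lt_of_lt_of_le hR (le_max_left _ _), fun r hr θ => ?_⟩
    have hrρ : ρ + ‖h‖ + 1 ≤ r := (le_max_right _ _).trans hr
    have hx : ρ < ‖r • (θ : Plane) - h‖ := by
      have := norm_sub_norm_le (r • (θ : Plane)) h
      rw [θ.norm_smul_of_nonneg (by linarith [norm_nonneg h])] at this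
      linarith
    rw [wavePart_shiftField, fderiv_shiftField, fderiv_wavePart lam mu ω (hsm _ (hρΩ _ hx))]
    simp only [shiftField, wavePart_eq]
    rw [smul_comm (Complex.I * _) c, ← smul_sub, smul_comm (Complex.I * _), ← smul_sub, ← map_smul,
      ← map_sub, norm_smul, hc1, one_mul, norm_neg_one_div_sq_smul]
    refine (mul_le_mul_of_nonneg_left (hb r ((le_max_left _ _).trans hr) θ)
      (by positivity)).trans (le_of_eq ?_)
    field_simp
  · intro n
    have hk := waveNumber_pos hmu hlam hω n
    obtain ⟨C, R, hR, hb⟩ := (hout n).farField_comp_sub hk h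
    refine ⟨1 / waveNumber lam mu ω n ^ 2 * C, R, hR, fun r hr θ => ?_⟩
    rw [wavePart_sub_farField hmu hlam hω, norm_neg_one_div_sq_smul, potential_shiftField,
      grad_shiftField, mul_assoc]
    refine mul_le_mul_of_nonneg_left ((le_of_eq ?_).trans (hb r hr θ)) (by positivity)
    have hcn : ∀ z : CVec, ‖z‖ = ‖c • z‖ := fun z => by rw [norm_smul, hc1, one_mul]
    rw [hcn (grad (potential n u) _ - _), smul_sub, smul_smul]
    simp only [shiftField, phaseFactor, ← hc]
    congr 3
    ring

/-! ### Green's identity for fields that vanish on the boundary -/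

lemma integral_pderiv_eq_zero {X : Plane → ℂ} (hX : ContDiff ℝ 1 X) (hc : HasCompactSupport X)
    (i : Fin 2) : ∫ x, pderiv i X x = 0 := by
  have hd : Continuous (fun x => fderiv ℝ X x (EuclideanSpace.single i 1)) :=
    (hX.continuous_fderiv (by simp)).clm_apply continuous_const
  have hdc : HasCompactSupport (fun x => fderiv ℝ X x (EuclideanSpace.single i 1)) :=
    hc.fderiv_apply ℝ _
  have := integral_smul_fderiv_eq_neg_fderiv_smul_of_integrable (𝕜 := ℝ) (μ := volume)
    (f := fun _ : Plane => (1 : ℝ)) (g := X) (v := EuclideanSpace.single i 1)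
    (by simp)
    (by simpa using hd.integrable_of_hasCompactSupport hdc)
    (by simpa using hX.continuous.integrable_of_hasCompactSupport hc)
    (fun _ _ => differentiableAt_const _) (fun x _ => (hX.differentiable (by simp)) x)
  simpa [pderiv] using this

lemma pderiv_eq_zero_of_notMem_tsupport {F : Type*} [NormedAddCommGroup F] [NormedSpace ℝ F]
    {f : Plane → F} {x : Plane} (hx : x ∉ tsupport f) (i : Fin 2) : pderiv i f x = 0 := by
  have h := notMem_tsupport_iff_eventuallyEq.1 hx
  rw [Filter.EventuallyEq.pderiv_eq h i]
  simp [pderiv]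

lemma integral_inner_pderiv_add {U : Set Plane} {φ B : Plane → CVec}
    (hφ : ContDiff ℝ (⊤ : ℕ∞) φ) (hφc : HasCompactSupport φ) (hφU : tsupport φ ⊆ U)
    (hB : ∀ x ∈ U, ContDiffAt ℝ (⊤ : ℕ∞) B x) (i : Fin 2) :
    Integrable (fun x => inner ℂ (φ x) (pderiv i B x) + inner ℂ (pderiv i φ x) (B x)) ∧
      ∫ x, (inner ℂ (φ x) (pderiv i B x) + inner ℂ (pderiv i φ x) (B x)) = 0 := by
  set X : Plane → ℂ := fun x => inner ℂ (φ x) (B x) with hX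
  have hXs : tsupport X ⊆ tsupport φ := by
    refine closure_mono fun x hx => ?_
    rw [Function.mem_support] at hx ⊢
    intro h0
    exact hx (by simp [hX, h0])
  have hXc : HasCompactSupport X := hφc.of_isClosed_subset (isClosed_tsupport X) hXs
  have hXd : ContDiff ℝ 1 X := by
    rw [contDiff_iff_contDiffAt]
    intro x
    by_cases hx : x ∈ tsupport φ
    · exact (hφ.contDiffAt.inner ℂ (hB x (hφU hx))).of_le (by exact_mod_cast le_top)
    · have h := notMem_tsupport_iff_eventuallyEq.1 (fun h => hx (hXs h))
      exact contDiffAt_const.congr_of_eventuallyEq h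
  suffices h : (fun x => inner ℂ (φ x) (pderiv i B x) + inner ℂ (pderiv i φ x) (B x))
      = pderiv i X by
    rw [h]
    refine ⟨?_, integral_pderiv_eq_zero hXd hXc i⟩
    have hc : Continuous (pderiv i X) :=
      (hXd.continuous_fderiv (by simp)).clm_apply continuous_const
    exact hc.integrable_of_hasCompactSupport (hXc.fderiv_apply ℝ _)
  funext x
  by_cases hx : x ∈ tsupport φ
  · exact (fderiv_inner_apply ℂ (hφ.contDiffAt.differentiableAt_of_infty)
      (hB x (hφU hx)).differentiableAt_of_infty _).symm
  · rw [pderiv_eq_zero_of_notMem_tsupport hx, image_eq_zero_of_notMem_tsupport hx,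
      pderiv_eq_zero_of_notMem_tsupport (fun h => hx (hXs h))]
    simp

lemma norm_integral_inner_le {α : Type*} [MeasurableSpace α] {μ : Measure α} {f g : α → CVec}
    (hf : MemLp f 2 μ) (hg : MemLp g 2 μ) :
    ‖∫ x, inner ℂ (f x) (g x) ∂μ‖ ≤ (eLpNorm f 2 μ).toReal * (eLpNorm g 2 μ).toReal := by
  have h1 : ∫ x, inner ℂ (f x) (g x) ∂μ = inner ℂ (hf.toLp f) (hg.toLp g) := by
    rw [L2.inner_def]
    refine integral_congr_ae ?_
    filter_upwards [hf.coeFn_toLp, hg.coeFn_toLp] with x h1 h2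
    rw [h1, h2]
  rw [h1, ← Lp.norm_toLp f hf, ← Lp.norm_toLp g hg]
  exact norm_inner_le_norm _ _

lemma integrable_inner_of_memLp {α : Type*} [MeasurableSpace α] {μ : Measure α} {f g : α → CVec}
    (hf : MemLp f 2 μ) (hg : MemLp g 2 μ) : Integrable (fun x => inner ℂ (f x) (g x)) μ := by
  refine (L2.integrable_inner (𝕜 := ℂ) (hf.toLp f) (hg.toLp g)).congr ?_
  filter_upwards [hf.coeFn_toLp, hg.coeFn_toLp] with x h1 h2
  rw [h1, h2]

/-- A linear functional that is continuous in the `H¹` norm vanishes on the closure of its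
kernel. -/
lemma integral_inner_eq_zero_of_approx {D : Set Plane} {A B₀ B₁ w : Plane → CVec}
    (hA : MemLp A 2 (volume.restrict D)) (hB₀ : MemLp B₀ 2 (volume.restrict D))
    (hB₁ : MemLp B₁ 2 (volume.restrict D)) (hw : MemLp w 2 (volume.restrict D))
    (hdw : ∀ i, MemLp (pderiv i w) 2 (volume.restrict D))
    (happ : ∀ ε : ENNReal, 0 < ε → ∃ φ : Plane → CVec, ContDiff ℝ (⊤ : ℕ∞) φ ∧
      HasCompactSupport φ ∧
      eLpNorm (fun x => w x - φ x) 2 (volume.restrict D) ≤ ε ∧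
      (∀ i, eLpNorm (fun x => pderiv i w x - pderiv i φ x) 2 (volume.restrict D) ≤ ε) ∧
      ∫ x in D, (inner ℂ (φ x) (A x) + (inner ℂ (pderiv 0 φ x) (B₀ x)
        + inner ℂ (pderiv 1 φ x) (B₁ x))) = 0) :
    ∫ x in D, (inner ℂ (w x) (A x) + (inner ℂ (pderiv 0 w x) (B₀ x)
        + inner ℂ (pderiv 1 w x) (B₁ x))) = 0 := by
  set μ := volume.restrict D with hμ
  set K := (eLpNorm A 2 μ).toReal + ((eLpNorm B₀ 2 μ).toReal + (eLpNorm B₁ 2 μ).toReal) with hK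
  have hK0 : 0 ≤ K := by positivity
  rw [← norm_le_zero_iff]
  refine le_of_forall_pos_le_add fun δ hδ => ?_
  rw [zero_add]
  set ε := δ / (K + 1) with hε
  have hε0 : 0 < ε := by positivity
  obtain ⟨φ, hφ, hφc, h0, h1, hφ0⟩ := happ (ENNReal.ofReal ε) (ENNReal.ofReal_pos.2 hε0)
  have mφ : MemLp φ 2 μ := hφ.continuous.memLp_of_hasCompactSupport hφc
  have mdφ : ∀ i, MemLp (pderiv i φ) 2 μ := fun i => by
    have hc : Continuous (pderiv i φ) :=
      (hφ.continuous_fderiv (by simp)).clm_apply continuous_const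
    exact hc.memLp_of_hasCompactSupport (hφc.fderiv_apply ℝ _)
  have hsub : ∫ x, (inner ℂ (w x) (A x) + (inner ℂ (pderiv 0 w x) (B₀ x)
        + inner ℂ (pderiv 1 w x) (B₁ x))) ∂μ
      = ∫ x, inner ℂ (w x - φ x) (A x) ∂μ + (∫ x, inner ℂ (pderiv 0 w x - pderiv 0 φ x) (B₀ x) ∂μ
        + ∫ x, inner ℂ (pderiv 1 w x - pderiv 1 φ x) (B₁ x) ∂μ) := by
    rw [← sub_zero (∫ x, (inner ℂ (w x) (A x) + _) ∂μ), ← hφ0, ← integral_sub,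
      ← integral_add, ← integral_add]
    · congr 1
      funext x
      simp only [inner_sub_left]
      ring
    · exact integrable_inner_of_memLp (hw.sub mφ) hA
    · exact (integrable_inner_of_memLp ((hdw 0).sub (mdφ 0)) hB₀).add
        (integrable_inner_of_memLp ((hdw 1).sub (mdφ 1)) hB₁)
    · exact integrable_inner_of_memLp ((hdw 0).sub (mdφ 0)) hB₀
    · exact integrable_inner_of_memLp ((hdw 1).sub (mdφ 1)) hB₁
    · exact (integrable_inner_of_memLp hw hA).add ((integrable_inner_of_memLp (hdw 0) hB₀).add
        (integrable_inner_of_memLp (hdw 1) hB₁))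
    · exact (integrable_inner_of_memLp mφ hA).add ((integrable_inner_of_memLp (mdφ 0) hB₀).add
        (integrable_inner_of_memLp (mdφ 1) hB₁))
  have hterm : ∀ {f g : Plane → CVec}, MemLp f 2 μ → MemLp g 2 μ →
      eLpNorm f 2 μ ≤ ENNReal.ofReal ε →
      ‖∫ x, inner ℂ (f x) (g x) ∂μ‖ ≤ ε * (eLpNorm g 2 μ).toReal := by
    intro f g hf hg hle
    refine (norm_integral_inner_le hf hg).trans ?_
    gcongr
    exact ENNReal.toReal_le_of_le_ofReal hε0.le hle
  rw [hsub]
  calc _ ≤ ε * (eLpNorm A 2 μ).toReal + (ε * (eLpNorm B₀ 2 μ).toReal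
        + ε * (eLpNorm B₁ 2 μ).toReal) := by
        refine (norm_add_le _ _).trans (add_le_add (hterm (hw.sub mφ) hA h0)
          ((norm_add_le _ _).trans (add_le_add (hterm ((hdw 0).sub (mdφ 0)) hB₀ (h1 0))
            (hterm ((hdw 1).sub (mdφ 1)) hB₁ (h1 1)))))
    _ = ε * K := by rw [hK]; ring
    _ ≤ ε * (K + 1) := by gcongr; linarith
    _ = δ := by rw [hε]; field_simp

lemma pderiv_continuous {F : Type*} [NormedAddCommGroup F] [NormedSpace ℝ F] {f : Plane → F}
    (hf : ContDiff ℝ (⊤ : ℕ∞) f) (i : Fin 2) : Continuous (pderiv i f) :=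
  (hf.continuous_fderiv (by simp)).clm_apply continuous_const

/-- The density of the energy flux of `w` through the level sets of the cut-off function `χ`, for
the quadratic form `(λ + 2μ) |div w|² + μ |div^⊥ w|²`. -/
def fluxDensity (lam mu : ℝ) (χ : Plane → ℝ) (w : Plane → CVec) (x : Plane) : ℂ :=
  ((lam + 2 * mu : ℝ) : ℂ) * potential Mode.p w x *
      (((pderiv 0 χ x : ℝ) : ℂ) * star (w x 0) + ((pderiv 1 χ x : ℝ) : ℂ) * star (w x 1))
    + (mu : ℂ) * potential Mode.s w x *
      (-((pderiv 1 χ x : ℝ) : ℂ) * star (w x 0) + ((pderiv 0 χ x : ℝ) : ℂ) * star (w x 1))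

/-- A field that vanishes on the boundary has no net energy flux: test Navier's equation with
`χ w` and take imaginary parts. -/
lemma integral_fluxDensity_im {lam mu ω : ℝ} {Ω : Set Plane} {w : Plane → CVec}
    (hw : ∀ x ∈ exterior Ω, ContDiffAt ℝ (⊤ : ℕ∞) w x)
    (hnav : ∀ x ∈ exterior Ω, lameOp lam mu w x + ((ω : ℂ) ^ 2) • w x = 0)
    (hH1 : IsH1Loc Ω w) (hvan : VanishesOnBoundary Ω w) {χ : Plane → ℝ}
    (hχ : ContDiff ℝ (⊤ : ℕ∞) χ) (hχc : HasCompactSupport χ)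
    (hχΩ : ∀ x ∉ exterior Ω, ∀ i, pderiv i χ x = 0) :
    ∫ x, (fluxDensity lam mu χ w x).im = 0 := by
  set P := potential Mode.p w with hP
  set Q := potential Mode.s w with hQ
  set L : ℂ := ((lam + 2 * mu : ℝ) : ℂ) with hL
  set B₀ : Plane → CVec := fun x => χ x • !₂[L * P x, mu * Q x] with hB₀
  set B₁ : Plane → CVec := fun x => χ x • !₂[-(mu * Q x), L * P x] with hB₁
  set A : Plane → CVec := fun x => pderiv 0 B₀ x + pderiv 1 B₁ x with hA
  have cP : ∀ x ∈ exterior Ω, ContDiffAt ℝ (⊤ : ℕ∞) P x := fun x hx =>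
    contDiffAt_potential (hw x hx) Mode.p
  have cQ : ∀ x ∈ exterior Ω, ContDiffAt ℝ (⊤ : ℕ∞) Q x := fun x hx =>
    contDiffAt_potential (hw x hx) Mode.s
  have cS₀ : ∀ x ∈ exterior Ω, ContDiffAt ℝ (⊤ : ℕ∞)
      (fun x => (!₂[L * P x, mu * Q x] : CVec)) x := by
    intro x hx
    refine contDiffAt_piLp' 2 fun i => ?_
    fin_cases i
    · exact contDiffAt_const.mul (cP x hx)
    · exact contDiffAt_const.mul (cQ x hx)
  have cS₁ : ∀ x ∈ exterior Ω, ContDiffAt ℝ (⊤ : ℕ∞)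
      (fun x => (!₂[-(mu * Q x), L * P x] : CVec)) x := by
    intro x hx
    refine contDiffAt_piLp' 2 fun i => ?_
    fin_cases i
    · exact (contDiffAt_const.mul (cQ x hx)).neg
    · exact contDiffAt_const.mul (cP x hx)
  have cB₀ : ∀ x ∈ exterior Ω, ContDiffAt ℝ (⊤ : ℕ∞) B₀ x := fun x hx =>
    hχ.contDiffAt.smul (cS₀ x hx)
  have cB₁ : ∀ x ∈ exterior Ω, ContDiffAt ℝ (⊤ : ℕ∞) B₁ x := fun x hx =>
    hχ.contDiffAt.smul (cS₁ x hx)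
  have cA : ∀ x ∈ exterior Ω, ContDiffAt ℝ (⊤ : ℕ∞) A x := fun x hx =>
    ((cB₀ x hx).pderiv 0).add ((cB₁ x hx).pderiv 1)
  have hAeq : ∀ x ∈ exterior Ω, A x = -((ω : ℂ) ^ 2 * χ x) • w x
      + !₂[L * P x * pderiv 0 χ x - mu * Q x * pderiv 1 χ x,
          mu * Q x * pderiv 0 χ x + L * P x * pderiv 1 χ x] := by
    intro x hx
    have hd := hχ.contDiffAt.differentiableAt_of_infty (x := x)
    have d₀ := (cS₀ x hx).differentiableAt_of_infty
    have d₁ := (cS₁ x hx).differentiableAt_of_infty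
    have dP := (cP x hx).differentiableAt_of_infty
    have dQ := (cQ x hx).differentiableAt_of_infty
    have e00 : (pderiv 0 (fun x => (!₂[L * P x, mu * Q x] : CVec)) x) 0 = L * pderiv 0 P x := by
      rw [← pderiv_apply d₀]; exact pderiv_const_mul _ dP 0
    have e01 : (pderiv 0 (fun x => (!₂[L * P x, mu * Q x] : CVec)) x) 1 = mu * pderiv 0 Q x := by
      rw [← pderiv_apply d₀]; exact pderiv_const_mul _ dQ 0
    have e10 : (pderiv 1 (fun x => (!₂[-(mu * Q x), L * P x] : CVec)) x) 0
        = -(mu * pderiv 1 Q x) := by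
      rw [← pderiv_apply d₁, ← pderiv_const_mul _ dQ 1]; exact pderiv_neg _ x 1
    have e11 : (pderiv 1 (fun x => (!₂[-(mu * Q x), L * P x] : CVec)) x) 1 = L * pderiv 1 P x := by
      rw [← pderiv_apply d₁]; exact pderiv_const_mul _ dP 1
    have hn := hnav x hx
    rw [lameOp_eq lam mu (isOpen_exterior Ω) hw hx] at hn
    have n0 := congrArg (fun z : CVec => z 0) hn
    have n1 := congrArg (fun z : CVec => z 1) hn
    simp only [PiLp.add_apply, PiLp.smul_apply, grad_apply_zero, grad_apply_one,
      gradPerp_apply_zero, gradPerp_apply_one, smul_eq_mul, PiLp.zero_apply] at n0 n1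
    simp only [hA, hB₀, hB₁]
    rw [pderiv_smul hd d₀, pderiv_smul hd d₁]
    ext j
    fin_cases j
    · simp only [Fin.zero_eta, PiLp.add_apply, PiLp.smul_apply, e00, e10,
        Matrix.cons_val_zero, smul_eq_mul, Complex.real_smul]
      linear_combination (χ x : ℂ) * n0
    · simp only [Fin.mk_one, PiLp.add_apply, PiLp.smul_apply, e01, e11,
        Matrix.cons_val_one, Matrix.cons_val_fin_one, smul_eq_mul, Complex.real_smul]
      linear_combination (χ x : ℂ) * n1
  obtain ⟨R₀, hR₀⟩ := hχc.isCompact.isBounded.exists_norm_le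
  set R := max (R₀ + 1) 1 with hR
  have hR1 : 0 < R := lt_of_lt_of_le one_pos (le_max_right _ _)
  have hsupp : ∀ x, x ∉ Metric.ball (0 : Plane) R → x ∉ tsupport χ := by
    intro x hx hmem
    have := hR₀ x hmem
    rw [mem_ball_zero_iff] at hx
    exact hx (lt_of_lt_of_le (by linarith) (le_max_left _ _))
  set D := Metric.ball (0 : Plane) R ∩ exterior Ω with hD
  have hDo : IsOpen D := Metric.isOpen_ball.inter (isOpen_exterior Ω)
  have hDm : MeasurableSet D := hDo.measurableSet
  obtain ⟨hwL, hdwL⟩ := hH1 R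
  -- square integrability of the coefficient fields
  have hmem : ∀ (f : Plane → CVec) (C : ℝ), (∀ x ∈ exterior Ω, ContDiffAt ℝ (⊤ : ℕ∞) f x) →
      (∀ x ∈ exterior Ω, ‖f x‖ ≤ C * (‖w x‖ + (‖pderiv 0 w x‖ + ‖pderiv 1 w x‖))) →
      MemLp f 2 (volume.restrict D) := by
    intro f C hf hb
    refine MemLp.of_le_mul (c := C) (hwL.norm.add ((hdwL 0).norm.add (hdwL 1).norm)) ?_ ?_
    · exact ContinuousOn.aestronglyMeasurable
        (fun x hx => (hf x hx.2).continuousAt.continuousWithinAt) hDm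
    · filter_upwards [ae_restrict_mem hDm] with x hx
      refine (hb x hx.2).trans (le_of_eq ?_)
      congr 1
      exact (Real.norm_of_nonneg (by positivity)).symm
  have hPb : ∀ x ∈ exterior Ω, ‖P x‖ ≤ ‖pderiv 0 w x‖ + ‖pderiv 1 w x‖ := by
    intro x hx
    have d := (hw x hx).differentiableAt_of_infty
    have : P x = (pderiv 0 w x) 0 + (pderiv 1 w x) 1 := by
      rw [← pderiv_apply d, ← pderiv_apply d]; rfl
    rw [this]
    exact (norm_add_le _ _).trans (add_le_add (CVec.norm_coord_le _ _) (CVec.norm_coord_le _ _))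
  have hQb : ∀ x ∈ exterior Ω, ‖Q x‖ ≤ ‖pderiv 0 w x‖ + ‖pderiv 1 w x‖ := by
    intro x hx
    have d := (hw x hx).differentiableAt_of_infty
    have : Q x = -(pderiv 1 w x) 0 + (pderiv 0 w x) 1 := by
      rw [← pderiv_apply d, ← pderiv_apply d]; rfl
    rw [this, add_comm (‖pderiv 0 w x‖)]
    refine (norm_add_le _ _).trans (add_le_add ?_ (CVec.norm_coord_le _ _))
    rw [norm_neg]
    exact CVec.norm_coord_le _ _
  obtain ⟨c₀, hc₀⟩ := hχ.continuous.bounded_above_of_compact_support hχc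
  obtain ⟨c₁, hc₁⟩ := (pderiv_continuous hχ 0).bounded_above_of_compact_support
    (hχc.fderiv_apply ℝ _)
  obtain ⟨c₂, hc₂⟩ := (pderiv_continuous hχ 1).bounded_above_of_compact_support
    (hχc.fderiv_apply ℝ _)
  have c₀0 : 0 ≤ c₀ := (norm_nonneg _).trans (hc₀ 0)
  have c₁0 : 0 ≤ c₁ := (norm_nonneg _).trans (hc₁ 0)
  have c₂0 : 0 ≤ c₂ := (norm_nonneg _).trans (hc₂ 0)
  have hSb : ∀ (p q : ℂ) (c : ℝ), ‖(c • !₂[L * p, mu * q] : CVec)‖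
      ≤ |c| * (‖L‖ * ‖p‖ + |mu| * ‖q‖) ∧ ‖(c • !₂[-(mu * q), L * p] : CVec)‖
      ≤ |c| * (‖L‖ * ‖p‖ + |mu| * ‖q‖) := by
    intro p q c
    constructor <;> rw [norm_smul, Real.norm_eq_abs] <;>
      refine mul_le_mul_of_nonneg_left ((CVec.norm_le_add _).trans ?_) (abs_nonneg c)
    · simp
    · simp [add_comm]
  have mB₀ : MemLp B₀ 2 (volume.restrict D) := by
    refine hmem B₀ (c₀ * (‖L‖ + |mu|)) cB₀ fun x hx => ((hSb _ _ _).1).trans ?_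
    have h1 := hPb x hx
    have h2 := hQb x hx
    have h3 : |χ x| ≤ c₀ := hc₀ x
    set T := ‖pderiv 0 w x‖ + ‖pderiv 1 w x‖
    calc |χ x| * (‖L‖ * ‖P x‖ + |mu| * ‖Q x‖) ≤ c₀ * (‖L‖ * T + |mu| * T) := by gcongr
      _ = c₀ * (‖L‖ + |mu|) * T := by ring
      _ ≤ _ := by gcongr; linarith [norm_nonneg (w x)]
  have mB₁ : MemLp B₁ 2 (volume.restrict D) := by
    refine hmem B₁ (c₀ * (‖L‖ + |mu|)) cB₁ fun x hx => ((hSb _ _ _).2).trans ?_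
    have h1 := hPb x hx
    have h2 := hQb x hx
    have h3 : |χ x| ≤ c₀ := hc₀ x
    set T := ‖pderiv 0 w x‖ + ‖pderiv 1 w x‖
    calc |χ x| * (‖L‖ * ‖P x‖ + |mu| * ‖Q x‖) ≤ c₀ * (‖L‖ * T + |mu| * T) := by gcongr
      _ = c₀ * (‖L‖ + |mu|) * T := by ring
      _ ≤ _ := by gcongr; linarith [norm_nonneg (w x)]
  have mA : MemLp A 2 (volume.restrict D) := by
    refine hmem A (ω ^ 2 * c₀ + 2 * (c₁ + c₂) * (‖L‖ + |mu|)) cA fun x hx => ?_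
    have h1 := hPb x hx
    have h2 := hQb x hx
    have h3 : |χ x| ≤ c₀ := hc₀ x
    have h4 : |pderiv 0 χ x| ≤ c₁ := hc₁ x
    have h5 : |pderiv 1 χ x| ≤ c₂ := hc₂ x
    set T := ‖pderiv 0 w x‖ + ‖pderiv 1 w x‖
    have hT : 0 ≤ T := by positivity
    rw [hAeq x hx]
    calc _ ≤ ω ^ 2 * |χ x| * ‖w x‖ + ((‖L‖ * ‖P x‖ * |pderiv 0 χ x| + |mu| * ‖Q x‖ * |pderiv 1 χ x|)
          + (|mu| * ‖Q x‖ * |pderiv 0 χ x| + ‖L‖ * ‖P x‖ * |pderiv 1 χ x|)) := by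
          refine (norm_add_le _ _).trans (add_le_add ?_ ((CVec.norm_le_add _).trans
            (add_le_add ((norm_sub_le _ _).trans ?_) ((norm_add_le _ _).trans ?_))))
          · rw [norm_smul, norm_neg, norm_mul, norm_pow]
            simp
          · simp
          · simp
      _ ≤ ω ^ 2 * c₀ * ‖w x‖ + ((‖L‖ * T * c₁ + |mu| * T * c₂)
          + (|mu| * T * c₁ + ‖L‖ * T * c₂)) := by gcongr
      _ = ω ^ 2 * c₀ * ‖w x‖ + (c₁ + c₂) * (‖L‖ + |mu|) * T := by ring
      _ ≤ _ := by
        have e1 : 0 ≤ ω ^ 2 * c₀ * T := by positivity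
        have e2 : 0 ≤ (c₁ + c₂) * (‖L‖ + |mu|) * T := by positivity
        have e3 : 0 ≤ (c₁ + c₂) * (‖L‖ + |mu|) * ‖w x‖ := by positivity
        nlinarith
  -- the weak form of Navier's equation, for test fields supported in the exterior
  have hB₀supp : tsupport B₀ ⊆ tsupport χ := tsupport_smul_subset_left _ _
  have hB₁supp : tsupport B₁ ⊆ tsupport χ := tsupport_smul_subset_left _ _
  have hweak : ∀ φ : Plane → CVec, ContDiff ℝ (⊤ : ℕ∞) φ → HasCompactSupport φ →
      tsupport φ ⊆ exterior Ω → ∫ x in D, (inner ℂ (φ x) (A x) + (inner ℂ (pderiv 0 φ x) (B₀ x)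
        + inner ℂ (pderiv 1 φ x) (B₁ x))) = 0 := by
    intro φ hφ hφc hφΩ
    obtain ⟨i0, z0⟩ := integral_inner_pderiv_add hφ hφc hφΩ cB₀ 0
    obtain ⟨i1, z1⟩ := integral_inner_pderiv_add hφ hφc hφΩ cB₁ 1
    rw [setIntegral_eq_integral_of_forall_compl_eq_zero]
    · calc _ = ∫ x, ((inner ℂ (φ x) (pderiv 0 B₀ x) + inner ℂ (pderiv 0 φ x) (B₀ x))
            + (inner ℂ (φ x) (pderiv 1 B₁ x) + inner ℂ (pderiv 1 φ x) (B₁ x))) := by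
            congr 1
            funext x
            simp only [hA, inner_add_right]
            ring
        _ = 0 := by rw [integral_add i0 i1, z0, z1, add_zero]
    · intro x hx
      by_cases hxΩ : x ∈ exterior Ω
      · have hxb := hsupp x (fun h => hx ⟨h, hxΩ⟩)
        simp only [hA, pderiv_eq_zero_of_notMem_tsupport (fun h => hxb (hB₀supp h)),
          pderiv_eq_zero_of_notMem_tsupport (fun h => hxb (hB₁supp h)),
          image_eq_zero_of_notMem_tsupport (fun h => hxb (hB₀supp h)),
          image_eq_zero_of_notMem_tsupport (fun h => hxb (hB₁supp h))]
        simp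
      · have hxφ : x ∉ tsupport φ := fun h => hxΩ (hφΩ h)
        rw [pderiv_eq_zero_of_notMem_tsupport hxφ, pderiv_eq_zero_of_notMem_tsupport hxφ,
          image_eq_zero_of_notMem_tsupport hxφ]
        simp
  have hzero : ∫ x in D, (inner ℂ (w x) (A x) + (inner ℂ (pderiv 0 w x) (B₀ x)
        + inner ℂ (pderiv 1 w x) (B₁ x))) = 0 := by
    refine integral_inner_eq_zero_of_approx mA mB₀ mB₁ hwL hdwL fun ε hε => ?_
    let b : ContDiffBump (0 : Plane) := ⟨R, R + 1, hR1, by linarith⟩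
    obtain ⟨φ, hφ, hφc, hφΩ, h0, h1⟩ := hvan b b.contDiff b.hasCompactSupport ε hε
    have hone : ∀ y ∈ Metric.ball (0 : Plane) R, b y • w y = w y := by
      intro y hy
      rw [b.one_of_mem_closedBall (Metric.ball_subset_closedBall hy), one_smul]
    have hmono : volume.restrict D ≤ volume.restrict (exterior Ω) :=
      Measure.restrict_mono Set.inter_subset_right le_rfl
    refine ⟨φ, hφ, hφc, ?_, fun i => ?_, hweak φ hφ hφc hφΩ⟩
    · refine (le_of_eq ?_).trans ((eLpNorm_mono_measure _ hmono).trans h0)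
      refine eLpNorm_congr_ae ?_
      filter_upwards [ae_restrict_mem hDm] with x hx
      rw [hone x hx.1]
    · refine (le_of_eq ?_).trans ((eLpNorm_mono_measure _ hmono).trans (h1 i))
      refine eLpNorm_congr_ae ?_
      filter_upwards [ae_restrict_mem hDm] with x hx
      rw [pderiv_congr_of_isOpen Metric.isOpen_ball hone hx.1]
  have hint := (integrable_inner_of_memLp hwL mA).add
    ((integrable_inner_of_memLp (hdwL 0) mB₀).add (integrable_inner_of_memLp (hdwL 1) mB₁))
  have him := integral_im hint
  rw [show (∫ x in D, ((fun x => inner ℂ (w x) (A x)) + ((fun x => inner ℂ (pderiv 0 w x) (B₀ x))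
    + fun x => inner ℂ (pderiv 1 w x) (B₁ x))) x) = 0 from hzero] at him
  rw [← setIntegral_eq_integral_of_forall_compl_eq_zero (s := D)]
  · refine Eq.trans (setIntegral_congr_fun hDm fun x hx => ?_) (him.trans (by simp))
    have d := (hw x hx.2).differentiableAt_of_infty
    have eP : P x = (pderiv 0 w x) 0 + (pderiv 1 w x) 1 := by
      rw [← pderiv_apply d, ← pderiv_apply d]; rfl
    have eQ : Q x = -(pderiv 1 w x) 0 + (pderiv 0 w x) 1 := by
      rw [← pderiv_apply d, ← pderiv_apply d]; rfl
    -- apart from the flux the integrand consists of real terms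
    have hreal : inner ℂ (w x) (A x) + (inner ℂ (pderiv 0 w x) (B₀ x)
        + inner ℂ (pderiv 1 w x) (B₁ x)) = fluxDensity lam mu χ w x
        + ((χ x * (-(ω ^ 2) * (Complex.normSq (w x 0) + Complex.normSq (w x 1))
          + (lam + 2 * mu) * Complex.normSq (P x) + mu * Complex.normSq (Q x)) : ℝ) : ℂ) := by
      rw [hAeq x hx.2]
      simp only [hB₀, hB₁, PiLp.inner_apply, Fin.sum_univ_two, fluxDensity, ← hP, ← hQ, ← hL]
      simp only [PiLp.add_apply, PiLp.smul_apply, Matrix.cons_val_zero,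
        Matrix.cons_val_one, RCLike.inner_apply, smul_eq_mul, Complex.real_smul,
        Complex.ofReal_mul, Complex.ofReal_add, Complex.ofReal_neg, Complex.ofReal_pow,
        Complex.normSq_eq_conj_mul_self]
      rw [eP, eQ, hL]
      simp only [map_add, map_neg, Complex.ofReal_add, Complex.ofReal_mul, Complex.ofReal_ofNat,
        RCLike.star_def]
      ring
    change (fluxDensity lam mu χ w x).im = (inner ℂ (w x) (A x) + (inner ℂ (pderiv 0 w x) (B₀ x)
        + inner ℂ (pderiv 1 w x) (B₁ x))).im
    rw [hreal, Complex.add_im, Complex.ofReal_im, add_zero]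
  · intro x hx
    have h0 : ∀ i, pderiv i χ x = 0 := by
      intro i
      by_cases hxΩ : x ∈ exterior Ω
      · exact pderiv_eq_zero_of_notMem_tsupport (hsupp x (fun h => hx ⟨h, hxΩ⟩)) i
      · exact hχΩ x hxΩ i
    simp [fluxDensity, h0]

/-! ### Radial cut-off functions -/

/-- `χ` is a smooth radial cut-off function, constant in the unit disc and zero outside the disc
of radius `2`, with gradient `-η(y) y`. -/
structure IsRadialCutoff (χ η : Plane → ℝ) : Prop where
  smooth : ContDiff ℝ (⊤ : ℕ∞) χ
  eq_zero : ∀ y, 2 < ‖y‖ → χ y = 0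
  pderiv_eq : ∀ j y, pderiv j χ y = -(η y * y j)
  continuous : Continuous η
  nonneg : ∀ y, 0 ≤ η y
  weight_eq_zero : ∀ y, ‖y‖ < 1 ∨ 2 < ‖y‖ → η y = 0

lemma exists_isRadialCutoff : ∃ (χ η : Plane → ℝ) (t : ℝ), IsRadialCutoff χ η ∧ 1 < t ∧ t < 2 ∧
    ∀ θ : Circle2, 0 < η (t • (θ : Plane)) := by
  set T := Real.smoothTransition with hT
  have hTc : ContDiff ℝ (⊤ : ℕ∞) T := Real.smoothTransition.contDiff
  have hTd : Differentiable ℝ T := hTc.differentiable (by simp)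
  set g : Plane → ℝ := fun y => (4 - ‖y‖ ^ 2) / 3 with hg
  have hgc : ContDiff ℝ (⊤ : ℕ∞) g := (contDiff_const.sub (contDiff_norm_sq ℝ)).div_const 3
  have hderiv_zero : ∀ s, s < 0 ∨ 1 < s → deriv T s = 0 := by
    rintro s (hs | hs)
    · have : T =ᶠ[nhds s] fun _ => 0 := by
        filter_upwards [Iio_mem_nhds hs] with r hr
        exact Real.smoothTransition.zero_of_nonpos (le_of_lt hr)
      rw [this.deriv_eq, deriv_const]
    · have : T =ᶠ[nhds s] fun _ => 1 := by
        filter_upwards [Ioi_mem_nhds hs] with r hr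
        exact Real.smoothTransition.one_of_one_le (le_of_lt hr)
      rw [this.deriv_eq, deriv_const]
  obtain ⟨c, hc, hcd⟩ := exists_deriv_eq_slope T one_pos hTc.continuous.continuousOn
    hTd.differentiableOn
  have hcd1 : deriv T c = 1 := by
    rw [hcd, hT, Real.smoothTransition.one, Real.smoothTransition.zero]
    norm_num
  have h43 : 0 < 4 - 3 * c := by linarith [hc.2]
  refine ⟨fun y => T (g y), fun y => 2 / 3 * deriv T (g y), Real.sqrt (4 - 3 * c),
    ⟨hTc.comp hgc, ?_, ?_, ?_, ?_, ?_⟩, ?_, ?_, ?_⟩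
  · intro y hy
    refine Real.smoothTransition.zero_of_nonpos ?_
    have : 4 ≤ ‖y‖ ^ 2 := by nlinarith
    simp only [hg]
    linarith
  · intro j y
    have h1 : HasFDerivAt (fun y : Plane => ‖y‖ ^ 2) ((2 : ℕ) • innerSL ℝ y : Plane →L[ℝ] ℝ) y :=
      (hasStrictFDerivAt_norm_sq y).hasFDerivAt
    have h2 : HasFDerivAt g
        ((1 / 3 : ℝ) • (-((2 : ℕ) • innerSL ℝ y)) : Plane →L[ℝ] ℝ) y := by
      have := (h1.const_sub 4).const_smul (1 / 3 : ℝ)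
      refine this.congr_of_eventuallyEq (Filter.Eventually.of_forall fun z => ?_)
      simp [hg]
      ring
    have h3 := ((hTd (g y)).hasDerivAt.comp_hasFDerivAt y h2).fderiv
    change fderiv ℝ (T ∘ g) y _ = _
    rw [h3]
    simp only [_root_.smul_apply, _root_.neg_apply, innerSL_apply_apply,
      smul_eq_mul, EuclideanSpace.inner_single_right, nsmul_eq_mul]
    simp
    ring
  · exact continuous_const.mul ((hTc.continuous_deriv (by simp)).comp hgc.continuous)
  · intro y
    exact mul_nonneg (by norm_num) (Real.smoothTransition.monotone.deriv_nonneg)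
  · intro y hy
    rw [hderiv_zero, mul_zero]
    rcases hy with hy | hy
    · right
      simp only [hg]
      nlinarith [norm_nonneg y]
    · left
      simp only [hg]
      nlinarith
  · exact Real.lt_sqrt_of_sq_lt (by linarith [hc.2])
  · rw [Real.sqrt_lt' two_pos]
    linarith [hc.1]
  · intro θ
    change 0 < 2 / 3 * deriv T (g _)
    have : g (Real.sqrt (4 - 3 * c) • (θ : Plane)) = c := by
      simp only [hg]
      rw [θ.norm_smul_of_nonneg (Real.sqrt_nonneg _), Real.sq_sqrt h43.le]
      ring
    rw [this, hcd1]
    norm_num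

namespace IsRadialCutoff

variable {χ η : Plane → ℝ}

lemma hasCompactSupport (h : IsRadialCutoff χ η) : HasCompactSupport χ := by
  refine HasCompactSupport.intro (isCompact_closedBall (0 : Plane) 2) fun y hy => h.eq_zero y ?_
  rw [mem_closedBall_zero_iff] at hy
  linarith

lemma pderiv_scaled (f : Plane → ℝ) (R : ℝ) (j : Fin 2) (x : Plane) :
    pderiv j (fun x => f (R⁻¹ • x)) x = R⁻¹ * pderiv j f (R⁻¹ • x) := by
  rw [pderiv, fderiv_comp_smul]
  rfl

lemma pderiv_scaled_eq (h : IsRadialCutoff χ η) (R : ℝ) (j : Fin 2) (x : Plane) :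
    pderiv j (fun x => χ (R⁻¹ • x)) x = -(η (R⁻¹ • x) / R ^ 2 * x j) := by
  rw [pderiv_scaled, h.pderiv_eq]
  simp only [PiLp.smul_apply, smul_eq_mul]
  ring

lemma pderiv_pderiv_scaled (h : IsRadialCutoff χ η) (R : ℝ) (i j : Fin 2) (x : Plane) :
    pderiv i (pderiv j (fun x => χ (R⁻¹ • x))) x
      = R⁻¹ ^ 2 * pderiv i (pderiv j χ) (R⁻¹ • x) := by
  have e : pderiv j (fun x => χ (R⁻¹ • x)) = fun x => R⁻¹ • pderiv j χ (R⁻¹ • x) :=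
    funext fun x => pderiv_scaled χ R j x
  have hd : DifferentiableAt ℝ (fun x : Plane => pderiv j χ (R⁻¹ • x)) x :=
    DifferentiableAt.comp (g := pderiv j χ) x
      (h.smooth.contDiffAt.pderiv j).differentiableAt_of_infty (by fun_prop)
  rw [e, pderiv, fderiv_fun_const_smul hd, _root_.smul_apply]
  change R⁻¹ • pderiv i (fun x => pderiv j χ (R⁻¹ • x)) x = _
  rw [pderiv_scaled, smul_eq_mul]
  ring

lemma weight_scaled_eq_zero (h : IsRadialCutoff χ η) {R : ℝ} (hR : 0 < R) {x : Plane}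
    (hx : ‖x‖ < R ∨ 2 * R < ‖x‖) : η (R⁻¹ • x) = 0 := by
  refine h.weight_eq_zero _ ?_
  rw [norm_smul, norm_inv, Real.norm_of_nonneg hR.le, inv_mul_eq_div, div_lt_one hR,
    lt_div_iff₀ hR]
  exact hx

end IsRadialCutoff

/-! ### The flux of an outgoing solution -/

section Annulus

variable {F : Type*} [NormedAddCommGroup F] {f : Plane → F} {ρ ρ' R : ℝ}

lemma contDiff_of_norm_lt_eq_zero [NormedSpace ℝ F] (hρ : ρ < ρ')
    (hf : ∀ x, ρ < ‖x‖ → ContDiffAt ℝ (⊤ : ℕ∞) f x)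
    (h0 : ∀ x, ‖x‖ < ρ' → f x = 0) : ContDiff ℝ (⊤ : ℕ∞) f := by
  rw [contDiff_iff_contDiffAt]
  intro x
  by_cases hx : ρ < ‖x‖
  · exact hf x hx
  · have hU : {y : Plane | ‖y‖ < ρ'} ∈ nhds x :=
      (isOpen_lt continuous_norm continuous_const).mem_nhds (by
        change ‖x‖ < ρ'
        linarith)
    exact (contDiffAt_const (c := (0 : F))).congr_of_eventuallyEq
      (Filter.eventuallyEq_of_mem hU h0)

lemma hasCompactSupport_of_lt_norm (h1 : ∀ x, R < ‖x‖ → f x = 0) : HasCompactSupport f := by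
  refine HasCompactSupport.intro (isCompact_closedBall (0 : Plane) R) fun y hy => h1 y ?_
  rw [mem_closedBall_zero_iff] at hy
  linarith

end Annulus

/-- `∇χ · ∇P̄`. -/
def gradDot (χ : Plane → ℝ) (P : Plane → ℂ) (x : Plane) : ℂ :=
  ((pderiv 0 χ x : ℝ) : ℂ) * star (pderiv 0 P x) + ((pderiv 1 χ x : ℝ) : ℂ) * star (pderiv 1 P x)

lemma contDiffAt_gradDot {χ : Plane → ℝ} {P : Plane → ℂ} {x : Plane}
    (hχ : ContDiff ℝ (⊤ : ℕ∞) χ) (hP : ContDiffAt ℝ (⊤ : ℕ∞) P x) :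
    ContDiffAt ℝ (⊤ : ℕ∞) (gradDot χ P) x := by
  have h1 : ∀ i, ContDiffAt ℝ (⊤ : ℕ∞) (fun x => ((pderiv i χ x : ℝ) : ℂ)) x := fun i =>
    Complex.ofRealCLM.contDiff.contDiffAt.comp x (hχ.contDiffAt.pderiv i)
  have h2 : ∀ i, ContDiffAt ℝ (⊤ : ℕ∞) (fun x => star (pderiv i P x)) x := fun i =>
    Complex.conjCLE.contDiff.contDiffAt.comp x (hP.pderiv i)
  exact ((h1 0).mul (h2 0)).add ((h1 1).mul (h2 1))

lemma pderiv_gradDot {χ : Plane → ℝ} {P : Plane → ℂ} {x : Plane}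
    (hχ : ContDiff ℝ (⊤ : ℕ∞) χ) (hP : ContDiffAt ℝ (⊤ : ℕ∞) P x) (i : Fin 2) :
    pderiv i (gradDot χ P) x =
      ((pderiv 0 χ x : ℝ) : ℂ) * star (pderiv i (pderiv 0 P) x)
        + ((pderiv i (pderiv 0 χ) x : ℝ) : ℂ) * star (pderiv 0 P x)
      + (((pderiv 1 χ x : ℝ) : ℂ) * star (pderiv i (pderiv 1 P) x)
        + ((pderiv i (pderiv 1 χ) x : ℝ) : ℂ) * star (pderiv 1 P x)) := by
  have h1 : ∀ i, DifferentiableAt ℝ (fun x => ((pderiv i χ x : ℝ) : ℂ)) x := fun i =>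
    (Complex.ofRealCLM.contDiff.contDiffAt.comp x
      (hχ.contDiffAt.pderiv i)).differentiableAt_of_infty
  have h2 : ∀ i, DifferentiableAt ℝ (fun x => star (pderiv i P x)) x := fun i =>
    (Complex.conjCLE.contDiff.contDiffAt.comp x (hP.pderiv i)).differentiableAt_of_infty
  have h3 : ∀ i, DifferentiableAt ℝ (pderiv i χ) x := fun i =>
    (hχ.contDiffAt.pderiv i).differentiableAt_of_infty
  change pderiv i (fun y => ((pderiv 0 χ y : ℝ) : ℂ) * star (pderiv 0 P y)
    + ((pderiv 1 χ y : ℝ) : ℂ) * star (pderiv 1 P y)) x = _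
  rw [pderiv_add ((h1 0).fun_mul (h2 0)) ((h1 1).fun_mul (h2 1)), pderiv_mul (h1 0) (h2 0),
    pderiv_mul (h1 1) (h2 1), pderiv_ofReal (h3 0), pderiv_ofReal (h3 1), pderiv_star, pderiv_star]

/-- Green's identity for the Helmholtz equation, tested with `∇χ · ∇P̄`. -/
lemma IsOutgoing.integral_green {k ρ : ℝ} {P : Plane → ℂ} {F : Circle2 → ℂ}
    (hP : IsOutgoing k ρ P F) {χ : Plane → ℝ} (hχ : ContDiff ℝ (⊤ : ℕ∞) χ) {ρ' R : ℝ}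
    (hρ : ρ < ρ') (h0 : ∀ x, ‖x‖ < ρ' → ∀ i, pderiv i χ x = 0)
    (h1 : ∀ x, R < ‖x‖ → ∀ i, pderiv i χ x = 0) :
    Integrable (fun x => P x * gradDot χ P x) ∧
    Integrable (fun x => pderiv 0 P x * pderiv 0 (gradDot χ P) x
      + pderiv 1 P x * pderiv 1 (gradDot χ P) x) ∧
    (k : ℂ) ^ 2 * ∫ x, P x * gradDot χ P x = ∫ x, (pderiv 0 P x * pderiv 0 (gradDot χ P) x
      + pderiv 1 P x * pderiv 1 (gradDot χ P) x) := by
  have hs0 : ∀ x, ‖x‖ < ρ' → gradDot χ P x = 0 := fun x hx => by simp [gradDot, h0 x hx]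
  have hs1 : ∀ x, R < ‖x‖ → gradDot χ P x = 0 := fun x hx => by simp [gradDot, h1 x hx]
  have hint : ∀ f : Plane → ℂ, (∀ x, ρ < ‖x‖ → ContDiffAt ℝ (⊤ : ℕ∞) f x) →
      ContDiff ℝ (⊤ : ℕ∞) (fun x => gradDot χ P x * f x) ∧
      HasCompactSupport (fun x => gradDot χ P x * f x) := fun f hf =>
    ⟨contDiff_of_norm_lt_eq_zero hρ (fun x hx => (contDiffAt_gradDot hχ (hP.smooth x hx)).mul
      (hf x hx)) (fun x hx => by rw [hs0 x hx, zero_mul]),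
      hasCompactSupport_of_lt_norm (R := R) fun x hx => by rw [hs1 x hx, zero_mul]⟩
  obtain ⟨cP, sP⟩ := hint P hP.smooth
  obtain ⟨c0, s0⟩ := hint (pderiv 0 P) fun x hx => (hP.smooth x hx).pderiv 0
  obtain ⟨c1, s1⟩ := hint (pderiv 1 P) fun x hx => (hP.smooth x hx).pderiv 1
  have iP := cP.continuous.integrable_of_hasCompactSupport (μ := volume) sP
  have i0 := (pderiv_continuous c0 0).integrable_of_hasCompactSupport (μ := volume)
    (s0.fderiv_apply ℝ _)
  have i1 := (pderiv_continuous c1 1).integrable_of_hasCompactSupport (μ := volume)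
    (s1.fderiv_apply ℝ _)
  have hpt : (fun x => pderiv 0 P x * pderiv 0 (gradDot χ P) x
      + pderiv 1 P x * pderiv 1 (gradDot χ P) x)
      = fun x => (pderiv 0 (fun x => gradDot χ P x * pderiv 0 P x) x
        + pderiv 1 (fun x => gradDot χ P x * pderiv 1 P x) x)
        + (k : ℂ) ^ 2 * (gradDot χ P x * P x) := by
    funext x
    by_cases hx : ρ < ‖x‖
    · have dP := hP.smooth x hx
      have dg := (contDiffAt_gradDot hχ dP).differentiableAt_of_infty
      rw [pderiv_mul dg (dP.pderiv 0).differentiableAt_of_infty,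
        pderiv_mul dg (dP.pderiv 1).differentiableAt_of_infty]
      linear_combination -(gradDot χ P x) * hP.helmholtz x hx
    · have hx' : ‖x‖ < ρ' := by linarith
      have hU : IsOpen {y : Plane | ‖y‖ < ρ'} := isOpen_lt continuous_norm continuous_const
      have z : ∀ (f : Plane → ℂ), (∀ y, ‖y‖ < ρ' → f y = 0) → ∀ i, pderiv i f x = 0 := by
        intro f hf i
        rw [pderiv_congr_of_isOpen hU (g := fun _ => 0) hf hx']
        simp [pderiv]
      rw [z _ hs0, z _ hs0,
        z (fun x => gradDot χ P x * pderiv 0 P x) (fun y hy => by rw [hs0 y hy, zero_mul]),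
        z (fun x => gradDot χ P x * pderiv 1 P x) (fun y hy => by rw [hs0 y hy, zero_mul]),
        hs0 x hx']
      simp
  have iP' : Integrable (fun x => P x * gradDot χ P x) := by
    simpa only [mul_comm] using iP
  refine ⟨iP', ?_, ?_⟩
  · rw [hpt]
    exact (i0.add i1).add (iP.const_mul _)
  · have z0 := integral_pderiv_eq_zero (c0.of_le (by exact_mod_cast le_top)) s0 0
    have z1 := integral_pderiv_eq_zero (c1.of_le (by exact_mod_cast le_top)) s1 1
    rw [hpt, integral_add (f := fun x => pderiv 0 (fun x => gradDot χ P x * pderiv 0 P x) x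
        + pderiv 1 (fun x => gradDot χ P x * pderiv 1 P x) x) (i0.add i1) (iP.const_mul _),
      integral_add i0 i1, z0, z1, integral_const_mul]
    simp only [zero_add, mul_comm]

/-- The energy radiated by `P` through the annulus `R ≤ |x| ≤ 2R`, up to a constant. -/
def outflow (η : Plane → ℝ) (R : ℝ) (P : Plane → ℂ) : ℝ :=
  ∫ x, η (R⁻¹ • x) / R ^ 2 * ‖x‖ * ‖grad P x‖ ^ 2

lemma outflow_nonneg {χ η : Plane → ℝ} (h : IsRadialCutoff χ η) (R : ℝ) (P : Plane → ℂ) :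
    0 ≤ outflow η R P :=
  integral_nonneg fun x => by
    have := h.nonneg (R⁻¹ • x)
    positivity

lemma CVec.sq_norm_eq (z : CVec) : ((‖z‖ ^ 2 : ℝ) : ℂ) = z 0 * star (z 0) + z 1 * star (z 1) := by
  rw [CVec.norm_sq]
  push_cast
  rw [RCLike.star_def, Complex.mul_conj', Complex.mul_conj']

namespace IsOutgoing

variable {k ρ : ℝ} {P : Plane → ℂ} {F : Circle2 → ℂ} {χ η : Plane → ℝ}

lemma integrable_outflow (hP : IsOutgoing k ρ P F) (hχ : IsRadialCutoff χ η) {R : ℝ} (hR : ρ < R) :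
    Integrable (fun x => η (R⁻¹ • x) / R ^ 2 * ‖x‖ * ‖grad P x‖ ^ 2) := by
  have hR0 : 0 < R := lt_of_le_of_lt hP.nonneg hR
  have hz : ∀ x : Plane, ‖x‖ < R ∨ 2 * R < ‖x‖ →
      η (R⁻¹ • x) / R ^ 2 * ‖x‖ * ‖grad P x‖ ^ 2 = 0 := fun x hx => by
    rw [hχ.weight_scaled_eq_zero hR0 hx]; simp
  refine Continuous.integrable_of_hasCompactSupport ?_
    (hasCompactSupport_of_lt_norm (R := 2 * R) fun x hx => hz x (Or.inr hx))
  rw [continuous_iff_continuousAt]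
  intro x
  by_cases hx : ρ < ‖x‖
  · have h1 : ContinuousAt (fun x : Plane => η (R⁻¹ • x)) x :=
      (hχ.continuous.comp (continuous_const_smul R⁻¹)).continuousAt
    exact ((h1.div_const _).mul continuous_norm.continuousAt).mul
      ((contDiffAt_grad (hP.smooth x hx)).continuousAt.norm.pow 2)
  · have hU : {y : Plane | ‖y‖ < R} ∈ nhds x :=
      (isOpen_lt continuous_norm continuous_const).mem_nhds (by
        change ‖x‖ < R
        linarith)
    exact (continuousAt_const (y := (0 : ℝ))).congr
      (Filter.eventuallyEq_of_mem hU fun y hy => (hz y (Or.inl hy)).symm)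

/-- The integrand of Green's identity is `i k` times the radiated energy density, up to the
second derivatives of the cut-off function and the defect in the radiation condition. -/
lemma norm_green_sub_le (hP : IsOutgoing k ρ P F) (hχ : IsRadialCutoff χ η) {R C G m δ : ℝ}
    (hR : 0 < R) (hC : ∀ i j y, ‖pderiv i (pderiv j χ) y‖ ≤ C) (hG : ∀ y, η y ≤ G)
    {θ : Circle2} {r : ℝ} (hr : 0 < r) (hrR : r ≤ 2 * R) (hρ : ρ < r)
    (hm : ‖grad P (r • (θ : Plane))‖ ≤ m)
    (hδ : ‖fderiv ℝ (grad P) (r • (θ : Plane)) (θ : Plane)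
      - (Complex.I * (k : ℂ)) • grad P (r • (θ : Plane))‖ ≤ δ) :
    ‖(pderiv 0 P (r • (θ : Plane)) * pderiv 0 (gradDot (fun x => χ (R⁻¹ • x)) P) (r • (θ : Plane))
      + pderiv 1 P (r • (θ : Plane))
        * pderiv 1 (gradDot (fun x => χ (R⁻¹ • x)) P) (r • (θ : Plane)))
      - Complex.I * k * ((η (R⁻¹ • r • (θ : Plane)) / R ^ 2 * ‖r • (θ : Plane)‖
        * ‖grad P (r • (θ : Plane))‖ ^ 2 : ℝ) : ℂ)‖
      ≤ 4 * (m ^ 2 * (C / R ^ 2)) + 4 * (G / R * (m * δ)) := by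
  have hx : ‖r • (θ : Plane)‖ = r := θ.norm_smul_of_nonneg hr.le
  have hs := hP.smooth (r • (θ : Plane)) (by rwa [hx])
  have hχs : ContDiff ℝ (⊤ : ℕ∞) (fun x : Plane => χ (R⁻¹ • x)) :=
    hχ.smooth.comp (g := χ) (f := fun x : Plane => R⁻¹ • x) (by fun_prop)
  set x := r • (θ : Plane) with hxdef
  set e := fderiv ℝ (grad P) x (θ : Plane) - (Complex.I * (k : ℂ)) • grad P x with he
  set w := η (R⁻¹ • x) / R ^ 2 with hw
  have hw0 : 0 ≤ w := div_nonneg (hχ.nonneg _) (by positivity)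
  have hwG : w ≤ G / R ^ 2 := by rw [hw]; gcongr; exact hG _
  have he' : ∀ j, e j = (θ : Plane) 0 * pderiv 0 (pderiv j P) x
      + (θ : Plane) 1 * pderiv 1 (pderiv j P) x - Complex.I * k * pderiv j P x := by
    intro j
    have h1 : e j = (fderiv ℝ (grad P) x (θ : Plane)) j - Complex.I * k * grad P x j := by
      rw [he]; rfl
    rw [h1, fderiv_grad_coord hs, fderiv_apply_eq_pderiv, Complex.real_smul, Complex.real_smul]
    fin_cases j <;> rfl
  have hsym := pderiv_comm hs 0 1
  have hcoord : ∀ j, x j = r * (θ : Plane) j := fun j => rfl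
  have key : (pderiv 0 P x * pderiv 0 (gradDot (fun x => χ (R⁻¹ • x)) P) x
      + pderiv 1 P x * pderiv 1 (gradDot (fun x => χ (R⁻¹ • x)) P) x)
      - Complex.I * k * ((w * ‖x‖ * ‖grad P x‖ ^ 2 : ℝ) : ℂ)
      = (pderiv 0 P x * star (pderiv 0 P x)
            * ((R⁻¹ ^ 2 * pderiv 0 (pderiv 0 χ) (R⁻¹ • x) : ℝ) : ℂ)
          + pderiv 0 P x * star (pderiv 1 P x)
            * ((R⁻¹ ^ 2 * pderiv 0 (pderiv 1 χ) (R⁻¹ • x) : ℝ) : ℂ)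
          + (pderiv 1 P x * star (pderiv 0 P x)
            * ((R⁻¹ ^ 2 * pderiv 1 (pderiv 0 χ) (R⁻¹ • x) : ℝ) : ℂ)
          + pderiv 1 P x * star (pderiv 1 P x)
            * ((R⁻¹ ^ 2 * pderiv 1 (pderiv 1 χ) (R⁻¹ • x) : ℝ) : ℂ)))
        - ((w * r : ℝ) : ℂ) * (pderiv 0 P x * star (e 0) + pderiv 1 P x * star (e 1)) := by
    rw [pderiv_gradDot hχs hs, pderiv_gradDot hχs hs, Complex.ofReal_mul (w * ‖x‖),
      CVec.sq_norm_eq, hx, he', he']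
    simp only [hχ.pderiv_scaled_eq, hχ.pderiv_pderiv_scaled, ← hw, hcoord, grad_apply_zero,
      grad_apply_one, RCLike.star_def, map_sub, map_add, map_mul, Complex.conj_ofReal,
      Complex.conj_I, Complex.ofReal_mul, Complex.ofReal_neg]
    rw [hsym]
    ring
  have p0 : ‖pderiv 0 P x‖ ≤ m := (CVec.norm_coord_le (grad P x) 0).trans hm
  have p1 : ‖pderiv 1 P x‖ ≤ m := (CVec.norm_coord_le (grad P x) 1).trans hm
  have e0 : ‖e 0‖ ≤ δ := (CVec.norm_coord_le e 0).trans hδ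
  have e1 : ‖e 1‖ ≤ δ := (CVec.norm_coord_le e 1).trans hδ
  have hm0 : 0 ≤ m := (norm_nonneg _).trans hm
  have hδ0 : 0 ≤ δ := (norm_nonneg _).trans hδ
  have hC0 : 0 ≤ C := (norm_nonneg _).trans (hC 0 0 0)
  have hG0 : 0 ≤ G := (hχ.nonneg 0).trans (hG 0)
  have hterm : ∀ (a b : ℂ) (i j : Fin 2), ‖a‖ ≤ m → ‖b‖ ≤ m →
      ‖a * star b * ((R⁻¹ ^ 2 * pderiv i (pderiv j χ) (R⁻¹ • x) : ℝ) : ℂ)‖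
        ≤ m ^ 2 * (C / R ^ 2) := by
    intro a b i j ha hb
    rw [norm_mul, norm_mul, norm_star, Complex.norm_real, norm_mul, norm_pow, norm_inv,
      Real.norm_of_nonneg hR.le]
    calc ‖a‖ * ‖b‖ * (R⁻¹ ^ 2 * ‖pderiv i (pderiv j χ) (R⁻¹ • x)‖) ≤ m * m * (R⁻¹ ^ 2 * C) := by
          gcongr
          exact hC i j _
      _ = _ := by field_simp
  rw [key]
  calc _ ≤ (m ^ 2 * (C / R ^ 2) + m ^ 2 * (C / R ^ 2)
          + (m ^ 2 * (C / R ^ 2) + m ^ 2 * (C / R ^ 2)))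
        + G / R ^ 2 * (2 * R) * (m * δ + m * δ) := by
        refine (norm_sub_le _ _).trans (add_le_add ?_ ?_)
        · exact (norm_add_le _ _).trans (add_le_add
            ((norm_add_le _ _).trans (add_le_add (hterm _ _ 0 0 p0 p0) (hterm _ _ 0 1 p0 p1)))
            ((norm_add_le _ _).trans (add_le_add (hterm _ _ 1 0 p1 p0) (hterm _ _ 1 1 p1 p1))))
        · rw [norm_mul, Complex.norm_real, Real.norm_of_nonneg (by positivity)]
          refine mul_le_mul (mul_le_mul hwG hrR hr.le (by positivity)) ?_ (norm_nonneg _)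
            (by positivity)
          refine (norm_add_le _ _).trans (add_le_add ?_ ?_) <;> rw [norm_mul, norm_star] <;> gcongr
    _ = _ := by field_simp; ring

/-- The flux of an outgoing solution through large circles is, on average, the radiated energy. -/
lemma abs_flux_sub_outflow_le (hP : IsOutgoing k ρ P F) (hχ : IsRadialCutoff χ η)
    {ε : ℝ} (hε : 0 < ε) : ∃ R₀ : ℝ, ∀ R : ℝ, R₀ ≤ R →
      |k ^ 2 * (∫ x, (P x * gradDot (fun x => χ (R⁻¹ • x)) P x).im) - k * outflow η R P| ≤ ε := by
  obtain ⟨M, R₁, hM, hR₁, hR₁ρ, -, hgrad⟩ := hP.exists_bound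
  have hη : HasCompactSupport η := hasCompactSupport_of_lt_norm (R := 2) fun y hy =>
    hχ.weight_eq_zero y (Or.inr hy)
  obtain ⟨G, hG⟩ := hχ.continuous.bounded_above_of_compact_support hη
  have hGle : ∀ y, η y ≤ G := fun y => (le_abs_self _).trans (hG y)
  have hG0 : 0 ≤ G := (norm_nonneg _).trans (hG 0)
  have hC : ∃ C : ℝ, ∀ i j y, ‖pderiv i (pderiv j χ) y‖ ≤ C := by
    have h1 : ∀ i j, ∃ C : ℝ, ∀ y, ‖pderiv i (pderiv j χ) y‖ ≤ C := fun i j => by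
      have hj : ContDiff ℝ (⊤ : ℕ∞) (pderiv j χ) :=
        contDiff_iff_contDiffAt.2 fun y => hχ.smooth.contDiffAt.pderiv j
      exact (pderiv_continuous hj i).bounded_above_of_compact_support
        ((hχ.hasCompactSupport.fderiv_apply ℝ _).fderiv_apply ℝ _)
    choose c hc using h1
    refine ⟨∑ i, ∑ j, |c i j|, fun i j y => (hc i j y).trans ((le_abs_self _).trans ?_)⟩
    exact (Finset.single_le_sum (f := fun j => |c i j|) (fun _ _ => abs_nonneg _)
      (Finset.mem_univ j)).trans (Finset.single_le_sum (f := fun i => ∑ j, |c i j|)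
        (fun _ _ => Finset.sum_nonneg fun _ _ => abs_nonneg _) (Finset.mem_univ i))
  obtain ⟨C, hC⟩ := hC
  have hC0 : 0 ≤ C := (norm_nonneg _).trans (hC 0 0 0)
  set V := (volume : Measure Plane).real (Metric.ball 0 1) with hV
  have hV0 : 0 ≤ V := measureReal_nonneg
  set δ := ε / (32 * (V * G * M + 1)) with hδ
  have hδ0 : 0 < δ := by positivity
  obtain ⟨R₂, hR₂, hrad⟩ := hP.radiating δ hδ0
  refine ⟨max (max R₁ R₂) (32 * V * M ^ 2 * C / ε), fun R hR => ?_⟩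
  obtain ⟨hR12, hR3⟩ := max_le_iff.1 hR
  obtain ⟨hR1, hR2⟩ := max_le_iff.1 hR12
  have hR0 : 0 < R := by linarith
  have hρR : ρ < R := by linarith
  have hsR : 0 < Real.sqrt R := Real.sqrt_pos.2 hR0
  have hχs : ContDiff ℝ (⊤ : ℕ∞) (fun x : Plane => χ (R⁻¹ • x)) :=
    hχ.smooth.comp (g := χ) (f := fun x : Plane => R⁻¹ • x) (by fun_prop)
  have hz : ∀ x : Plane, ‖x‖ < R ∨ 2 * R < ‖x‖ → ∀ i, pderiv i (fun x => χ (R⁻¹ • x)) x = 0 :=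
    fun x hx i => by
      rw [hχ.pderiv_scaled_eq, hχ.weight_scaled_eq_zero hR0 hx]; simp
  obtain ⟨i1, i2, hgreen⟩ := hP.integral_green hχs hρR (fun x hx => hz x (Or.inl hx))
    (fun x hx => hz x (Or.inr hx))
  have i3 := hP.integrable_outflow hχ hρR
  set f : Plane → ℂ := fun x => pderiv 0 P x * pderiv 0 (gradDot (fun x => χ (R⁻¹ • x)) P) x
      + pderiv 1 P x * pderiv 1 (gradDot (fun x => χ (R⁻¹ • x)) P) x with hf
  set h : Plane → ℝ := fun x => η (R⁻¹ • x) / R ^ 2 * ‖x‖ * ‖grad P x‖ ^ 2 with hh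
  set m := M / Real.sqrt R with hm
  set B := 4 * (m ^ 2 * (C / R ^ 2)) + 4 * (G / R * (m * (δ / Real.sqrt R))) with hB
  have hpt : ∀ x ∈ Metric.closedBall (0 : Plane) (2 * R),
      ‖f x - Complex.I * k * ((h x : ℝ) : ℂ)‖ ≤ B := by
    intro x hx
    rw [mem_closedBall_zero_iff] at hx
    by_cases hxR : ‖x‖ < R
    · have hU : IsOpen {y : Plane | ‖y‖ < R} := isOpen_lt continuous_norm continuous_const
      have h0 : ∀ i, pderiv i (gradDot (fun x => χ (R⁻¹ • x)) P) x = 0 := by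
        intro i
        rw [pderiv_congr_of_isOpen hU (g := fun _ => 0)
          (fun y hy => by simp [gradDot, hz y (Or.inl hy)]) hxR]
        simp [pderiv]
      simp only [hf, hh]
      rw [h0, h0, hχ.weight_scaled_eq_zero hR0 (Or.inl hxR)]
      simp only [mul_zero, zero_div, zero_mul, add_zero, Complex.ofReal_zero, sub_zero, norm_zero]
      positivity
    · push Not at hxR
      have hx0 : 0 < ‖x‖ := hR0.trans_le hxR
      obtain ⟨θ, hθ⟩ := exists_circle_smul (norm_pos_iff.1 hx0)
      have hmono : Real.sqrt R ≤ Real.sqrt ‖x‖ := Real.sqrt_le_sqrt hxR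
      have := hP.norm_green_sub_le hχ (m := m) (δ := δ / Real.sqrt R) hR0 hC hGle (θ := θ) hx0 hx
        (by linarith)
        ((hgrad ‖x‖ (by linarith) θ).trans (by rw [hm]; gcongr))
        ((hrad ‖x‖ (by linarith) θ).trans (by gcongr))
      rwa [← hθ] at this
  have hout : ∀ x, x ∉ Metric.closedBall (0 : Plane) (2 * R) →
      f x - Complex.I * k * ((h x : ℝ) : ℂ) = 0 := by
    intro x hx
    rw [mem_closedBall_zero_iff] at hx
    push Not at hx
    have hU : IsOpen {y : Plane | 2 * R < ‖y‖} := isOpen_lt continuous_const continuous_norm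
    have h0 : ∀ i, pderiv i (gradDot (fun x => χ (R⁻¹ • x)) P) x = 0 := by
      intro i
      rw [pderiv_congr_of_isOpen hU (g := fun _ => 0)
        (fun y hy => by simp [gradDot, hz y (Or.inr hy)]) hx]
      simp [pderiv]
    simp only [hf, hh]
    rw [h0, h0, hχ.weight_scaled_eq_zero hR0 (Or.inr hx)]
    simp
  have hnorm : ‖∫ x, (f x - Complex.I * k * ((h x : ℝ) : ℂ))‖ ≤ ε := by
    rw [← setIntegral_eq_integral_of_forall_compl_eq_zero hout]
    refine (norm_setIntegral_le_of_norm_le_const measure_closedBall_lt_top hpt).trans ?_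
    rw [Measure.addHaar_real_closedBall _ _ (by positivity), finrank_euclideanSpace_fin, ← hV]
    have hsq : Real.sqrt R ^ 2 = R := Real.sq_sqrt hR0.le
    have e1 : B * ((2 * R) ^ 2 * V) = 16 * V * M ^ 2 * C / R + 16 * (V * G * M) * δ := by
      have hm2 : m ^ 2 = M ^ 2 / R := by rw [hm, div_pow, hsq]
      have hmd : m * (δ / Real.sqrt R) = M * δ / R := by
        rw [hm, div_mul_div_comm, ← pow_two, hsq]
      rw [hB, hm2, hmd]
      field_simp
      ring
    rw [e1]
    have e2 : 16 * V * M ^ 2 * C / R ≤ ε / 2 := by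
      rw [div_le_iff₀ hR0]
      rw [div_le_iff₀ hε] at hR3
      linarith
    have e3 : 16 * (V * G * M) * δ ≤ ε / 2 := by
      have : 16 * (V * G * M) * δ = ε / 2 * (V * G * M / (V * G * M + 1)) := by
        rw [hδ]; field_simp; ring
      rw [this]
      have h1 : V * G * M / (V * G * M + 1) ≤ 1 := (div_le_one (by positivity)).2 (by linarith)
      nlinarith
    linarith
  have hsplit : ∫ x, (f x - Complex.I * k * ((h x : ℝ) : ℂ))
      = (k : ℂ) ^ 2 * (∫ x, P x * gradDot (fun x => χ (R⁻¹ • x)) P x)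
        - Complex.I * k * ((outflow η R P : ℝ) : ℂ) := by
    have i4 : Integrable (fun x => Complex.I * k * ((h x : ℝ) : ℂ)) := i3.ofReal.const_mul _
    rw [integral_sub i2 i4, hgreen, integral_const_mul, integral_complex_ofReal]
    rfl
  rw [hsplit] at hnorm
  refine le_trans (le_of_eq ?_) ((Complex.abs_im_le_norm _).trans hnorm)
  have him : (∫ x, (P x * gradDot (fun x => χ (R⁻¹ • x)) P x).im)
      = (∫ x, P x * gradDot (fun x => χ (R⁻¹ • x)) P x).im := integral_im i1
  rw [him, Complex.sub_im]
  congr 1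
  congr 1
  · rw [← Complex.ofReal_pow, Complex.im_ofReal_mul]
  · simp
/-- An outgoing solution with a nonzero pattern radiates energy: the pattern is continuous, hence
bounded below on a sector. -/
lemma exists_le_outflow (hP : IsOutgoing k ρ P F) (hk : 0 < k) (hχ : IsRadialCutoff χ η) {t : ℝ}
    (ht : 1 < t) {θ₀ : Circle2} (hη : 0 < η (t • (θ₀ : Plane))) (hF : F θ₀ ≠ 0) :
    ∃ c R₀ : ℝ, 0 < c ∧ ∀ R : ℝ, R₀ ≤ R → c ≤ outflow η R P := by
  obtain ⟨C, R₁, hC, hR₁, hlip⟩ := hP.exists_pattern_bound hk zero_le_one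
  obtain ⟨C', R₂, hC', hR₂, -, hR₂ρ, hfar⟩ := hP.exists_farField_bound 0
  set y₀ : Plane := t • (θ₀ : Plane) with hy₀
  set c := ‖F θ₀‖ / 2 with hc
  have hc0 : 0 < c := half_pos (norm_pos_iff.2 hF)
  have hy₀n : ‖y₀‖ = t := θ₀.norm_smul_of_nonneg (by linarith)
  set σ := min (1 / R₁) (c / (C + 1)) with hσ
  have hσ0 : 0 < σ := by positivity
  have hσR : R₁ ≤ 1 / σ := by
    rw [le_div_iff₀ hσ0]
    calc R₁ * σ ≤ R₁ * (1 / R₁) := by gcongr; exact min_le_left _ _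
      _ = 1 := by field_simp
  have hσC : C * σ ≤ c := by
    calc C * σ ≤ (C + 1) * (c / (C + 1)) := by
          gcongr
          · linarith
          · exact min_le_right _ _
      _ = c := by field_simp
  have hnhds : ∀ᶠ y in nhds y₀, η y₀ / 2 < η y ∧ 1 < ‖y‖ ∧ ‖‖y‖⁻¹ • y - (θ₀ : Plane)‖ < σ := by
    have h1 : ContinuousAt η y₀ := hχ.continuous.continuousAt
    have h2 : ContinuousAt (fun y : Plane => ‖y‖) y₀ := continuous_norm.continuousAt
    have h3 : ContinuousAt (fun y : Plane => ‖‖y‖⁻¹ • y - (θ₀ : Plane)‖) y₀ :=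
      (((h2.inv₀ (by rw [hy₀n]; linarith)).smul continuousAt_id).sub continuousAt_const).norm
    have h4 : ‖‖y₀‖⁻¹ • y₀ - (θ₀ : Plane)‖ = 0 := by
      rw [hy₀n, hy₀, smul_smul, inv_mul_cancel₀ (by linarith), one_smul, sub_self, norm_zero]
    refine (h1.eventually_const_lt (half_lt_self hη)).and
      ((h2.eventually_const_lt (by simpa [hy₀n] using ht)).and (h3.eventually_lt_const ?_))
    exact h4.trans_lt hσ0
  obtain ⟨s, hs, hball⟩ := Metric.nhds_basis_closedBall.eventually_iff.1 hnhds
  set V := (volume : Measure Plane).real (Metric.ball 0 1) with hV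
  have hV0 : 0 < V :=
    ENNReal.toReal_pos (Metric.measure_ball_pos _ _ one_pos).ne' measure_ball_lt_top.ne
  refine ⟨η y₀ / 2 * (c / 2) ^ 2 * (s ^ 2 * V), max R₂ (2 * C' / c), by positivity,
    fun R hR => ?_⟩
  obtain ⟨hRR, hRC⟩ := max_le_iff.1 hR
  have hR0 : 0 < R := by linarith
  have hint := hP.integrable_outflow hχ (lt_of_lt_of_le hR₂ρ hRR)
  have hnn : ∀ x : Plane, 0 ≤ η (R⁻¹ • x) / R ^ 2 * ‖x‖ * ‖grad P x‖ ^ 2 := fun x => by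
    have := hχ.nonneg (R⁻¹ • x)
    positivity
  have hlow : ∀ x ∈ Metric.closedBall (R • y₀) (R * s), η y₀ / 2 / R ^ 2 * (c / 2) ^ 2
      ≤ η (R⁻¹ • x) / R ^ 2 * ‖x‖ * ‖grad P x‖ ^ 2 := by
    intro x hx
    have hxy : R⁻¹ • x ∈ Metric.closedBall y₀ s := by
      rw [mem_closedBall_iff_norm] at hx ⊢
      have : R⁻¹ • x - y₀ = R⁻¹ • (x - R • y₀) := by
        rw [smul_sub, smul_smul, inv_mul_cancel₀ hR0.ne', one_smul]
      rw [this, norm_smul, norm_inv, Real.norm_of_nonneg hR0.le, inv_mul_le_iff₀ hR0]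
      exact hx
    obtain ⟨b1, b2, b3⟩ := hball hxy
    have hnorm : ‖R⁻¹ • x‖ = R⁻¹ * ‖x‖ := by
      rw [norm_smul, norm_inv, Real.norm_of_nonneg hR0.le]
    have hxR : R < ‖x‖ := by
      rw [hnorm, inv_mul_eq_div, lt_div_iff₀ hR0, one_mul] at b2
      exact b2
    have hx0 : 0 < ‖x‖ := hR0.trans hxR
    obtain ⟨θ, hθ⟩ := exists_circle_smul (norm_pos_iff.1 hx0)
    have hdir : ‖R⁻¹ • x‖⁻¹ • R⁻¹ • x = (θ : Plane) := by
      rw [hnorm, mul_inv, inv_inv, smul_smul]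
      conv_lhs => rw [hθ]
      rw [smul_smul, θ.norm_smul_of_nonneg hx0.le]
      convert one_smul ℝ (θ : Plane) using 2
      field_simp
    rw [hdir] at b3
    have hFθ : c ≤ ‖F θ‖ := by
      have h1 := hlip (1 / σ) hσR θ θ₀ (by rw [one_div_one_div]; exact b3.le)
      rw [div_div_eq_mul_div, div_one] at h1
      have h2 := norm_sub_norm_le (F θ₀) (F θ)
      rw [norm_sub_rev] at h2
      linarith
    have hsq : 0 < Real.sqrt ‖x‖ := Real.sqrt_pos.2 hx0
    have hg : c / 2 / Real.sqrt ‖x‖ ≤ ‖grad P x‖ := by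
      have h1 := hfar ‖x‖ (hRR.trans hxR.le) θ
      rw [← hθ] at h1
      have h2 : ‖(Complex.exp (Complex.I * ((k * ‖x‖ : ℝ) : ℂ)) / (Real.sqrt ‖x‖ : ℂ) * F θ) •
          toCVec (θ : Plane)‖ = ‖F θ‖ / Real.sqrt ‖x‖ := by
        rw [norm_smul, norm_toCVec, θ.norm_eq, norm_mul, norm_div,
          Complex.norm_exp_I_mul_ofReal', Complex.norm_real, Real.norm_of_nonneg hsq.le]
        ring
      have h3 := norm_sub_norm_le ((Complex.exp (Complex.I * ((k * ‖x‖ : ℝ) : ℂ))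
        / (Real.sqrt ‖x‖ : ℂ) * F θ) • toCVec (θ : Plane)) (grad P x)
      rw [norm_sub_rev, h2] at h3
      have h4 : C' / (‖x‖ * Real.sqrt ‖x‖) ≤ c / 2 / Real.sqrt ‖x‖ := by
        rw [← div_div]
        refine div_le_div_of_nonneg_right ?_ hsq.le
        rw [div_le_iff₀ hx0]
        rw [div_le_iff₀ hc0] at hRC
        nlinarith
      have h5 : c / Real.sqrt ‖x‖ ≤ ‖F θ‖ / Real.sqrt ‖x‖ := by gcongr
      have h6 : c / Real.sqrt ‖x‖ = c / 2 / Real.sqrt ‖x‖ + c / 2 / Real.sqrt ‖x‖ := by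
        field_simp; ring
      linarith
    calc η y₀ / 2 / R ^ 2 * (c / 2) ^ 2
        = η y₀ / 2 / R ^ 2 * ‖x‖ * (c / 2 / Real.sqrt ‖x‖) ^ 2 := by
          rw [div_pow (c / 2), Real.sq_sqrt hx0.le]
          field_simp
      _ ≤ _ := by
        have := hχ.nonneg (R⁻¹ • x)
        gcongr
  calc η y₀ / 2 * (c / 2) ^ 2 * (s ^ 2 * V)
      = ∫ _x in Metric.closedBall (R • y₀) (R * s), η y₀ / 2 / R ^ 2 * (c / 2) ^ 2 := by
        rw [setIntegral_const, Measure.addHaar_real_closedBall _ _ (by positivity),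
          finrank_euclideanSpace_fin, ← hV, smul_eq_mul]
        field_simp
    _ ≤ ∫ x in Metric.closedBall (R • y₀) (R * s),
        η (R⁻¹ • x) / R ^ 2 * ‖x‖ * ‖grad P x‖ ^ 2 :=
        setIntegral_mono_on (integrableOn_const measure_closedBall_lt_top.ne) hint.integrableOn
          measurableSet_closedBall hlow
    _ ≤ _ := setIntegral_le_integral hint (Filter.Eventually.of_forall hnn)

end IsOutgoing

/-! ### Fields that vanish on the boundary radiate nothing -/

/-- The energy flux of a solution of Navier's equation splits into the fluxes of its two potentials:
the mixed terms form, up to a real function, a divergence. -/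
lemma flux_potential_add_eq_zero {lam mu ω kp ks ρ : ℝ} {Ω : Set Plane} {w : Plane → CVec}
    {F G : Circle2 → ℂ}
    (hw : ∀ x ∈ exterior Ω, ContDiffAt ℝ (⊤ : ℕ∞) w x)
    (hnav : ∀ x ∈ exterior Ω, lameOp lam mu w x + ((ω : ℂ) ^ 2) • w x = 0)
    (hH1 : IsH1Loc Ω w) (hvan : VanishesOnBoundary Ω w)
    (hρΩ : ∀ x : Plane, ρ < ‖x‖ → x ∈ exterior Ω)
    (hP : IsOutgoing kp ρ (potential Mode.p w) F) (hQ : IsOutgoing ks ρ (potential Mode.s w) G)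
    {χ : Plane → ℝ} (hχ : ContDiff ℝ (⊤ : ℕ∞) χ) (hχc : HasCompactSupport χ) {R₁ R₂ : ℝ}
    (hρ : ρ < R₁) (h0 : ∀ x, ‖x‖ < R₁ → ∀ i, pderiv i χ x = 0)
    (h1 : ∀ x, R₂ < ‖x‖ → ∀ i, pderiv i χ x = 0) :
    (lam + 2 * mu) ^ 2 * (∫ x, (potential Mode.p w x * gradDot χ (potential Mode.p w) x).im)
      + mu ^ 2 * (∫ x, (potential Mode.s w x * gradDot χ (potential Mode.s w) x).im) = 0 := by
  have hflux := integral_fluxDensity_im hw hnav hH1 hvan hχ hχc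
    (fun x hx => h0 x ((not_lt.1 fun h => hx (hρΩ x h)).trans_lt hρ))
  set P := potential Mode.p w with hPdef
  set Q := potential Mode.s w with hQdef
  obtain ⟨iP, -, -⟩ := hP.integral_green hχ hρ h0 h1
  obtain ⟨iQ, -, -⟩ := hQ.integral_green hχ hρ h0 h1
  set Y : Fin 2 → Plane → ℂ := fun i x => ((pderiv i χ x : ℝ) : ℂ) * (P x * star (Q x)) with hY
  have cχ : ∀ i x, ContDiffAt ℝ (⊤ : ℕ∞) (fun x => ((pderiv i χ x : ℝ) : ℂ)) x := fun i x =>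
    Complex.ofRealCLM.contDiff.contDiffAt.comp x (hχ.contDiffAt.pderiv i)
  have cQ' : ∀ x, ρ < ‖x‖ → ContDiffAt ℝ (⊤ : ℕ∞) (fun x => star (Q x)) x := fun x hx =>
    Complex.conjCLE.contDiff.contDiffAt.comp x (hQ.smooth x hx)
  have Y0 : ∀ i x, ‖x‖ < R₁ → Y i x = 0 := fun i x hx => by simp [hY, h0 x hx]
  have cY : ∀ i, ContDiff ℝ (⊤ : ℕ∞) (Y i) := fun i =>
    contDiff_of_norm_lt_eq_zero hρ
      (fun x hx => (cχ i x).mul ((hP.smooth x hx).mul (cQ' x hx))) (Y0 i)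
  have sY : ∀ i, HasCompactSupport (Y i) := fun i =>
    hasCompactSupport_of_lt_norm (R := R₂) fun x hx => by simp [hY, h1 x hx]
  set Z : Plane → ℂ := fun x => pderiv 0 (Y 1) x - pderiv 1 (Y 0) x with hZ
  have iY : ∀ i j, Integrable (pderiv i (Y j)) := fun i j =>
    (pderiv_continuous (cY j) i).integrable_of_hasCompactSupport ((sY j).fderiv_apply ℝ _)
  have iZ : Integrable Z := (iY 0 1).sub (iY 1 0)
  have zZ : ∫ x, (Z x).im = 0 := by
    have e : ∫ x, Z x = 0 := by
      rw [integral_sub (iY 0 1) (iY 1 0),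
        integral_pderiv_eq_zero ((cY 1).of_le (by exact_mod_cast le_top)) (sY 1),
        integral_pderiv_eq_zero ((cY 0).of_le (by exact_mod_cast le_top)) (sY 0), sub_zero]
    have := integral_im iZ
    rw [e] at this
    exact this.trans (by simp)
  have hpt : ∀ x, ω ^ 2 * (fluxDensity lam mu χ w x).im
      = -((lam + 2 * mu) ^ 2 * (P x * gradDot χ P x).im + mu ^ 2 * (Q x * gradDot χ Q x).im
        + (lam + 2 * mu) * mu * (Z x).im) := by
    intro x
    by_cases hx : ρ < ‖x‖
    · set A : ℂ := Q x * (((pderiv 0 χ x : ℝ) : ℂ) * star (pderiv 1 P x)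
        - ((pderiv 1 χ x : ℝ) : ℂ) * star (pderiv 0 P x)) with hA
      have dP := (hP.smooth x hx).differentiableAt_of_infty
      have dQ := (cQ' x hx).differentiableAt_of_infty
      have hYd : ∀ i j, pderiv i (Y j) x = ((pderiv j χ x : ℝ) : ℂ)
          * (P x * star (pderiv i Q x) + pderiv i P x * star (Q x))
          + ((pderiv i (pderiv j χ) x : ℝ) : ℂ) * (P x * star (Q x)) := fun i j => by
        simp only [hY]
        rw [pderiv_mul (cχ j x).differentiableAt_of_infty (dP.fun_mul dQ), pderiv_mul dP dQ,
          pderiv_star, pderiv_ofReal (hχ.contDiffAt.pderiv j).differentiableAt_of_infty]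
      have hn := hnav x (hρΩ x hx)
      rw [lameOp_eq lam mu (isOpen_exterior Ω) hw (hρΩ x hx)] at hn
      have n0 := congrArg (fun z : CVec => star (z 0)) hn
      have n1 := congrArg (fun z : CVec => star (z 1)) hn
      simp only [PiLp.add_apply, PiLp.smul_apply, grad_apply_zero, grad_apply_one,
        gradPerp_apply_zero, gradPerp_apply_one, smul_eq_mul, PiLp.zero_apply, RCLike.star_def,
        map_add, map_mul, map_neg, map_zero, map_pow, Complex.conj_ofReal, ← hPdef, ← hQdef]
        at n0 n1
      have key : ((ω ^ 2 : ℝ) : ℂ) * fluxDensity lam mu χ w x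
          = -((((lam + 2 * mu) ^ 2 : ℝ) : ℂ) * (P x * gradDot χ P x)
            + ((mu ^ 2 : ℝ) : ℂ) * (Q x * gradDot χ Q x)
            + (((lam + 2 * mu) * mu : ℝ) : ℂ) * (Z x + (A + star A))) := by
        simp only [fluxDensity, gradDot, hZ, hYd, hA, ← hPdef, ← hQdef, RCLike.star_def, map_mul,
          map_sub, Complex.conj_ofReal, Complex.conj_conj, Complex.ofReal_pow, Complex.ofReal_mul]
        rw [pderiv_comm hχ.contDiffAt 0 1]
        set L : ℂ := ((lam + 2 * mu : ℝ) : ℂ)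
        linear_combination (L * P x * ((pderiv 0 χ x : ℝ) : ℂ)
            - mu * Q x * ((pderiv 1 χ x : ℝ) : ℂ)) * n0
          + (L * P x * ((pderiv 1 χ x : ℝ) : ℂ) + mu * Q x * ((pderiv 0 χ x : ℝ) : ℂ)) * n1
      have := congrArg Complex.im key
      simp only [Complex.im_ofReal_mul, Complex.neg_im, Complex.add_im] at this
      rw [this]
      simp
    · have hx' : ‖x‖ < R₁ := by linarith
      have hU : IsOpen {y : Plane | ‖y‖ < R₁} := isOpen_lt continuous_norm continuous_const
      have z : ∀ i j, pderiv i (Y j) x = 0 := by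
        intro i j
        rw [pderiv_congr_of_isOpen hU (g := fun _ => 0) (Y0 j) hx']
        simp [pderiv]
      simp [fluxDensity, gradDot, hZ, z, h0 x hx']
  have hI : ∫ x, ω ^ 2 * (fluxDensity lam mu χ w x).im
      = -((lam + 2 * mu) ^ 2 * (∫ x, (P x * gradDot χ P x).im)
        + mu ^ 2 * (∫ x, (Q x * gradDot χ Q x).im) + (lam + 2 * mu) * mu * ∫ x, (Z x).im) := by
    simp_rw [hpt]
    have j1 : Integrable fun x => (lam + 2 * mu) ^ 2 * (P x * gradDot χ P x).im :=
      iP.im.const_mul _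
    have j2 : Integrable fun x => mu ^ 2 * (Q x * gradDot χ Q x).im := iQ.im.const_mul _
    have j3 : Integrable fun x => (lam + 2 * mu) * mu * (Z x).im := iZ.im.const_mul _
    rw [integral_neg, integral_add (f := fun x => (lam + 2 * mu) ^ 2 * (P x * gradDot χ P x).im
        + mu ^ 2 * (Q x * gradDot χ Q x).im) (j1.add j2) j3, integral_add j1 j2, integral_const_mul,
      integral_const_mul, integral_const_mul]
  rw [integral_const_mul, hflux, zZ] at hI
  linarith

/-- A radiating solution of Navier's equation that vanishes on the boundary has zero far field
patterns. -/
lemma farFieldPattern_eq_zero {lam mu ω : ℝ} (hmu : 0 < mu) (hlam : 0 < 2 * mu + lam)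
    (hω : 0 < ω) {Ω : Set Plane} (hΩ : Bornology.IsBounded Ω) {w : Plane → CVec}
    (hw : ∀ x ∈ exterior Ω, ContDiffAt ℝ (⊤ : ℕ∞) w x)
    (hnav : ∀ x ∈ exterior Ω, lameOp lam mu w x + ((ω : ℂ) ^ 2) • w x = 0)
    (hH1 : IsH1Loc Ω w) (hvan : VanishesOnBoundary Ω w) (hrad : IsRadiating lam mu ω w)
    {f : Mode → Circle2 → ℂ} (hfar : HasFarFieldPatterns lam mu ω w f) (n : Mode) (θ : Circle2) :
    f n θ = 0 := by
  obtain ⟨ρ, hρ, hρΩ⟩ := exists_radius_exterior hΩ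
  have hout := isOutgoing_potential hmu hlam hω (isOpen_exterior Ω) hw hnav hrad hfar hρ hρΩ
  obtain ⟨χ, η, t, hχ, ht, -, hηpos⟩ := exists_isRadialCutoff
  set a := (lam + 2 * mu) ^ 2 / waveNumber lam mu ω Mode.p with ha
  set b := mu ^ 2 / waveNumber lam mu ω Mode.s with hb
  have hkp := waveNumber_pos hmu hlam hω Mode.p
  have hks := waveNumber_pos hmu hlam hω Mode.s
  have hL : 0 < lam + 2 * mu := by linarith
  have ha0 : 0 < a := by positivity
  have hb0 : 0 < b := by positivity
  set a' := a / waveNumber lam mu ω Mode.p with ha'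
  set b' := b / waveNumber lam mu ω Mode.s with hb'
  have ha'0 : 0 < a' := by positivity
  have hb'0 : 0 < b' := by positivity
  have hsmall : ∀ ε : ℝ, 0 < ε → ∃ R₀ : ℝ, ∀ R : ℝ, R₀ ≤ R →
      a * outflow η R (potential Mode.p w) + b * outflow η R (potential Mode.s w)
        ≤ (a' + b') * ε := by
    intro ε hε
    obtain ⟨R₁, hp⟩ := (hout Mode.p).abs_flux_sub_outflow_le hχ hε
    obtain ⟨R₂, hs⟩ := (hout Mode.s).abs_flux_sub_outflow_le hχ hε
    refine ⟨max (max R₁ R₂) (ρ + 1), fun R hR => ?_⟩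
    obtain ⟨hR12, hRρ⟩ := max_le_iff.1 hR
    obtain ⟨hR1, hR2⟩ := max_le_iff.1 hR12
    have hR0 : 0 < R := by linarith
    have hχs : ContDiff ℝ (⊤ : ℕ∞) (fun x : Plane => χ (R⁻¹ • x)) :=
      hχ.smooth.comp (g := χ) (f := fun x : Plane => R⁻¹ • x) (by fun_prop)
    have hz : ∀ x : Plane, ‖x‖ < R ∨ 2 * R < ‖x‖ → ∀ i, pderiv i (fun x => χ (R⁻¹ • x)) x = 0 :=
      fun x hx i => by
        rw [hχ.pderiv_scaled_eq, hχ.weight_scaled_eq_zero hR0 hx]; simp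
    have hχc : HasCompactSupport (fun x : Plane => χ (R⁻¹ • x)) :=
      hχ.hasCompactSupport.comp_smul (inv_ne_zero hR0.ne')
    have hbal := flux_potential_add_eq_zero hw hnav hH1 hvan hρΩ (hout Mode.p) (hout Mode.s)
      hχs hχc (by linarith : ρ < R) (fun x hx => hz x (Or.inl hx)) (fun x hx => hz x (Or.inr hx))
    have hp' := mul_le_mul_of_nonneg_left (neg_le_of_abs_le (hp R hR1)) ha'0.le
    have hs' := mul_le_mul_of_nonneg_left (neg_le_of_abs_le (hs R hR2)) hb'0.le
    set Ip := ∫ x, (potential Mode.p w x * gradDot (fun x => χ (R⁻¹ • x)) (potential Mode.p w) x).im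
    set Is := ∫ x, (potential Mode.s w x * gradDot (fun x => χ (R⁻¹ • x)) (potential Mode.s w) x).im
    have e1 : a' * (waveNumber lam mu ω Mode.p ^ 2 * Ip
        - waveNumber lam mu ω Mode.p * outflow η R (potential Mode.p w))
        = (lam + 2 * mu) ^ 2 * Ip - a * outflow η R (potential Mode.p w) := by
      rw [ha', ha]; field_simp
    have e2 : b' * (waveNumber lam mu ω Mode.s ^ 2 * Is
        - waveNumber lam mu ω Mode.s * outflow η R (potential Mode.s w))
        = mu ^ 2 * Is - b * outflow η R (potential Mode.s w) := by
      rw [hb', hb]; field_simp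
    rw [e1] at hp'
    rw [e2] at hs'
    linarith
  by_contra hne
  have hne' : farFieldFactor lam mu ω n * f n θ ≠ 0 :=
    mul_ne_zero (farFieldFactor_ne_zero hmu hlam hω n) hne
  obtain ⟨c, R₁, hc, hlow⟩ := (hout n).exists_le_outflow (waveNumber_pos hmu hlam hω n) hχ ht
    (hηpos θ) hne'
  have hmin : 0 < min a b := lt_min ha0 hb0
  obtain ⟨R₂, hup⟩ := hsmall (min a b * c / (2 * (a' + b'))) (by positivity)
  have h1 := hlow (max R₁ R₂) (le_max_left _ _)
  have h2 := hup (max R₁ R₂) (le_max_right _ _)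
  have e : (a' + b') * (min a b * c / (2 * (a' + b'))) = min a b * c / 2 := by field_simp
  rw [e] at h2
  have op := outflow_nonneg hχ (max R₁ R₂) (potential Mode.p w)
  have os := outflow_nonneg hχ (max R₁ R₂) (potential Mode.s w)
  have hmc : 0 < min a b * c := by positivity
  cases n
  · have : min a b * c ≤ a * outflow η (max R₁ R₂) (potential Mode.p w) := by
      gcongr
      exact min_le_left _ _
    have := mul_nonneg hb0.le os
    linarith
  · have : min a b * c ≤ b * outflow η (max R₁ R₂) (potential Mode.s w) := by
      gcongr
      exact min_le_right _ _
    have := mul_nonneg ha0.le op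
    linarith

/-! ### Differences of scattered fields -/

section Difference

variable {u v : Plane → CVec} {U : Set Plane}

lemma grad_potential_sub (hU : IsOpen U) (hu : ∀ x ∈ U, ContDiffAt ℝ (⊤ : ℕ∞) u x)
    (hv : ∀ x ∈ U, ContDiffAt ℝ (⊤ : ℕ∞) v x) (n : Mode) {x : Plane} (hx : x ∈ U) :
    grad (potential n (fun y => u y - v y)) x
      = grad (potential n u) x - grad (potential n v) x := by
  have h1 : ∀ y ∈ U, potential n (fun y => u y - v y) y = potential n u y - potential n v y := by
    intro y hy
    have du : ∀ j, DifferentiableAt ℝ (fun y => u y j) y := fun j =>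
      ((hu y hy).coord j).differentiableAt_of_infty
    have dv : ∀ j, DifferentiableAt ℝ (fun y => v y j) y := fun j =>
      ((hv y hy).coord j).differentiableAt_of_infty
    cases n
    · simp only [potential, dvg, PiLp.sub_apply, pderiv_sub (du _) (dv _)]
      ring
    · simp only [potential, dvgPerp, PiLp.sub_apply, pderiv_sub (du _) (dv _)]
      ring
  have h2 : ∀ i, pderiv i (potential n (fun y => u y - v y)) x
      = pderiv i (potential n u) x - pderiv i (potential n v) x := fun i => by
    rw [pderiv_congr_of_isOpen hU h1 hx,
      pderiv_sub (contDiffAt_potential (hu x hx) n).differentiableAt_of_infty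
        (contDiffAt_potential (hv x hx) n).differentiableAt_of_infty]
  ext i
  fin_cases i
  · exact h2 0
  · exact h2 1

lemma wavePart_sub (lam mu ω : ℝ) (hU : IsOpen U) (hu : ∀ x ∈ U, ContDiffAt ℝ (⊤ : ℕ∞) u x)
    (hv : ∀ x ∈ U, ContDiffAt ℝ (⊤ : ℕ∞) v x) (n : Mode) {x : Plane} (hx : x ∈ U) :
    wavePart lam mu ω n (fun y => u y - v y) x
      = wavePart lam mu ω n u x - wavePart lam mu ω n v x := by
  simp only [wavePart_eq, grad_potential_sub hU hu hv n hx, map_sub, smul_sub]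

lemma fderiv_wavePart_sub (lam mu ω : ℝ) (hU : IsOpen U)
    (hu : ∀ x ∈ U, ContDiffAt ℝ (⊤ : ℕ∞) u x) (hv : ∀ x ∈ U, ContDiffAt ℝ (⊤ : ℕ∞) v x)
    (n : Mode) {x : Plane} (hx : x ∈ U) (e : Plane) :
    fderiv ℝ (wavePart lam mu ω n (fun y => u y - v y)) x e
      = fderiv ℝ (wavePart lam mu ω n u) x e - fderiv ℝ (wavePart lam mu ω n v) x e := by
  have h1 : grad (potential n (fun y => u y - v y))
      =ᶠ[nhds x] fun y => grad (potential n u) y - grad (potential n v) y :=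
    Filter.eventuallyEq_of_mem (hU.mem_nhds hx) fun y hy => grad_potential_sub hU hu hv n hy
  rw [fderiv_wavePart lam mu ω ((hu x hx).sub (hv x hx)), fderiv_wavePart lam mu ω (hu x hx),
    fderiv_wavePart lam mu ω (hv x hx), h1.fderiv_eq, fderiv_fun_sub
      (contDiffAt_grad (contDiffAt_potential (hu x hx) n)).differentiableAt_of_infty
      (contDiffAt_grad (contDiffAt_potential (hv x hx) n)).differentiableAt_of_infty,
    _root_.sub_apply, map_sub, smul_sub]

lemma lameOp_sub (lam mu : ℝ) (hU : IsOpen U) (hu : ∀ x ∈ U, ContDiffAt ℝ (⊤ : ℕ∞) u x)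
    (hv : ∀ x ∈ U, ContDiffAt ℝ (⊤ : ℕ∞) v x) {x : Plane} (hx : x ∈ U) :
    lameOp lam mu (fun y => u y - v y) x = lameOp lam mu u x - lameOp lam mu v x := by
  rw [lameOp_eq lam mu hU hu hx, lameOp_eq lam mu hU hv hx,
    lameOp_eq lam mu hU (fun y hy => (hu y hy).sub (hv y hy)) hx,
    grad_potential_sub hU hu hv _ hx]
  have h := grad_potential_sub hU hu hv Mode.s hx
  have h0 := congrArg (fun z : CVec => z 0) h
  have h1 := congrArg (fun z : CVec => z 1) h
  simp only [grad_apply_zero, grad_apply_one, PiLp.sub_apply] at h0 h1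
  ext i
  fin_cases i
  · simp [h1]; ring
  · simp [h0]; ring

variable {Ω : Set Plane}

lemma IsH1Loc.sub (hu : IsH1Loc Ω u) (hv : IsH1Loc Ω v)
    (cu : ∀ x ∈ exterior Ω, ContDiffAt ℝ (⊤ : ℕ∞) u x)
    (cv : ∀ x ∈ exterior Ω, ContDiffAt ℝ (⊤ : ℕ∞) v x) : IsH1Loc Ω (fun x => u x - v x) := by
  intro R
  refine ⟨(hu R).1.sub (hv R).1, fun i => (((hu R).2 i).sub ((hv R).2 i)).ae_eq ?_⟩
  filter_upwards [ae_restrict_mem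
    (Metric.isOpen_ball.inter (isOpen_exterior Ω)).measurableSet] with x hx
  exact (pderiv_sub (cu x hx.2).differentiableAt_of_infty
    (cv x hx.2).differentiableAt_of_infty i).symm

lemma VanishesOnBoundary.sub (hu : VanishesOnBoundary Ω u) (hv : VanishesOnBoundary Ω v)
    (cu : ∀ x ∈ exterior Ω, ContDiffAt ℝ (⊤ : ℕ∞) u x)
    (cv : ∀ x ∈ exterior Ω, ContDiffAt ℝ (⊤ : ℕ∞) v x) :
    VanishesOnBoundary Ω (fun x => u x - v x) := by
  intro χ hχ hχc ε hε
  obtain ⟨φ, hφ, hφc, hφΩ, a0, a1⟩ := hu χ hχ hχc (ε / 2) (ENNReal.half_pos hε.ne')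
  obtain ⟨ψ, hψ, hψc, hψΩ, b0, b1⟩ := hv χ hχ hχc (ε / 2) (ENNReal.half_pos hε.ne')
  have hm := (isOpen_exterior Ω).measurableSet
  have meas : ∀ f : Plane → CVec, (∀ x ∈ exterior Ω, ContDiffAt ℝ (⊤ : ℕ∞) f x) →
      AEStronglyMeasurable f (volume.restrict (exterior Ω)) := fun f hf =>
    ContinuousOn.aestronglyMeasurable (fun x hx => (hf x hx).continuousAt.continuousWithinAt) hm
  have cχu : ∀ x ∈ exterior Ω, ContDiffAt ℝ (⊤ : ℕ∞) (fun x => χ x • u x) x := fun x hx =>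
    hχ.contDiffAt.smul (cu x hx)
  have cχv : ∀ x ∈ exterior Ω, ContDiffAt ℝ (⊤ : ℕ∞) (fun x => χ x • v x) x := fun x hx =>
    hχ.contDiffAt.smul (cv x hx)
  refine ⟨fun x => φ x - ψ x, hφ.sub hψ, hφc.sub hψc, ?_, ?_, fun i => ?_⟩
  · exact (tsupport_sub φ ψ).trans (Set.union_subset hφΩ hψΩ)
  · have e : (fun x => χ x • (u x - v x) - (φ x - ψ x))
        = (fun x => χ x • u x - φ x) - fun x => χ x • v x - ψ x := by
      funext x
      simp only [Pi.sub_apply, smul_sub]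
      abel
    rw [e, ← ENNReal.add_halves ε]
    exact (eLpNorm_sub_le (meas _ fun x hx => (cχu x hx).sub hφ.contDiffAt)
      (meas _ fun x hx => (cχv x hx).sub hψ.contDiffAt) one_le_two).trans (add_le_add a0 b0)
  · have e : (fun x => pderiv i (fun y => χ y • (u y - v y)) x - pderiv i (fun x => φ x - ψ x) x)
        =ᵐ[volume.restrict (exterior Ω)]
        (fun x => pderiv i (fun y => χ y • u y) x - pderiv i φ x)
          - fun x => pderiv i (fun y => χ y • v y) x - pderiv i ψ x := by
      filter_upwards [ae_restrict_mem hm] with x hx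
      simp only [Pi.sub_apply, smul_sub]
      rw [pderiv_sub (cχu x hx).differentiableAt_of_infty (cχv x hx).differentiableAt_of_infty,
        pderiv_sub hφ.contDiffAt.differentiableAt_of_infty
          hψ.contDiffAt.differentiableAt_of_infty]
      abel
    rw [eLpNorm_congr_ae e, ← ENNReal.add_halves ε]
    exact (eLpNorm_sub_le
      (meas _ fun x hx => ((cχu x hx).pderiv i).sub (hφ.contDiffAt.pderiv i))
      (meas _ fun x hx => ((cχv x hx).pderiv i).sub (hψ.contDiffAt.pderiv i))
      one_le_two).trans (add_le_add (a1 i) (b1 i))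

lemma IsRadiating.sub {lam mu ω : ℝ} (hu : IsRadiating lam mu ω u) (hv : IsRadiating lam mu ω v)
    (hΩ : Bornology.IsBounded Ω) (cu : ∀ x ∈ exterior Ω, ContDiffAt ℝ (⊤ : ℕ∞) u x)
    (cv : ∀ x ∈ exterior Ω, ContDiffAt ℝ (⊤ : ℕ∞) v x) :
    IsRadiating lam mu ω (fun x => u x - v x) := by
  intro n ε hε
  obtain ⟨ρ, hρ, hρΩ⟩ := exists_radius_exterior hΩ
  obtain ⟨R₁, hR₁, h1⟩ := hu n (ε / 2) (half_pos hε)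
  obtain ⟨R₂, -, h2⟩ := hv n (ε / 2) (half_pos hε)
  refine ⟨max (max R₁ R₂) (ρ + 1), hR₁.trans_le ((le_max_left _ _).trans (le_max_left _ _)),
    fun r hr θ => ?_⟩
  obtain ⟨hr12, hrρ⟩ := max_le_iff.1 hr
  obtain ⟨hr1, hr2⟩ := max_le_iff.1 hr12
  have hx : r • (θ : Plane) ∈ exterior Ω :=
    hρΩ _ (by rw [θ.norm_smul_of_nonneg (by linarith)]; linarith)
  rw [wavePart_sub lam mu ω (isOpen_exterior Ω) cu cv n hx,
    fderiv_wavePart_sub lam mu ω (isOpen_exterior Ω) cu cv n hx, smul_sub, sub_sub_sub_comm,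
    ← add_halves ε, add_div]
  exact (norm_sub_le _ _).trans (add_le_add (h1 r hr1 θ) (h2 r hr2 θ))

lemma HasFarFieldPatterns.sub {lam mu ω : ℝ} {f g : Mode → Circle2 → ℂ}
    (hu : HasFarFieldPatterns lam mu ω u f) (hv : HasFarFieldPatterns lam mu ω v g)
    (hΩ : Bornology.IsBounded Ω) (cu : ∀ x ∈ exterior Ω, ContDiffAt ℝ (⊤ : ℕ∞) u x)
    (cv : ∀ x ∈ exterior Ω, ContDiffAt ℝ (⊤ : ℕ∞) v x) :
    HasFarFieldPatterns lam mu ω (fun x => u x - v x) (fun n θ => f n θ - g n θ) := by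
  intro n
  obtain ⟨ρ, hρ, hρΩ⟩ := exists_radius_exterior hΩ
  obtain ⟨C₁, R₁, hR₁, h1⟩ := hu n
  obtain ⟨C₂, R₂, -, h2⟩ := hv n
  refine ⟨C₁ + C₂, max (max R₁ R₂) (ρ + 1),
    hR₁.trans_le ((le_max_left _ _).trans (le_max_left _ _)), fun r hr θ => ?_⟩
  obtain ⟨hr12, hrρ⟩ := max_le_iff.1 hr
  obtain ⟨hr1, hr2⟩ := max_le_iff.1 hr12
  have hx : r • (θ : Plane) ∈ exterior Ω :=
    hρΩ _ (by rw [θ.norm_smul_of_nonneg (by linarith)]; linarith)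
  rw [wavePart_sub lam mu ω (isOpen_exterior Ω) cu cv n hx, mul_sub, sub_smul, sub_sub_sub_comm,
    add_mul]
  exact (norm_sub_le _ _).trans (add_le_add (h1 r hr1 θ) (h2 r hr2 θ))

end Difference

lemma contDiffAt_planeWave (lam mu ω : ℝ) (m : Mode) (d x : Plane) :
    ContDiffAt ℝ (⊤ : ℕ∞) (planeWave lam mu ω m d) x := by
  have h1 : ContDiff ℝ (⊤ : ℕ∞) fun x : Plane => waveNumber lam mu ω m * inner ℝ x d :=
    contDiff_const.mul (contDiff_id.inner ℝ contDiff_const)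
  have h2 : ContDiff ℝ (⊤ : ℕ∞)
      fun x : Plane => ((waveNumber lam mu ω m * inner ℝ x d : ℝ) : ℂ) :=
    Complex.ofRealCLM.contDiff.comp h1
  exact ((contDiff_const.mul h2).cexp.smul contDiff_const).contDiffAt

/-! ### Uniqueness of the far field patterns -/

/-- The difference of two scattered fields vanishes on the boundary and radiates, so its far field
patterns are zero. -/
lemma AreFarFieldPatterns.eq {lam mu ω : ℝ} (hmu : 0 < mu) (hlam : 0 < 2 * mu + lam) (hω : 0 < ω)
    {Ω : Set Plane} (hΩ : Bornology.IsBounded Ω) {m : Mode} {d : Plane}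
    {f g : Mode → Circle2 → ℂ} (hf : AreFarFieldPatterns lam mu ω Ω m d f)
    (hg : AreFarFieldPatterns lam mu ω Ω m d g) : f = g := by
  obtain ⟨u, hu, huf⟩ := hf
  obtain ⟨v, hv, hvg⟩ := hg
  have cu : ∀ x ∈ exterior Ω, ContDiffAt ℝ (⊤ : ℕ∞) u x := fun x hx => hu.contDiffAt hx
  have cv : ∀ x ∈ exterior Ω, ContDiffAt ℝ (⊤ : ℕ∞) v x := fun x hx => hv.contDiffAt hx
  have hnav : ∀ x ∈ exterior Ω, lameOp lam mu (fun y => u y - v y) x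
      + ((ω : ℂ) ^ 2) • (u x - v x) = 0 := fun x hx => by
    rw [lameOp_sub lam mu (isOpen_exterior Ω) cu cv hx, smul_sub, ← add_sub_add_comm,
      hu.navier x hx, hv.navier x hx, sub_zero]
  have hvan : VanishesOnBoundary Ω (fun x => u x - v x) := by
    have := hu.dirichlet.sub hv.dirichlet
      (fun x hx => (cu x hx).add (contDiffAt_planeWave lam mu ω m d x))
      (fun x hx => (cv x hx).add (contDiffAt_planeWave lam mu ω m d x))
    simpa only [add_sub_add_right_eq_sub] using this
  funext n θ
  exact sub_eq_zero.1 (farFieldPattern_eq_zero hmu hlam hω hΩ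
    (fun x hx => (cu x hx).sub (cv x hx)) hnav (hu.h1Loc.sub hv.h1Loc cu cv) hvan
    (hu.radiating.sub hv.radiating hΩ cu cv) (huf.sub hvg hΩ cu cv) n θ)

lemma isBounded_shifted {Ω : Set Plane} (hΩ : Bornology.IsBounded Ω) (h : Plane) :
    Bornology.IsBounded (shifted Ω h) := by
  obtain ⟨ρ, hρ⟩ := hΩ.exists_norm_le
  refine isBounded_iff_forall_norm_le.2 ⟨ρ + ‖h‖, ?_⟩
  rintro _ ⟨z, hz, rfl⟩
  exact (norm_add_le _ _).trans (by linarith [hρ z hz])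

lemma norm_phaseFactor (lam mu ω : ℝ) (m n : Mode) (h d θ : Plane) :
    ‖phaseFactor lam mu ω m n h d θ‖ = 1 := by
  rw [phaseFactor, norm_mul, Complex.norm_exp_I_mul_ofReal', Complex.exp_neg, norm_inv,
    Complex.norm_exp_I_mul_ofReal', inv_one, one_mul]

end

theorem theorem2p2 (lam mu : ℝ) (hmu : 0 < mu) (hlam : 0 < 2 * mu + lam)
    (Ω : Set Plane) (hΩ : IsRigidBody Ω) (h : Plane)
    (ω : ℝ) (hω : 0 < ω) (m : Mode) (d : Circle2) :
    -- shifting the body multiplies far field patterns by the explicit phase factors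
    (∀ f : Mode → Circle2 → ℂ,
      AreFarFieldPatterns lam mu ω Ω m d f →
      AreFarFieldPatterns lam mu ω (shifted Ω h) m d
        (fun n θ => phaseFactor lam mu ω m n h d θ * f n θ)) ∧
    -- any far field patterns of the two bodies have equal moduli and differ by these factors
    (∀ f g : Mode → Circle2 → ℂ,
      AreFarFieldPatterns lam mu ω Ω m d f →
      AreFarFieldPatterns lam mu ω (shifted Ω h) m d g →
      ∀ (n : Mode) (θ : Circle2),
        ‖g n θ‖ = ‖f n θ‖ ∧ g n θ = phaseFactor lam mu ω m n h d θ * f n θ) := by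
  refine ⟨fun f hf => hf.shifted hmu hlam hω hΩ.isBounded h, fun f g hf hg n θ => ?_⟩
  have e : g n θ = phaseFactor lam mu ω m n h d θ * f n θ :=
    congrFun (congrFun (hg.eq hmu hlam hω (isBounded_shifted hΩ.isBounded h)
      (hf.shifted hmu hlam hω hΩ.isBounded h)) n) θ
  exact ⟨by rw [e, norm_mul, norm_phaseFactor, one_mul], e⟩
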